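/- Let $\sigma\in\{1,-1\}$. Write $\langle x\rangle=(1+x^2)^{1/2}$, $L^{2,s}(\mathbb R)=\{f:\langle x\rangle^s f\in L^2(\mathbb R)\}$, $H^{1,1}(\mathbb R)=\{f\in L^{2,1}(\mathbb R): f'\in L^{2,1}(\mathbb R)\}$ (weak derivative), $X=H^{1,1}(\mathbb R)\cap H^3(\mathbb R)$ and $Y=H^{1,1}(\mathbb R)\cap L^{2,3}(\mathbb R)$ (complex-valued functions, with the natural norms). For $u\in X$ consider the spectral problem $$\psi_x-iz\sigma_3\psi=Q\psi,\qquad Q(x)=\begin{pmatrix}0&u(x)\\-\sigma u(-x)&0\end{pmatrix},\qquad \sigma_3=\begin{pmatrix}1&0\\0&-1\end{pmatrix},\qquad z\in\mathbb R.$$ Its Jost functions are $\psi^\pm(x,z)=m^\pm(x,z)e^{izx\sigma_3}$, where $m^\pm(\cdot,z)$ is the bounded continuous solution of $$m^\pm(x,z)=I+\int_{\pm\infty}^x e^{-iz(y-x)\sigma_3}\,Q(y)m^\pm(y,z)\,e^{iz(y-x)\sigma_3}\,dy .$$ The scattering matrix $S(z)=\begin{pmatrix}a(z)&c(z)\\ b(z)&d(z)\end{pmatrix}$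 is defined by $\psi^+(x,z)=\psi^-(x,z)S(z)$, and the reflection coefficients are $r_1=b/a$ and $r_2=c/d$. Call $u\in X$ regular if $a(z)\neq0$ and $d(z)\ne0$ for all $z\in\mathbb R$ (in particular, $u$ is regular if the spectral problem has no eigenvalues or resonances). Then: 1. If $u\in X$ is regular, then $r_1,r_2\in Y$. 2. The map $u\mapsto(r_1,r_2)$ from the regular potentials in $X$ to $Y\times Y$ is Lipschitz continuous in the following sense. For all $U,\delta>0$ there is a constant $C>0$, depending only on $U$, $\delta$ and $\sigma$, such that for all $u,\tilde u\in X$ of norm at most $U$ whose coefficients satisfy $|a|,|d|,|\tilde a|,|\tilde d|\ge\delta$ on $\mathbb R$, $$\|r_1-\tilde r_1\|_Y+\|r_2-\tilde r_2\|_Y\le C\,\|u-\tilde u\|_X .$$ Moreover, the set of regular potentials is open in $X$, and every regular potential has a neighbourhood in $X$ on which such an estimate holds with one constant $C$. -/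

import Mathlib

open MeasureTheory Set
open scoped ContDiff

namespace NonlocalMKdV

noncomputable section

/-! ## Weak derivatives and the function spaces -/

/-- `g` is a weak (distributional) derivative of `f` on the real line. -/
def HasWeakDeriv (f g : ℝ → ℂ) : Prop :=
  LocallyIntegrable f ∧ LocallyIntegrable g ∧
    ∀ φ : ℝ → ℝ, ContDiff ℝ ∞ φ → HasCompactSupport φ →
      ∫ x, deriv φ x • f x = -∫ x, φ x • g x

open Classical in
/-- The weak derivative of `f` (unique up to null sets when it exists; `0` if there is none). -/
def weakDeriv (f : ℝ → ℂ) : ℝ → ℂ :=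
  if h : ∃ g, HasWeakDeriv f g then h.choose else 0

/-- The function `x ↦ ⟨x⟩ ^ s * f x`, where `⟨x⟩ = (1 + x ^ 2) ^ (1 / 2)`. -/
def weighted (s : ℕ) (f : ℝ → ℂ) : ℝ → ℂ :=
  fun x => (Real.sqrt (1 + x ^ 2) ^ s) • f x

/-- The norm of the weighted space `L^{2,s}(ℝ)`. -/
def normL2w (s : ℕ) (f : ℝ → ℂ) : ℝ := (eLpNorm (weighted s f) 2 volume).toReal

/-- Membership in `L^{2,s}(ℝ)`. -/
def MemL2w (s : ℕ) (f : ℝ → ℂ) : Prop := MemLp (weighted s f) 2 volume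

/-- Membership in `H^{1,1}(ℝ) = {f ∈ L^{2,1}(ℝ) : f' ∈ L^{2,1}(ℝ)}`. -/
def MemH11 (f : ℝ → ℂ) : Prop :=
  MemL2w 1 f ∧ (∃ g, HasWeakDeriv f g) ∧ MemL2w 1 (weakDeriv f)

/-- The norm of `H^{1,1}(ℝ)`. -/
def normH11 (f : ℝ → ℂ) : ℝ := normL2w 1 f + normL2w 1 (weakDeriv f)

/-- Membership in the Sobolev space `H^k(ℝ)`: the weak derivatives of order at most `k` exist and
are square integrable. -/
def MemH (k : ℕ) (f : ℝ → ℂ) : Prop :=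
  (∀ j < k, ∃ g, HasWeakDeriv (weakDeriv^[j] f) g) ∧
    ∀ j ≤ k, MemLp (weakDeriv^[j] f) 2 volume

/-- The norm of `H^k(ℝ)` (the sum of the `L^2` norms of the derivatives). -/
def normH (k : ℕ) (f : ℝ → ℂ) : ℝ :=
  ∑ j ∈ Finset.range (k + 1), (eLpNorm (weakDeriv^[j] f) 2 volume).toReal

/-- Potentials: `H^{1,1}(ℝ) ∩ H^3(ℝ)`. -/
def MemX (u : ℝ → ℂ) : Prop := MemH11 u ∧ MemH 3 u

/-- The norm of `H^{1,1}(ℝ) ∩ H^3(ℝ)`. -/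
def normX (u : ℝ → ℂ) : ℝ := normH11 u + normH 3 u

/-- Reflection coefficients: `H^{1,1}(ℝ) ∩ L^{2,3}(ℝ)`. -/
def MemY (r : ℝ → ℂ) : Prop := MemH11 r ∧ MemL2w 3 r

/-- The norm of `H^{1,1}(ℝ) ∩ L^{2,3}(ℝ)`. -/
def normY (r : ℝ → ℂ) : ℝ := normH11 r + normL2w 3 r

/-! ## Direct scattering for `ψ_x - i z σ₃ ψ = Q ψ` -/

/-- The potential matrix `Q(x)`. -/
def Q (σ : ℝ) (u : ℝ → ℂ) (x : ℝ) : Matrix (Fin 2) (Fin 2) ℂ :=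
  !![0, u x; -(σ : ℂ) * u (-x), 0]

/-- The matrix `e^{i t σ₃}`. -/
def expSigma3 (t : ℝ) : Matrix (Fin 2) (Fin 2) ℂ :=
  !![Complex.exp (Complex.I * t), 0; 0, Complex.exp (-(Complex.I * t))]

/-- The integrand `e^{-i z (y - x) ad σ₃} (Q(y) m(y))` of the Volterra equations, where
`e^{ad A} B = e^A B e^{-A}`. -/
def volterraIntegrand (σ : ℝ) (u : ℝ → ℂ) (z : ℝ) (m : ℝ → Matrix (Fin 2) (Fin 2) ℂ) (x y : ℝ) :
    Matrix (Fin 2) (Fin 2) ℂ :=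
  expSigma3 (-(z * (y - x))) * (Q σ u y * m y) * expSigma3 (z * (y - x))

/-- `m` is continuous and bounded on the real line. -/
def BoundedContinuous (m : ℝ → Matrix (Fin 2) (Fin 2) ℂ) : Prop :=
  Continuous m ∧ ∃ C : ℝ, ∀ x i j, ‖m x i j‖ ≤ C

/-- `m` is the normalized Jost function `m⁺(·, z) = ψ⁺(·, z) e^{-i z x σ₃}`, i.e. the bounded
solution of the Volterra equation based at `+∞`. -/
def IsJostPlus (σ : ℝ) (u : ℝ → ℂ) (z : ℝ) (m : ℝ → Matrix (Fin 2) (Fin 2) ℂ) : Prop :=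
  BoundedContinuous m ∧ ∀ x i j,
    m x i j = (1 : Matrix (Fin 2) (Fin 2) ℂ) i j - ∫ y in Ioi x, volterraIntegrand σ u z m x y i j

/-- `m` is the normalized Jost function `m⁻(·, z) = ψ⁻(·, z) e^{-i z x σ₃}`, i.e. the bounded
solution of the Volterra equation based at `-∞`. -/
def IsJostMinus (σ : ℝ) (u : ℝ → ℂ) (z : ℝ) (m : ℝ → Matrix (Fin 2) (Fin 2) ℂ) : Prop :=
  BoundedContinuous m ∧ ∀ x i j,
    m x i j = (1 : Matrix (Fin 2) (Fin 2) ℂ) i j + ∫ y in Iic x, volterraIntegrand σ u z m x y i j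

open Classical in
/-- The Jost function `m⁺(·, z)` (it exists and is unique for integrable `u`). -/
def jostPlus (σ : ℝ) (u : ℝ → ℂ) (z : ℝ) : ℝ → Matrix (Fin 2) (Fin 2) ℂ :=
  if h : ∃ m, IsJostPlus σ u z m then h.choose else 0

open Classical in
/-- The Jost function `m⁻(·, z)` (it exists and is unique for integrable `u`). -/
def jostMinus (σ : ℝ) (u : ℝ → ℂ) (z : ℝ) : ℝ → Matrix (Fin 2) (Fin 2) ℂ :=
  if h : ∃ m, IsJostMinus σ u z m then h.choose else 0

/-- The scattering matrix `S(z)`, defined by `ψ⁺(x, z) = ψ⁻(x, z) S(z)` for all `x`. Both `ψ^±` solve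
the same linear system and `det ψ^± = 1`, so it is read off at `x = 0`, where `ψ^± = m^±`. -/
def scatteringMatrix (σ : ℝ) (u : ℝ → ℂ) (z : ℝ) : Matrix (Fin 2) (Fin 2) ℂ :=
  (jostMinus σ u z 0)⁻¹ * jostPlus σ u z 0

/-- The scattering coefficient `a = S₁₁`. -/
def a (σ : ℝ) (u : ℝ → ℂ) (z : ℝ) : ℂ := scatteringMatrix σ u z 0 0

/-- The scattering coefficient `b = S₂₁`. -/
def b (σ : ℝ) (u : ℝ → ℂ) (z : ℝ) : ℂ := scatteringMatrix σ u z 1 0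

/-- The scattering coefficient `c = S₁₂`. -/
def c (σ : ℝ) (u : ℝ → ℂ) (z : ℝ) : ℂ := scatteringMatrix σ u z 0 1

/-- The scattering coefficient `d = S₂₂`. -/
def d (σ : ℝ) (u : ℝ → ℂ) (z : ℝ) : ℂ := scatteringMatrix σ u z 1 1

/-- The reflection coefficient `r₁ = b / a`. -/
def r₁ (σ : ℝ) (u : ℝ → ℂ) (z : ℝ) : ℂ := b σ u z / a σ u z

/-- The reflection coefficient `r₂ = c / d`. -/
def r₂ (σ : ℝ) (u : ℝ → ℂ) (z : ℝ) : ℂ := c σ u z / d σ u z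

/-- The spectral problem has no spectral singularity on the real line, so that both reflection
coefficients are defined at every real `z`. -/
def Regular (σ : ℝ) (u : ℝ → ℂ) : Prop := ∀ z : ℝ, a σ u z ≠ 0 ∧ d σ u z ≠ 0

/-- Quantitative form: `|a|` and `|d|` are at least `δ` on the real line. -/
def RegularWith (δ : ℝ) (σ : ℝ) (u : ℝ → ℂ) : Prop :=
  ∀ z : ℝ, δ ≤ ‖a σ u z‖ ∧ δ ≤ ‖d σ u z‖

end

end NonlocalMKdV

/-! Removing the phases from the Jost function (`A = m₁₁`, `B = e^{2izx} m₂₁`) turns the first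
column of `m⁺` into the system `A' = e^{-iκzx} u B`, `B' = e^{iκzx} v A` with `κ = 2`, `v(x) = -σ
u(-x)`. It equals `(1, 0)` at `+∞`, and Wronskians with the columns of `m⁻` show that it tends to
`(a, b)` at `-∞`. The second column gives `(d, c)` from the same system with `κ = -2` and `u`, `v`
exchanged. Only this model has to be studied, and `u`, `v` may be treated as independent.

Smoothness in `z`. With an adjoint solution `Θ` normalised at `-∞`, the limits `n(z)` at `-∞`
satisfy `n(z) - n(w) = ∫ Θ_z (P_w - P_z) N_w`. For `w = z + h` the middle factor is a sum of two
terms, each a phase `e^{±iκzy}` times a function that does not depend on `z` and has `L²` norm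
`O(|h|)`, by the weight in the norm of the potential. The outer factors depend on `z`, but their
derivatives in `y` are bounded by a fixed integrable function. Integrating by parts onto truncated
Fourier integrals therefore leaves a majorant built from a single function (`norm_integral_osc_le`),
to which Plancherel applies (`eLpNorm_majorant_le`). Hence translations of `a` and `b` are Lipschitz
in `L²`, which for a continuous function yields a weak derivative in `L²`
(`TransLip.exists_hasWeakDeriv`).

Decay in `z`. Multiplying `∫ e^{iκzy} g A` by `-iκz` amounts to replacing `g` by `g' - (∫_{-∞}^x g
u) v` (`tendsto_osc_recursion`). Starting from `v`, three steps use three derivatives of `v` and put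
`z³ b` in `L²`. After one step the function `g₁` still has a weight, so adjoining `D' = e^{iκzx} g₁
A` as a third component of the system shows that `z b` is also Lipschitz under translation in `L²`.
One integration by parts gives `z (a - 1)` bounded.

Lipschitz dependence. All these bounds hold for coefficients in any finite-dimensional normed
algebra. Two scalar problems at distance at most `ε` form one problem over lower triangular 2×2
matrices with entries `s`, `t` and `(t - s)/ε`; its data are bounded independently of `ε` (`pair`,
`ModelSolution.pair`). Reading off the lower left entry of `a`, `b` and of `b/a` gives estimates of
differences proportional to `ε`, so no estimate is proved twice (`exists_reflectionBounds`).
Membership of `r₁`, `r₂` in `Y` is the comparison with the zero potential.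

Regularity. Since `z (a - 1)` and `z (d - 1)` are bounded, `a` and `d` stay away from zero at
infinity, so regularity implies a uniform lower bound. As `a` and `d` are Lipschitz in the potential
for the uniform norm, this bound survives, halved, in a neighbourhood. -/

namespace AKNS
open Filter Topology FourierTransform
open scoped ENNReal

/-! ## Phases -/

/-- The phase `e^{it}`. -/
noncomputable def ph (t : ℝ) : ℂ := Complex.exp (Complex.I * t)

lemma norm_ph (t : ℝ) : ‖ph t‖ = 1 := by
  rw [ph, mul_comm]; exact Complex.norm_exp_ofReal_mul_I t

lemma ph_add (s t : ℝ) : ph (s + t) = ph s * ph t := by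
  simp [ph, mul_add, Complex.exp_add]

@[simp] lemma ph_zero : ph 0 = 1 := by simp [ph]

lemma ph_neg_mul_self (t : ℝ) : ph (-t) * ph t = 1 := by rw [← ph_add]; simp

lemma ph_mul_neg_self (t : ℝ) : ph t * ph (-t) = 1 := by rw [← ph_add]; simp

@[fun_prop] lemma continuous_ph : Continuous ph := by unfold ph; fun_prop

lemma norm_ph_sub_one_le (t : ℝ) : ‖ph t - 1‖ ≤ |t| := by
  rw [ph]; exact Real.norm_exp_I_mul_ofReal_sub_one_le

lemma hasDerivAt_ph (k x : ℝ) :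
    HasDerivAt (fun x => ph (k * x)) (Complex.I * k * ph (k * x)) x := by
  have h : HasDerivAt (fun x : ℝ => Complex.I * ((k * x : ℝ) : ℂ)) (Complex.I * k) x := by
    have := ((hasDerivAt_id x).const_mul k).ofReal_comp.const_mul Complex.I
    simpa using this
  have := h.cexp
  unfold ph
  convert this using 1
  ring

lemma norm_ph_smul {E : Type*} [NormedAddCommGroup E] [NormedSpace ℂ E] (t : ℝ) (x : E) :
    ‖ph t • x‖ = ‖x‖ := by rw [norm_smul, norm_ph, one_mul]

/-! ## The Plancherel estimate -/

/-- Plancherel is available for the Fourier transform of `L²` classes. That transform agrees with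
the integral one: against every test function both give the same pairing, the first through tempered
distributions and the second because the Fourier kernel can be moved to the other factor. -/
lemma eLpNorm_fourier_eq {F : Type*} [NormedAddCommGroup F] [InnerProductSpace ℂ F]
    [CompleteSpace F] {g : ℝ → F} (h1 : Integrable g) (h2 : MemLp g 2 volume) :
    eLpNorm (𝓕 g) 2 volume = eLpNorm g 2 volume := by
  have hcont : Continuous (𝓕 g) :=
    VectorFourier.fourierIntegral_continuous Real.continuous_fourierChar
      (L := innerₗ ℝ) continuous_inner h1
  have key : (𝓕 (h2.toLp g) : Lp (α := ℝ) F 2 volume) =ᵐ[volume] 𝓕 g := by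
    apply ae_eq_of_integral_contDiff_smul_eq (μ := volume)
    · exact (Lp.memLp _).locallyIntegrable (by norm_num)
    · exact hcont.locallyIntegrable
    · intro φ hφ hφc
      have hφ₁ : HasCompactSupport (Complex.ofRealCLM ∘ φ) := hφc.comp_left rfl
      have hφ₂ : ContDiff ℝ ∞ (Complex.ofRealCLM ∘ φ) := by fun_prop
      set Φ := hφ₁.toSchwartzMap hφ₂ with hΦ
      have e1 := congrArg (fun T => T Φ) (Lp.fourier_toTemperedDistribution_eq (h2.toLp g))
      simp only [TemperedDistribution.fourier_apply, Lp.toTemperedDistribution_apply] at e1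
      have e2 : ∫ x, (Φ x) • 𝓕 g x = ∫ x, 𝓕 (Φ : ℝ → ℂ) x • g x :=
        (by simpa using! (VectorFourier.integral_fourierIntegral_smul_eq_flip (L := innerₗ ℝ)
          (μ := volume) (ν := volume)
          Real.continuous_fourierChar continuous_inner Φ.integrable h1).symm)
      have e3 : ∫ x, (𝓕 Φ) x • (h2.toLp g) x = ∫ x, 𝓕 (Φ : ℝ → ℂ) x • g x := by
        apply integral_congr_ae
        filter_upwards [h2.coeFn_toLp] with x hx
        rw [hx, SchwartzMap.fourier_coe]
      have hc : ∀ x, Φ x = (φ x : ℂ) := fun x => rfl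
      rw [e3, ← e2] at e1
      simp only [hc, Complex.coe_smul] at e1
      exact e1.symm
  rw [← eLpNorm_congr_ae key, ← eLpNorm_congr_ae h2.coeFn_toLp]
  have := Lp.norm_fourier_eq (h2.toLp g)
  rw [Lp.norm_def, Lp.norm_def] at this
  exact (ENNReal.toReal_eq_toReal_iff' (Lp.eLpNorm_ne_top _) (Lp.eLpNorm_ne_top _)).1 this

lemma eLpNorm_comp_mul_left {F : Type*} [NormedAddCommGroup F] (f : ℝ → F) {c : ℝ} (hc : c ≠ 0) :
    eLpNorm (fun z => f (c * z)) 2 volume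
      = ENNReal.ofReal |c⁻¹| ^ (1 / (2 : ℝ)) * eLpNorm f 2 volume := by
  have he : MeasurableEmbedding (fun z : ℝ => c * z) := measurableEmbedding_mulLeft₀ hc
  have := he.eLpNorm_map_measure (g := f) (p := 2) (μ := volume)
  rw [Real.map_volume_mul_left hc] at this
  change eLpNorm (f ∘ fun z => c * z) 2 volume = _
  rw [← this, eLpNorm_smul_measure_of_ne_top (by norm_num)]
  simp

/-- Plancherel estimate for functions with values in a finite dimensional space. -/
lemma exists_eLpNorm_integral_ph_smul_le (E : Type*) [NormedAddCommGroup E] [NormedSpace ℂ E]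
    [FiniteDimensional ℂ E] {κ : ℝ} (hκ : κ ≠ 0) :
    ∃ C₀ : ℝ, 0 ≤ C₀ ∧ ∀ g : ℝ → E, Integrable g → MemLp g 2 volume →
      eLpNorm (fun z => ∫ y, ph (κ * z * y) • g y) 2 volume
        ≤ ENNReal.ofReal C₀ * eLpNorm g 2 volume := by
  have : CompleteSpace E := FiniteDimensional.complete ℂ E
  -- The norm of `E` need not come from an inner product; coordinates in a Euclidean space cost only
  -- the two operator norms that enter the constant.
  let F := EuclideanSpace ℂ (Fin (Module.finrank ℂ E))
  let T : E ≃L[ℂ] F := ContinuousLinearEquiv.ofFinrankEq (by simp [F])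
  -- Chosen so that `e^{iκzy} = e^{-2πi y (cz)}`.
  set c : ℝ := -(κ / (2 * Real.pi)) with hc
  have hc0 : c ≠ 0 := by
    rw [hc]; exact neg_ne_zero.2 (div_ne_zero hκ (by positivity))
  set A : ℝ≥0∞ := ENNReal.ofReal |c⁻¹| ^ (1 / (2 : ℝ)) with hA
  have hAtop : A ≠ ⊤ := ENNReal.rpow_ne_top_of_nonneg (by norm_num) ENNReal.ofReal_ne_top
  refine ⟨‖(T.symm : F →L[ℂ] E)‖ * A.toReal * ‖(T : E →L[ℂ] F)‖, by positivity, fun g h1 h2 => ?_⟩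
  have h1' : Integrable (fun y => T (g y)) := (T : E →L[ℂ] F).integrable_comp h1
  have h2' : MemLp (fun y => T (g y)) 2 volume := (T : E →L[ℂ] F).comp_memLp' h2
  have e1 : ∀ z, ‖∫ y, ph (κ * z * y) • g y‖
      ≤ ‖(T.symm : F →L[ℂ] E)‖ * ‖𝓕 (fun y => T (g y)) (c * z)‖ := by
    intro z
    have : ∫ y, ph (κ * z * y) • g y = (T.symm : F →L[ℂ] E) (𝓕 (fun y => T (g y)) (c * z)) := by
      rw [Real.fourier_real_eq_integral_exp_smul]
      rw [← ContinuousLinearMap.integral_comp_comm]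
      · congr 1; ext y
        simp only [map_smul, ContinuousLinearEquiv.coe_coe, ContinuousLinearEquiv.symm_apply_apply]
        congr 1
        rw [ph]
        congr 1
        rw [hc]
        push_cast
        have : (Real.pi : ℂ) ≠ 0 := by exact_mod_cast Real.pi_ne_zero
        field_simp
      · have hcont : Continuous (fun v : ℝ =>
            Complex.exp (↑(-2 * Real.pi * v * (c * z)) * Complex.I)) := by fun_prop
        have hm : AEStronglyMeasurable (fun v : ℝ =>
            Complex.exp (↑(-2 * Real.pi * v * (c * z)) * Complex.I) • T (g v)) volume :=
          hcont.aestronglyMeasurable.smul h1'.1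
        refine h1'.mono hm (ae_of_all _ fun v => ?_)
        rw [norm_smul, Complex.norm_exp_ofReal_mul_I, one_mul]
    rw [this]
    exact ContinuousLinearMap.le_opNorm _ _
  have e2 : ∀ y, ‖T (g y)‖ ≤ ‖(T : E →L[ℂ] F)‖ * ‖g y‖ := fun y =>
    (T : E →L[ℂ] F).le_opNorm _
  calc eLpNorm (fun z => ∫ y, ph (κ * z * y) • g y) 2 volume
      ≤ ENNReal.ofReal ‖(T.symm : F →L[ℂ] E)‖
          * eLpNorm (fun z => 𝓕 (fun y => T (g y)) (c * z)) 2 volume :=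
        eLpNorm_le_mul_eLpNorm_of_ae_le_mul (ae_of_all _ e1) 2
    _ = ENNReal.ofReal ‖(T.symm : F →L[ℂ] E)‖ * (A * eLpNorm (fun y => T (g y)) 2 volume) := by
        rw [eLpNorm_comp_mul_left _ hc0, eLpNorm_fourier_eq h1' h2']
    _ ≤ ENNReal.ofReal ‖(T.symm : F →L[ℂ] E)‖ *
          (A * (ENNReal.ofReal ‖(T : E →L[ℂ] F)‖ * eLpNorm g 2 volume)) := by
        gcongr
        exact eLpNorm_le_mul_eLpNorm_of_ae_le_mul (ae_of_all _ e2) 2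
    _ = _ := by
        rw [ENNReal.ofReal_mul (by positivity), ENNReal.ofReal_mul (by positivity),
          ENNReal.ofReal_toReal hAtop]
        ring

end AKNS

namespace AKNS
open Filter Topology FourierTransform
open scoped ENNReal

/-! ## Square integrable functions with quantitative bounds -/

/-- `f` is square integrable with `L²` norm at most `C`. -/
def L2le {E : Type*} [NormedAddCommGroup E] (f : ℝ → E) (C : ℝ) : Prop :=
  AEStronglyMeasurable f volume ∧ eLpNorm f 2 volume ≤ ENNReal.ofReal C

section L2le
variable {E F : Type*} [NormedAddCommGroup E] [NormedAddCommGroup F]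

lemma L2le.memLp {f : ℝ → E} {C : ℝ} (h : L2le f C) : MemLp f 2 volume :=
  ⟨h.1, h.2.trans_lt ENNReal.ofReal_lt_top⟩

lemma L2le.mono {f : ℝ → E} {C D : ℝ} (h : L2le f C) (hCD : C ≤ D) : L2le f D :=
  ⟨h.1, h.2.trans (ENNReal.ofReal_le_ofReal hCD)⟩

lemma L2le.congr {f g : ℝ → E} {C : ℝ} (h : L2le f C) (hfg : f =ᵐ[volume] g) : L2le g C :=
  ⟨h.1.congr hfg, (eLpNorm_congr_ae hfg).symm.le.trans h.2⟩

lemma L2le.of_norm_le {f : ℝ → E} {g : ℝ → F} {K C : ℝ} (hf : AEStronglyMeasurable f volume)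
    (h : L2le g C) (hK : 0 ≤ K) (hfg : ∀ᵐ x, ‖f x‖ ≤ K * ‖g x‖) : L2le f (K * C) := by
  refine ⟨hf, (eLpNorm_le_mul_eLpNorm_of_ae_le_mul hfg 2).trans ?_⟩
  rw [ENNReal.ofReal_mul hK]
  gcongr
  exact h.2

lemma L2le.add {f g : ℝ → E} {C D : ℝ} (hf : L2le f C) (hg : L2le g D) (hC : 0 ≤ C) (hD : 0 ≤ D) :
    L2le (fun x => f x + g x) (C + D) := by
  refine ⟨hf.1.add hg.1, (eLpNorm_add_le hf.1 hg.1 (by norm_num)).trans ?_⟩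
  rw [ENNReal.ofReal_add hC hD]
  exact add_le_add hf.2 hg.2

lemma L2le.neg {f : ℝ → E} {C : ℝ} (hf : L2le f C) : L2le (fun x => -f x) C :=
  ⟨hf.1.neg, (eLpNorm_neg f 2 volume).le.trans hf.2⟩

lemma L2le.sub {f g : ℝ → E} {C D : ℝ} (hf : L2le f C) (hg : L2le g D) (hC : 0 ≤ C) (hD : 0 ≤ D) :
    L2le (fun x => f x - g x) (C + D) := by
  simpa [sub_eq_add_neg] using hf.add hg.neg hC hD

lemma eLpNorm_two_sq {α : Type*} [MeasurableSpace α] (f : α → E) (μ : Measure α) :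
    eLpNorm f 2 μ ^ 2 = ∫⁻ x, ‖f x‖ₑ ^ 2 ∂μ := by
  have := eLpNorm_nnreal_pow_eq_lintegral (f := f) (μ := μ) (p := 2) (by norm_num)
  simpa using this

lemma eLpNorm_two_le_iff {α : Type*} [MeasurableSpace α] {f : α → E} {μ : Measure α} {K : ℝ≥0∞} :
    eLpNorm f 2 μ ≤ K ↔ ∫⁻ x, ‖f x‖ₑ ^ 2 ∂μ ≤ K ^ 2 := by
  rw [← eLpNorm_two_sq, ENNReal.pow_le_pow_left_iff (by norm_num)]

lemma L2le.integrable_sq {f : ℝ → E} {C : ℝ} (h : L2le f C) : Integrable (fun x => ‖f x‖ ^ 2) :=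
  h.memLp.integrable_norm_pow (by norm_num)

lemma L2le.integral_sq_le {f : ℝ → E} {C : ℝ} (h : L2le f C) (hC : 0 ≤ C) :
    ∫ x, ‖f x‖ ^ 2 ≤ C ^ 2 := by
  have h1 := eLpNorm_two_le_iff.1 h.2
  rw [integral_eq_lintegral_of_nonneg_ae (ae_of_all _ fun x => by positivity)
    h.integrable_sq.1]
  apply ENNReal.toReal_le_of_le_ofReal (by positivity)
  rw [ENNReal.ofReal_pow hC]
  refine le_trans (le_of_eq ?_) h1
  congr 1; ext x
  rw [ENNReal.ofReal_pow (norm_nonneg _), ofReal_norm]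

/-- Fatou's lemma, applied to the majorants. Measurability is asked of the majorants alone: in the
applications the approximants contain solutions of differential equations, and their measurability
in the parameter would need a separate argument. -/
lemma eLpNorm_le_of_tendsto {f : ℝ → E} {fn : ℕ → ℝ → E} {D : ℕ → ℝ → ℝ} {K : ℝ≥0∞}
    (hD : ∀ n, AEMeasurable (D n) volume) (hK : ∀ n, eLpNorm (D n) 2 volume ≤ K)
    (hfD : ∀ n z, ‖fn n z‖ ≤ D n z) (hlim : ∀ z, Tendsto (fun n => fn n z) atTop (𝓝 (f z))) :
    eLpNorm f 2 volume ≤ K := by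
  rw [eLpNorm_two_le_iff]
  have h1 : ∀ z, ‖f z‖ₑ ^ 2 ≤ liminf (fun n => ‖D n z‖ₑ ^ 2) atTop := by
    intro z
    have ht : Tendsto (fun n => ‖fn n z‖ₑ ^ 2) atTop (𝓝 (‖f z‖ₑ ^ 2)) :=
      (ENNReal.continuous_pow 2).continuousAt.tendsto.comp
        ((continuous_enorm.tendsto _).comp (hlim z))
    rw [← ht.liminf_eq]
    refine liminf_le_liminf (Eventually.of_forall fun n => ?_)
    gcongr
    rw [enorm_le_iff_norm_le]
    exact (hfD n z).trans (Real.le_norm_self _)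
  calc ∫⁻ z, ‖f z‖ₑ ^ 2 ≤ ∫⁻ z, liminf (fun n => ‖D n z‖ₑ ^ 2) atTop := lintegral_mono h1
    _ ≤ liminf (fun n => ∫⁻ z, ‖D n z‖ₑ ^ 2) atTop :=
        lintegral_liminf_le' fun n => (hD n).enorm.pow_const 2
    _ ≤ K ^ 2 := by
        refine liminf_le_of_le (by isBoundedDefault) fun b hb => ?_
        obtain ⟨n, hn⟩ := hb.exists
        exact hn.trans (eLpNorm_two_le_iff.1 (hK n))

end L2le

/-! ## Weighted averages in `L²` -/

/-- Cauchy–Schwarz for the factorisation `w^{1/2} · (w^{1/2} e)`. -/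
lemma lintegral_mul_sq_le {α : Type*} [MeasurableSpace α] {μ : Measure α} {w e : α → ℝ≥0∞}
    (hw : Measurable w) (he : Measurable e) :
    (∫⁻ t, w t * e t ∂μ) ^ 2 ≤ (∫⁻ t, w t ∂μ) * ∫⁻ t, w t * e t ^ 2 ∂μ := by
  have h := ENNReal.lintegral_mul_le_Lp_mul_Lq μ Real.HolderConjugate.two_two
    (f := fun t => w t ^ (1 / 2 : ℝ)) (g := fun t => w t ^ (1 / 2 : ℝ) * e t)
    (hw.pow_const _).aemeasurable ((hw.pow_const _).mul he).aemeasurable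
  have hs : ∀ x : ℝ≥0∞, x ^ (1 / 2 : ℝ) * x ^ (1 / 2 : ℝ) = x := fun x => by
    rw [← ENNReal.rpow_add_of_nonneg _ _ (by norm_num) (by norm_num)]; norm_num
  have hs' : ∀ x : ℝ≥0∞, (x ^ (1 / 2 : ℝ)) ^ 2 = x := fun x => by rw [pow_two, hs]
  simp only [Pi.mul_apply, ← mul_assoc, hs, ENNReal.rpow_two, mul_pow, hs'] at h
  calc _ ≤ _ := pow_le_pow_left₀ zero_le h 2
    _ = _ := by rw [mul_pow, hs', hs']

/-- A form of Minkowski's integral inequality in `L²`, from weighted Cauchy–Schwarz at fixed `z` and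
Tonelli. -/
lemma lintegral_lintegral_mul_sq_le {α β : Type*} [MeasurableSpace α] [MeasurableSpace β]
    {μ : Measure α} {ν : Measure β} [SFinite μ] [SFinite ν] {w : α → ℝ≥0∞} {e : α → β → ℝ≥0∞}
    {K : ℝ≥0∞} (hw : Measurable w) (he : Measurable (Function.uncurry e))
    (hK : ∀ t, ∫⁻ z, e t z ^ 2 ∂ν ≤ K) :
    ∫⁻ z, (∫⁻ t, w t * e t z ∂μ) ^ 2 ∂ν ≤ (∫⁻ t, w t ∂μ) ^ 2 * K := by
  calc ∫⁻ z, (∫⁻ t, w t * e t z ∂μ) ^ 2 ∂ν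
      ≤ ∫⁻ z, (∫⁻ t, w t ∂μ) * ∫⁻ t, w t * e t z ^ 2 ∂μ ∂ν :=
        lintegral_mono fun z => lintegral_mul_sq_le hw
          (he.comp (measurable_id.prodMk measurable_const))
    _ = (∫⁻ t, w t ∂μ) * ∫⁻ z, ∫⁻ t, w t * e t z ^ 2 ∂μ ∂ν := by
        have hm : Measurable fun p : α × β => w p.1 * e p.1 p.2 ^ 2 :=
          (hw.comp measurable_fst).mul (he.pow_const 2)
        rw [lintegral_const_mul _ hm.lintegral_prod_left']
    _ = (∫⁻ t, w t ∂μ) * ∫⁻ t, ∫⁻ z, w t * e t z ^ 2 ∂ν ∂μ := by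
        rw [lintegral_lintegral_swap]
        exact (((hw.comp measurable_snd).mul ((he.comp measurable_swap).pow_const 2))).aemeasurable
    _ = (∫⁻ t, w t ∂μ) * ∫⁻ t, w t * ∫⁻ z, e t z ^ 2 ∂ν ∂μ := by
        congr 2; ext t
        rw [lintegral_const_mul]
        exact (he.comp (measurable_const.prodMk measurable_id)).pow_const 2
    _ ≤ (∫⁻ t, w t ∂μ) * ∫⁻ t, w t * K ∂μ := by
        gcongr with t
        exact hK t
    _ = _ := by rw [lintegral_mul_const _ hw]; ring

/-! ### Truncated Fourier integrals and their square integrable majorants -/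

/-- The truncated Fourier integral `∫_{-T}^t e^{iκzy} g(y) dy`. -/
noncomputable def trunc {E : Type*} [NormedAddCommGroup E] [NormedSpace ℂ E] (κ T : ℝ) (g : ℝ → E)
    (t z : ℝ) : E := ∫ y in (-T)..t, ph (κ * z * y) • g y

/-- A majorant for oscillatory integrals against amplitudes of bounded variation. -/
noncomputable def majorant {E : Type*} [NormedAddCommGroup E] [NormedSpace ℂ E] (κ T M : ℝ)
    (w : ℝ → ℝ) (g : ℝ → E) (z : ℝ) : ℝ :=
  M * ‖trunc κ T g T z‖ + ∫ t in (-T)..T, w t * ‖trunc κ T g t z‖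

/-- Each truncation is the full Fourier integral of `g` cut off to an interval, so Plancherel bounds
it in `L²(dz)` by `C₀ K` uniformly in `t`; averaging over `t` against `w` costs only the mass of
`w`. -/
lemma eLpNorm_majorant_le {E : Type*} [NormedAddCommGroup E] [NormedSpace ℂ E]
    {κ C₀ T K M W : ℝ} (hC₀ : 0 ≤ C₀)
    (hP : ∀ g : ℝ → E, Integrable g → MemLp g 2 volume →
      eLpNorm (fun z => ∫ y, ph (κ * z * y) • g y) 2 volume
        ≤ ENNReal.ofReal C₀ * eLpNorm g 2 volume)
    {g : ℝ → E} (hg : L2le g K) (hT : 0 ≤ T) (hM : 0 ≤ M) (hW : 0 ≤ W)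
    {w : ℝ → ℝ} (hwc : Continuous w) (hw0 : ∀ t, 0 ≤ w t) (hwW : ∫ t in (-T)..T, w t ≤ W) :
    AEMeasurable (majorant κ T M w g) volume ∧
      eLpNorm (majorant κ T M w g) 2 volume ≤ ENNReal.ofReal ((M + W) * (C₀ * K)) := by
  wlog hsm : StronglyMeasurable g generalizing g
  · have hae := hg.1.ae_eq_mk
    have h := this (hg.congr hae) hg.1.stronglyMeasurable_mk
    have e : majorant κ T M w g = majorant κ T M w (hg.1.mk g) := by
      have : trunc κ T g = trunc κ T (hg.1.mk g) := by
        ext t z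
        refine intervalIntegral.integral_congr_ae ?_
        filter_upwards [hae] with y hy _
        rw [hy]
      unfold majorant; rw [this]
    rwa [e]
  set G : ℝ → ℝ → E := fun t z => ∫ y, ph (κ * z * y) • (Ioc (-T) t).indicator g y with hG
  have htr : ∀ t, -T ≤ t → ∀ z, trunc κ T g t z = G t z := by
    intro t ht z
    rw [trunc, intervalIntegral.integral_of_le ht, hG]
    rw [← integral_indicator measurableSet_Ioc]
    congr 1; ext y
    by_cases hy : y ∈ Ioc (-T) t <;> simp [hy]
  have hGn : ∀ t, eLpNorm (G t) 2 volume ≤ ENNReal.ofReal (C₀ * K) := by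
    intro t
    have h2 : MemLp ((Ioc (-T) t).indicator g) 2 volume := hg.memLp.indicator measurableSet_Ioc
    have h1 : Integrable ((Ioc (-T) t).indicator g) := by
      rw [integrable_indicator_iff measurableSet_Ioc]
      exact ((hg.memLp.restrict _).integrable (by norm_num))
    refine (hP _ h1 h2).trans ?_
    rw [ENNReal.ofReal_mul hC₀]
    gcongr
    exact (eLpNorm_indicator_le _).trans hg.2
  have hGm : StronglyMeasurable (Function.uncurry G) := by
    have hm : StronglyMeasurable (fun p : (ℝ × ℝ) × ℝ =>
        ph (κ * p.1.2 * p.2) • (Ioc (-T) p.1.1).indicator g p.2) := by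
      have h1 : StronglyMeasurable (fun p : (ℝ × ℝ) × ℝ => ph (κ * p.1.2 * p.2)) :=
        Continuous.stronglyMeasurable (by fun_prop)
      refine h1.smul ?_
      have h2 : (fun p : (ℝ × ℝ) × ℝ => (Ioc (-T) p.1.1).indicator g p.2)
          = {p : (ℝ × ℝ) × ℝ | -T < p.2 ∧ p.2 ≤ p.1.1}.indicator (fun p => g p.2) := by
        ext p
        by_cases hp : -T < p.2 ∧ p.2 ≤ p.1.1
        · rw [indicator_of_mem (by exact hp), indicator_of_mem (by exact hp)]
        · rw [indicator_of_notMem (by exact hp), indicator_of_notMem (by exact hp)]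
      rw [h2]
      refine (hsm.comp_measurable measurable_snd).indicator ?_
      exact (measurableSet_lt measurable_const measurable_snd).inter
        (measurableSet_le measurable_snd (measurable_fst.comp measurable_fst))
    exact hm.integral_prod_right
  have hGz : ∀ t, StronglyMeasurable (G t) := fun t =>
    hGm.comp_measurable (measurable_const.prodMk measurable_id)
  set V : ℝ → ℝ := fun z => ∫ t in Ioc (-T) T, w t * ‖G t z‖ with hV
  have hVm : StronglyMeasurable V := by
    have : StronglyMeasurable (Function.uncurry fun z t => w t * ‖G t z‖) :=
      (hwc.stronglyMeasurable.comp_measurable measurable_snd).mul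
        (hGm.comp_measurable measurable_swap).norm
    exact this.integral_prod_right
  have hVn : eLpNorm V 2 volume ≤ ENNReal.ofReal (W * (C₀ * K)) := by
    rw [eLpNorm_two_le_iff]
    calc ∫⁻ z, ‖V z‖ₑ ^ 2
        ≤ ∫⁻ z, (∫⁻ t in Ioc (-T) T, ‖w t‖ₑ * ‖G t z‖ₑ) ^ 2 := by
          gcongr with z
          refine (enorm_integral_le_lintegral_enorm _).trans (lintegral_mono fun t => ?_)
          rw [enorm_mul, enorm_norm]
      _ ≤ (∫⁻ t in Ioc (-T) T, ‖w t‖ₑ) ^ 2 * ENNReal.ofReal (C₀ * K) ^ 2 := by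
          refine lintegral_lintegral_mul_sq_le (μ := volume.restrict (Ioc (-T) T))
            hwc.measurable.enorm (e := fun t z => ‖G t z‖ₑ) ?_ fun t => ?_
          · exact hGm.enorm
          · exact eLpNorm_two_le_iff.1 (hGn t)
      _ ≤ ENNReal.ofReal W ^ 2 * ENNReal.ofReal (C₀ * K) ^ 2 := by
          gcongr
          rw [intervalIntegral.integral_of_le (by linarith)] at hwW
          have hint : IntegrableOn w (Ioc (-T) T) :=
            (hwc.integrableOn_Icc).mono_set Ioc_subset_Icc_self
          rw [← ofReal_integral_norm_eq_lintegral_enorm hint]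
          refine ENNReal.ofReal_le_ofReal ?_
          simpa only [Real.norm_of_nonneg (hw0 _)] using hwW
      _ = ENNReal.ofReal (W * (C₀ * K)) ^ 2 := by
          rw [ENNReal.ofReal_mul hW, mul_pow]
  have hmaj : majorant κ T M w g = fun z => M * ‖G T z‖ + V z := by
    ext z
    rw [majorant, htr T (by linarith), hV, intervalIntegral.integral_of_le (by linarith)]
    congr 1
    refine setIntegral_congr_fun measurableSet_Ioc fun t ht => ?_
    rw [htr t ht.1.le]
  have hA : StronglyMeasurable fun z => M * ‖G T z‖ := (hGz T).norm.const_mul M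
  have hAn : eLpNorm (fun z => M * ‖G T z‖) 2 volume ≤ ENNReal.ofReal (M * (C₀ * K)) := by
    refine (eLpNorm_le_mul_eLpNorm_of_ae_le_mul (g := G T) (c := M)
      (ae_of_all _ fun z => ?_) 2).trans ?_
    · rw [norm_mul, norm_norm, Real.norm_of_nonneg hM]
    · rw [ENNReal.ofReal_mul hM]
      gcongr
      exact hGn T
  rw [hmaj]
  refine ⟨(hA.add hVm).measurable.aemeasurable, ?_⟩
  refine (eLpNorm_add_le hA.aestronglyMeasurable hVm.aestronglyMeasurable (by norm_num)).trans ?_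
  -- Nothing forces `K ≥ 0`. If `C₀ K < 0`, the right hand sides of `hAn` and `hVn` are zero.
  rcases le_or_gt 0 (C₀ * K) with h | h
  · rw [add_mul, ENNReal.ofReal_add (by positivity) (by positivity)]
    exact add_le_add hAn hVn
  · rw [ENNReal.ofReal_of_nonpos (mul_nonpos_of_nonneg_of_nonpos hM h.le)] at hAn
    rw [ENNReal.ofReal_of_nonpos (mul_nonpos_of_nonneg_of_nonpos hW h.le)] at hVn
    calc _ ≤ (0 : ℝ≥0∞) + 0 := add_le_add hAn hVn
      _ ≤ _ := by simp

/-! ## Integration by parts for primitives of integrable functions -/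

/-- Here `f` is only an indefinite integral, so the fundamental theorem of calculus cannot be
applied to `f F`. Instead Fubini is applied to `f'(t) F'(s)` on the triangle `t < s`, keeping the
order of the factors. -/
lemma integral_mul_of_primitive {R : Type*} [NormedRing R] [NormedAlgebra ℝ R] [CompleteSpace R]
    {f f' F F' : ℝ → R} {a b : ℝ} (hab : a ≤ b) (hf' : IntervalIntegrable f' volume a b)
    (hf : ∀ x ∈ Icc a b, f x = f a + ∫ t in a..x, f' t)
    (hF : ∀ x, HasDerivAt F (F' x) x) (hF' : Continuous F') :
    ∫ t in a..b, f' t * F t = f b * F b - f a * F a - ∫ t in a..b, f t * F' t := by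
  have hFc : Continuous F := continuous_iff_continuousAt.2 fun x => (hF x).continuousAt
  set μ := volume.restrict (Ioc a b) with hμ
  have hi' : Integrable f' μ := (intervalIntegrable_iff_integrableOn_Ioc_of_le hab).1 hf'
  have hiF : Integrable F' μ := (hF'.integrableOn_Icc).mono_set Ioc_subset_Icc_self
  have hprod : Integrable (fun p : ℝ × ℝ => f' p.1 * F' p.2) (μ.prod μ) := hi'.mul_prod hiF
  set S : Set (ℝ × ℝ) := {p | p.1 < p.2} with hS
  have hSm : MeasurableSet S := measurableSet_lt measurable_fst measurable_snd
  have hind : Integrable (S.indicator fun p : ℝ × ℝ => f' p.1 * F' p.2) (μ.prod μ) :=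
    hprod.indicator hSm
  have hswap := integral_integral_swap (f := fun t s => S.indicator
    (fun p : ℝ × ℝ => f' p.1 * F' p.2) (t, s)) (μ := μ) (ν := μ) hind
  have e1 : ∀ t ∈ Ioc a b, ∫ s, S.indicator (fun p : ℝ × ℝ => f' p.1 * F' p.2) (t, s) ∂μ
      = f' t * (F b - F t) := by
    intro t ht
    have : ∀ s, S.indicator (fun p : ℝ × ℝ => f' p.1 * F' p.2) (t, s)
        = (Ioi t).indicator (fun s => f' t * F' s) s := fun s => by
      by_cases h : t < s
      · rw [indicator_of_mem (by exact h), indicator_of_mem (by exact h)]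
      · rw [indicator_of_notMem (by exact h), indicator_of_notMem (by exact h)]
    simp_rw [this]
    rw [integral_indicator measurableSet_Ioi, hμ, Measure.restrict_restrict measurableSet_Ioi]
    have : Ioi t ∩ Ioc a b = Ioc t b := by
      ext s; simp only [mem_inter_iff, mem_Ioi, mem_Ioc]
      exact ⟨fun h => ⟨h.1, h.2.2⟩, fun h => ⟨h.1, ht.1.trans h.1, h.2⟩⟩
    rw [this, integral_const_mul_of_integrable
      ((hF'.integrableOn_Icc).mono_set Ioc_subset_Icc_self), ← intervalIntegral.integral_of_le ht.2,
      intervalIntegral.integral_eq_sub_of_hasDerivAt (fun x _ => hF x)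
        (hF'.intervalIntegrable _ _)]
  have e2 : ∀ s ∈ Ioc a b, ∫ t, S.indicator (fun p : ℝ × ℝ => f' p.1 * F' p.2) (t, s) ∂μ
      = (f s - f a) * F' s := by
    intro s hs
    have : ∀ t, S.indicator (fun p : ℝ × ℝ => f' p.1 * F' p.2) (t, s)
        = (Iio s).indicator (fun t => f' t * F' s) t := fun t => by
      by_cases h : t < s
      · rw [indicator_of_mem (by exact h), indicator_of_mem (by exact h)]
      · rw [indicator_of_notMem (by exact h), indicator_of_notMem (by exact h)]
    simp_rw [this]
    rw [integral_indicator measurableSet_Iio, hμ, Measure.restrict_restrict measurableSet_Iio]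
    have : Iio s ∩ Ioc a b = Ioo a s := by
      ext t; simp only [mem_inter_iff, mem_Iio, mem_Ioc, mem_Ioo]
      exact ⟨fun h => ⟨h.2.1, h.1⟩, fun h => ⟨h.2, h.1, h.2.le.trans hs.2⟩⟩
    rw [this, integral_mul_const_of_integrable (IntegrableOn.mono_set hi'
      (Ioo_subset_Ioc_self.trans (Ioc_subset_Ioc_right hs.2))), ← integral_Ioc_eq_integral_Ioo,
      ← intervalIntegral.integral_of_le hs.1.le, hf s ⟨hs.1.le, hs.2⟩]
    simp
  have i1 : Integrable (fun t => f' t * F t) μ := by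
    obtain ⟨C, hC⟩ :=
      (isCompact_Icc (a := a) (b := b)).exists_bound_of_continuousOn hFc.continuousOn
    refine Integrable.mul_bdd (c := C) hi' hFc.aestronglyMeasurable ?_
    exact (ae_restrict_iff' measurableSet_Ioc).2 (ae_of_all _ fun x hx => hC x ⟨hx.1.le, hx.2⟩)
  have i2 : Integrable (fun s => (f s - f a) * F' s) μ := by
    refine hind.integral_prod_right.congr ?_
    exact (ae_restrict_iff' measurableSet_Ioc).2 (ae_of_all _ e2)
  have i3 : Integrable (fun s => f a * F' s) μ := hiF.const_mul _
  rw [setIntegral_congr_fun measurableSet_Ioc e1, setIntegral_congr_fun measurableSet_Ioc e2]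
    at hswap
  have e3 : ∫ t, f' t * (F b - F t) ∂μ = (f b - f a) * F b - ∫ t, f' t * F t ∂μ := by
    simp_rw [mul_sub]
    rw [integral_sub (hi'.mul_const _) i1, integral_mul_const_of_integrable hi',
      hf b ⟨hab, le_rfl⟩, intervalIntegral.integral_of_le hab]
    simp [hμ]
  have e4 : ∫ s, f s * F' s ∂μ = ∫ s, (f s - f a) * F' s ∂μ + f a * (F b - F a) := by
    have : ∀ s, f s * F' s = (f s - f a) * F' s + f a * F' s := fun s => by simp [sub_mul]
    simp_rw [this]
    rw [integral_add i2 i3, integral_const_mul_of_integrable hiF,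
      ← intervalIntegral.integral_eq_sub_of_hasDerivAt (fun x _ => hF x)
        (hF'.intervalIntegrable a b), intervalIntegral.integral_of_le hab]
  rw [intervalIntegral.integral_of_le hab, intervalIntegral.integral_of_le hab, ← hμ, e4, ← hswap,
    e3]
  simp only [sub_mul, mul_sub]
  abel

end AKNS

namespace AKNS
open Filter Topology FourierTransform
open scoped ENNReal

/-! ## Linear systems with integrable coefficients on the line -/

lemma exists_norm_le_of_tendsto {E : Type*} [NormedAddCommGroup E] {N : ℝ → E} {N₀ n : E}
    (hc : Continuous N)
    (h1 : Tendsto N atTop (𝓝 N₀)) (h2 : Tendsto N atBot (𝓝 n)) : ∃ M, ∀ x, ‖N x‖ ≤ M := by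
  obtain ⟨a, ha⟩ := eventually_atTop.1 (h1.norm.eventually (gt_mem_nhds (lt_add_one _)))
  obtain ⟨b, hb⟩ := eventually_atBot.1 (h2.norm.eventually (gt_mem_nhds (lt_add_one _)))
  obtain ⟨C, hC⟩ := (isCompact_Icc (a := b) (b := a)).exists_bound_of_continuousOn hc.continuousOn
  refine ⟨max (max (‖N₀‖ + 1) (‖n‖ + 1)) C, fun x => ?_⟩
  rcases le_total a x with h | h
  · exact (ha x h).le.trans (by simp)
  · rcases le_total x b with h' | h'
    · exact (hb x h').le.trans (by simp)
    · exact (hC x ⟨h', h⟩).trans (by simp)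

section Volterra
variable {E : Type*} [NormedAddCommGroup E] [NormedSpace ℝ E]

/-- The tail integral `∫_x^∞ f`. -/
noncomputable def tail (f : ℝ → E) (x : ℝ) : E := ∫ y in Ioi x, f y

lemma tail_eq {f : ℝ → E} (hf : Integrable f) (x : ℝ) :
    tail f x = (∫ y in Ioi 0, f y) - ∫ y in (0 : ℝ)..x, f y := by
  have := intervalIntegral.integral_Ioi_sub_Ioi' (a := 0) (b := x) hf.integrableOn hf.integrableOn
  rw [tail, ← this]; abel

lemma hasDerivAt_tail [CompleteSpace E] {f : ℝ → E} (hf : Integrable f) (hc : Continuous f)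
    (x : ℝ) : HasDerivAt (tail f) (-f x) x := by
  have h : tail f = fun x => (∫ y in Ioi 0, f y) - ∫ y in (0 : ℝ)..x, f y := funext (tail_eq hf)
  rw [h]
  exact (intervalIntegral.integral_hasDerivAt_right (hc.intervalIntegrable _ _)
    hc.aestronglyMeasurable.stronglyMeasurableAtFilter hc.continuousAt).const_sub _

lemma tendsto_tail_atTop {f : ℝ → E} (hf : Integrable f) : Tendsto (tail f) atTop (𝓝 0) := by
  have h : tail f = fun x => (∫ y in Ioi 0, f y) - ∫ y in (0 : ℝ)..x, f y := funext (tail_eq hf)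
  rw [h, ← sub_self (∫ y in Ioi 0, f y)]
  exact tendsto_const_nhds.sub
    (intervalIntegral_tendsto_integral_Ioi 0 hf.integrableOn tendsto_id)

lemma tendsto_tail_atBot {f : ℝ → E} (hf : Integrable f) :
    Tendsto (tail f) atBot (𝓝 (∫ y, f y)) := by
  have h : tail f = fun x => (∫ y in Ioi 0, f y) + ∫ y in x..(0 : ℝ), f y := by
    ext x; rw [tail_eq hf, intervalIntegral.integral_symm x 0, sub_eq_add_neg, neg_neg]
  have e : ∫ y, f y = (∫ y in Ioi 0, f y) + ∫ y in Iic 0, f y := by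
    rw [add_comm, intervalIntegral.integral_Iic_add_Ioi hf.integrableOn hf.integrableOn]
  rw [h, e]
  exact tendsto_const_nhds.add
    (intervalIntegral_tendsto_integral_Iic 0 hf.integrableOn tendsto_id)

lemma tail_nonneg {q : ℝ → ℝ} (h0 : ∀ x, 0 ≤ q x) (x : ℝ) : 0 ≤ tail q x :=
  setIntegral_nonneg measurableSet_Ioi fun y _ => h0 y

lemma tail_le {q : ℝ → ℝ} (hq : Integrable q) (h0 : ∀ x, 0 ≤ q x) (x : ℝ) :
    tail q x ≤ ∫ y, q y :=
  setIntegral_le_integral hq (ae_of_all _ h0)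

lemma continuous_tail {q : ℝ → ℝ} (hq : Integrable q) (hc : Continuous q) :
    Continuous (tail q) :=
  continuous_iff_continuousAt.2 fun x => (hasDerivAt_tail hq hc x).continuousAt

lemma integrable_mul_exp_tail {q : ℝ → ℝ} (hq : Integrable q) (hc : Continuous q)
    (h0 : ∀ x, 0 ≤ q x) : Integrable fun y => q y * Real.exp (2 * tail q y) := by
  have hcont := continuous_tail hq hc
  refine hq.mul_bdd (c := Real.exp (2 * ∫ y, q y)) (by fun_prop) (ae_of_all _ fun y => ?_)
  rw [Real.norm_of_nonneg (Real.exp_nonneg _)]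
  gcongr
  exact tail_le hq h0 y

/-- The integrand is the exact derivative of `-e^{2 tail q}/2`. In the norm weighted by `e^{2 tail
q}` the Volterra operator with kernel bounded by `q` thus has norm at most `1/2`; the bound and the
existence proof below both rest on this. -/
lemma tail_mul_exp_tail {q : ℝ → ℝ} (hq : Integrable q) (hc : Continuous q)
    (h0 : ∀ x, 0 ≤ q x) (x : ℝ) :
    tail (fun y => q y * Real.exp (2 * tail q y)) x = (Real.exp (2 * tail q x) - 1) / 2 := by
  have h1 : ∀ y ∈ Ici x, HasDerivAt (fun y => -(Real.exp (2 * tail q y) / 2))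
      (q y * Real.exp (2 * tail q y)) y := fun y _ => by
    have := ((((hasDerivAt_tail hq hc y).const_mul 2).exp).div_const 2).neg
    exact this.congr_deriv (by ring)
  have ht : Tendsto (fun y => -(Real.exp (2 * tail q y) / 2)) atTop
      (𝓝 (-(Real.exp (2 * 0) / 2))) :=
    (((Real.continuous_exp.tendsto _).comp ((tendsto_tail_atTop hq).const_mul 2)).div_const 2).neg
  rw [tail, integral_Ioi_of_hasDerivAt_of_tendsto' h1
    (integrable_mul_exp_tail hq hc h0).integrableOn ht]
  simp; ring

/-- With `S` the supremum of `‖N‖ / e^{2 tail q}`, the equation gives `S ≤ ‖N₀‖ + S/2`. The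
qualitative bound on `N` serves only to make `S` finite, so that `S/2` can be absorbed. -/
lemma norm_le_of_eq_sub_tail {N f : ℝ → E} {N₀ : E} {q : ℝ → ℝ} (hq : Integrable q)
    (hc : Continuous q) (h0 : ∀ x, 0 ≤ q x) (hb : ∃ M, ∀ x, ‖N x‖ ≤ M)
    (hN : ∀ x, N x = N₀ - tail f x) (hf : ∀ x, ‖f x‖ ≤ q x * ‖N x‖) (x : ℝ) :
    ‖N x‖ ≤ 2 * ‖N₀‖ * Real.exp (2 * ∫ y, q y) := by
  obtain ⟨M, hM⟩ := hb
  set e : ℝ → ℝ := fun x => Real.exp (2 * tail q x) with he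
  have he1 : ∀ x, 1 ≤ e x := fun x =>
    Real.one_le_exp (mul_nonneg zero_le_two (tail_nonneg h0 x))
  have hbdd : BddAbove (range fun x => ‖N x‖ / e x) := by
    refine ⟨M, ?_⟩
    rintro _ ⟨y, rfl⟩
    exact (div_le_self (norm_nonneg _) (he1 y)).trans (hM y)
  set S := ⨆ x, ‖N x‖ / e x with hS
  have hNS : ∀ x, ‖N x‖ ≤ S * e x := fun x => by
    have := le_ciSup hbdd x
    rwa [div_le_iff₀ (by linarith [he1 x])] at this
  have key : ∀ x, ‖N x‖ ≤ ‖N₀‖ + S * ((e x - 1) / 2) := by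
    intro x
    rw [hN x]
    refine (norm_sub_le _ _).trans ?_
    gcongr
    rw [← tail_mul_exp_tail hq hc h0 x, tail, tail, ← integral_const_mul]
    refine norm_integral_le_of_norm_le
      ((integrable_mul_exp_tail hq hc h0).const_mul S).integrableOn (ae_of_all _ fun y => ?_)
    calc ‖f y‖ ≤ q y * ‖N y‖ := hf y
      _ ≤ q y * (S * e y) := by gcongr; exacts [h0 y, hNS y]
      _ = _ := by ring
  have hS0 : 0 ≤ S := by
    refine le_trans ?_ (le_ciSup hbdd 0)
    have := he1 0
    positivity
  have hS2 : S ≤ 2 * ‖N₀‖ := by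
    have : S ≤ ‖N₀‖ + S / 2 := by
      refine ciSup_le fun y => ?_
      have h1 := he1 y
      rw [div_le_iff₀ (by linarith)]
      have := key y
      nlinarith [norm_nonneg N₀]
    linarith
  calc ‖N x‖ ≤ S * e x := hNS x
    _ ≤ 2 * ‖N₀‖ * Real.exp (2 * ∫ y, q y) := by
      gcongr
      exact Real.exp_le_exp.2 (by linarith [tail_le hq h0 x])

variable [CompleteSpace E]

/-- Banach's fixed point theorem for `m = N / e^{2 tail q}` in the space of bounded continuous
functions; the weight makes the map a contraction with ratio `1/2` however large the integral of `q`
is. -/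
lemma exists_eq_sub_tail {L : ℝ → E →L[ℝ] E} (hL : Continuous L) {q : ℝ → ℝ} (hq : Integrable q)
    (hc : Continuous q) (hLq : ∀ x, ‖L x‖ ≤ q x) (N₀ : E) :
    ∃ N : ℝ → E, Continuous N ∧ (∃ M, ∀ x, ‖N x‖ ≤ M) ∧
      ∀ x, N x = N₀ - tail (fun y => L y (N y)) x := by
  have h0 : ∀ x, 0 ≤ q x := fun x => (norm_nonneg _).trans (hLq x)
  set e : ℝ → ℝ := fun x => Real.exp (2 * tail q x) with he
  have hec : Continuous e := by
    have := continuous_tail hq hc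
    fun_prop
  have he1 : ∀ x, 1 ≤ e x := fun x =>
    Real.one_le_exp (mul_nonneg zero_le_two (tail_nonneg h0 x))
  have hqe := integrable_mul_exp_tail hq hc h0
  have hbd : ∀ (m : BoundedContinuousFunction ℝ E) y,
      ‖L y (e y • m y)‖ ≤ ‖m‖ * (q y * e y) := by
    intro m y
    refine ((L y).le_opNorm _).trans ?_
    rw [norm_smul, Real.norm_of_nonneg (zero_le_one.trans (he1 y))]
    calc ‖L y‖ * (e y * ‖m y‖) ≤ q y * (e y * ‖m‖) := by
          gcongr
          · exact h0 y
          · exact hLq y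
          · exact m.norm_coe_le_norm y
      _ = _ := by ring
  have hLc : ∀ m : BoundedContinuousFunction ℝ E, Continuous fun y => L y (e y • m y) :=
    fun m => hL.clm_apply (hec.smul m.continuous)
  have hint : ∀ m : BoundedContinuousFunction ℝ E, Integrable fun y => L y (e y • m y) := fun m =>
    (hqe.const_mul ‖m‖).mono' (hLc m).aestronglyMeasurable (ae_of_all _ (hbd m))
  have htail : ∀ (m : BoundedContinuousFunction ℝ E) x,
      ‖tail (fun y => L y (e y • m y)) x‖ ≤ ‖m‖ * ((e x - 1) / 2) := by
    intro m x
    rw [← tail_mul_exp_tail hq hc h0 x, tail, tail, ← integral_const_mul]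
    exact norm_integral_le_of_norm_le (hqe.const_mul _).integrableOn (ae_of_all _ (hbd m))
  have hTc : ∀ m : BoundedContinuousFunction ℝ E,
      Continuous fun x => (e x)⁻¹ • (N₀ - tail (fun y => L y (e y • m y)) x) := fun m => by
    have h1 : Continuous (tail fun y => L y (e y • m y)) :=
      continuous_iff_continuousAt.2 fun x => (hasDerivAt_tail (hint m) (hLc m) x).continuousAt
    have h2 : Continuous fun x => (e x)⁻¹ :=
      hec.inv₀ fun x => (zero_lt_one.trans_le (he1 x)).ne'
    exact h2.smul (continuous_const.sub h1)
  have hmul : ∀ x, (e x)⁻¹ * ((e x - 1) / 2) ≤ 1 / 2 := fun x => by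
    have := he1 x
    rw [inv_mul_le_iff₀ (by linarith)]; linarith
  have hinv : ∀ x, (e x)⁻¹ ≤ 1 := fun x => inv_le_one_of_one_le₀ (he1 x)
  let T : BoundedContinuousFunction ℝ E → BoundedContinuousFunction ℝ E := fun m =>
    BoundedContinuousFunction.ofNormedAddCommGroup _ (hTc m) (‖N₀‖ + ‖m‖ * (1 / 2)) (fun x => by
      have h1 := hinv x
      have h2 := hmul x
      have h3 : 0 ≤ (e x)⁻¹ := inv_nonneg.2 (zero_le_one.trans (he1 x))
      rw [norm_smul, Real.norm_of_nonneg h3]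
      calc (e x)⁻¹ * ‖N₀ - tail (fun y => L y (e y • m y)) x‖
          ≤ (e x)⁻¹ * (‖N₀‖ + ‖m‖ * ((e x - 1) / 2)) := by
            gcongr
            exact (norm_sub_le _ _).trans (by gcongr; exact htail m x)
        _ = (e x)⁻¹ * ‖N₀‖ + ‖m‖ * ((e x)⁻¹ * ((e x - 1) / 2)) := by ring
        _ ≤ 1 * ‖N₀‖ + ‖m‖ * (1 / 2) := by gcongr
        _ = _ := by ring)
  have hT : ContractingWith (1 / 2) T := by
    refine ⟨by norm_num [← NNReal.coe_lt_coe], LipschitzWith.of_dist_le_mul fun m m' => ?_⟩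
    rw [BoundedContinuousFunction.dist_le (by positivity)]
    intro x
    have h3 : 0 ≤ (e x)⁻¹ := inv_nonneg.2 (zero_le_one.trans (he1 x))
    have e1 : T m x - T m' x = -((e x)⁻¹ • tail (fun y => L y (e y • (m - m') y)) x) := by
      change (e x)⁻¹ • (N₀ - tail (fun y => L y (e y • m y)) x)
        - (e x)⁻¹ • (N₀ - tail (fun y => L y (e y • m' y)) x) = _
      rw [← smul_sub, ← smul_neg]
      congr 1
      have : tail (fun y => L y (e y • (m - m') y)) x
          = tail (fun y => L y (e y • m y)) x - tail (fun y => L y (e y • m' y)) x := by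
        rw [tail, tail, tail, ← integral_sub (hint m).integrableOn (hint m').integrableOn]
        simp [smul_sub]
      rw [this]; abel
    rw [dist_eq_norm, e1, norm_neg, norm_smul, Real.norm_of_nonneg h3, dist_eq_norm]
    calc (e x)⁻¹ * ‖tail (fun y => L y (e y • (m - m') y)) x‖
        ≤ (e x)⁻¹ * (‖m - m'‖ * ((e x - 1) / 2)) := by gcongr; exact htail _ x
      _ = ((e x)⁻¹ * ((e x - 1) / 2)) * ‖m - m'‖ := by ring
      _ ≤ (1 / 2) * ‖m - m'‖ := by gcongr; exact hmul x
      _ = _ := by simp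
  set m := hT.fixedPoint T with hm
  have hfix : T m = m := hT.fixedPoint_isFixedPt
  refine ⟨fun x => e x • m x, hec.smul m.continuous, ⟨Real.exp (2 * ∫ y, q y) * ‖m‖, fun x => ?_⟩,
    fun x => ?_⟩
  · rw [norm_smul, Real.norm_of_nonneg (zero_le_one.trans (he1 x))]
    gcongr
    · exact Real.exp_le_exp.2 (by linarith [tail_le hq h0 x])
    · exact m.norm_coe_le_norm x
  · have h1 : m x = (e x)⁻¹ • (N₀ - tail (fun y => L y (e y • m y)) x) :=
      (DFunLike.congr_fun hfix x).symm
    dsimp only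
    conv_lhs => rw [h1]
    rw [smul_smul, mul_inv_cancel₀ (zero_lt_one.trans_le (he1 x)).ne', one_smul]

/-- Solution of a linear system with prescribed limit at `+∞`. -/
lemma exists_solution_atTop {L : ℝ → E →L[ℝ] E} (hL : Continuous L) {q : ℝ → ℝ}
    (hq : Integrable q) (hc : Continuous q) (hLq : ∀ x, ‖L x‖ ≤ q x) (N₀ : E) :
    ∃ (N : ℝ → E) (n : E), (∀ x, HasDerivAt N (L x (N x)) x) ∧ Tendsto N atTop (𝓝 N₀) ∧
      Tendsto N atBot (𝓝 n) := by
  obtain ⟨N, hNc, ⟨M, hM⟩, hN⟩ := exists_eq_sub_tail hL hq hc hLq N₀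
  have hfc : Continuous fun y => L y (N y) := hL.clm_apply hNc
  have hfi : Integrable fun y => L y (N y) := by
    refine (hq.mul_const M).mono' hfc.aestronglyMeasurable (ae_of_all _ fun y => ?_)
    exact ((L y).le_opNorm _).trans (mul_le_mul (hLq y) (hM y) (norm_nonneg _)
      ((norm_nonneg _).trans (hLq y)))
  have hN' : N = fun x => N₀ - tail (fun y => L y (N y)) x := funext hN
  refine ⟨N, N₀ - ∫ y, L y (N y), fun x => ?_, ?_, ?_⟩
  · have := (hasDerivAt_tail hfi hfc x).const_sub N₀
    rw [neg_neg, ← hN'] at this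
    exact this
  · have := (tendsto_tail_atTop hfi).const_sub N₀
    rwa [sub_zero, ← hN'] at this
  · have := (tendsto_tail_atBot hfi).const_sub N₀
    rwa [← hN'] at this

/-- Solution of a linear system with prescribed limit at `-∞`. -/
lemma exists_solution_atBot {L : ℝ → E →L[ℝ] E} (hL : Continuous L) {q : ℝ → ℝ}
    (hq : Integrable q) (hc : Continuous q) (hLq : ∀ x, ‖L x‖ ≤ q x) (N₀ : E) :
    ∃ (N : ℝ → E) (n : E), (∀ x, HasDerivAt N (L x (N x)) x) ∧ Tendsto N atBot (𝓝 N₀) ∧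
      Tendsto N atTop (𝓝 n) := by
  obtain ⟨N, n, h1, h2, h3⟩ := exists_solution_atTop (L := fun x => -L (-x))
    (hL.comp continuous_neg).neg hq.comp_neg (hc.comp continuous_neg)
    (fun x => by simpa using hLq (-x)) N₀
  refine ⟨fun x => N (-x), n, fun x => ?_, h2.comp tendsto_neg_atBot_atTop,
    h3.comp tendsto_neg_atTop_atBot⟩
  have := (h1 (-x)).scomp x (hasDerivAt_neg x)
  simpa [Function.comp_def] using this

/-- Grönwall's inequality on the line. -/
lemma norm_le_of_hasDerivAt {N N' : ℝ → E} {N₀ n : E} {q : ℝ → ℝ} (hq : Integrable q)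
    (hc : Continuous q) (hN : ∀ x, HasDerivAt N (N' x) x) (hN' : Continuous N')
    (hNq : ∀ x, ‖N' x‖ ≤ q x * ‖N x‖) (h0 : ∀ x, 0 ≤ q x)
    (h1 : Tendsto N atTop (𝓝 N₀)) (h2 : Tendsto N atBot (𝓝 n)) (x : ℝ) :
    ‖N x‖ ≤ 2 * ‖N₀‖ * Real.exp (2 * ∫ y, q y) := by
  have hNc : Continuous N := continuous_iff_continuousAt.2 fun x => (hN x).continuousAt
  obtain ⟨M, hM⟩ := exists_norm_le_of_tendsto hNc h1 h2
  have hi : Integrable N' := by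
    refine (hq.mul_const M).mono' hN'.aestronglyMeasurable (ae_of_all _ fun y => ?_)
    exact (hNq y).trans (mul_le_mul_of_nonneg_left (hM y) (h0 y))
  refine norm_le_of_eq_sub_tail hq hc h0 ⟨M, hM⟩ (f := N') (fun x => ?_) hNq x
  rw [tail, integral_Ioi_of_hasDerivAt_of_tendsto' (fun y _ => hN y) hi.integrableOn h1]
  abel

end Volterra

end AKNS

namespace AKNS
open Filter Topology FourierTransform
open scoped ENNReal

/-! ## Oscillatory integrals and the dependence of solutions on the spectral parameter -/

/-- Lipschitz continuity of translations in `L²`, with constant `C`. -/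
def TransLip {E : Type*} [NormedAddCommGroup E] (f : ℝ → E) (C : ℝ) : Prop :=
  ∀ h : ℝ, eLpNorm (fun z => f (z + h) - f z) 2 volume ≤ ENNReal.ofReal (C * |h|)

lemma norm_le_of_hasDerivAt_atBot {E : Type*} [NormedAddCommGroup E] [NormedSpace ℝ E]
    [CompleteSpace E] {N N' : ℝ → E} {N₀ n : E} {q : ℝ → ℝ} (hq : Integrable q)
    (hc : Continuous q) (hN : ∀ x, HasDerivAt N (N' x) x) (hN' : Continuous N')
    (hNq : ∀ x, ‖N' x‖ ≤ q x * ‖N x‖) (h0 : ∀ x, 0 ≤ q x)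
    (h1 : Tendsto N atBot (𝓝 N₀)) (h2 : Tendsto N atTop (𝓝 n)) (x : ℝ) :
    ‖N x‖ ≤ 2 * ‖N₀‖ * Real.exp (2 * ∫ y, q y) := by
  have h := norm_le_of_hasDerivAt (N := fun x => N (-x)) (N' := fun x => -N' (-x))
    (q := fun x => q (-x)) (N₀ := N₀) (n := n) hq.comp_neg (hc.comp continuous_neg) (fun x => by
      have := (hN (-x)).scomp x (hasDerivAt_neg x)
      simpa [Function.comp_def] using this)
    (hN'.comp continuous_neg).neg (fun x => by simpa using hNq (-x)) (fun x => h0 (-x))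
    (h1.comp tendsto_neg_atTop_atBot) (h2.comp tendsto_neg_atBot_atTop) (-x)
  simpa [integral_neg_eq_self] using h

section Algebra
variable {𝔸 : Type*} [NormedRing 𝔸] [NormedAlgebra ℂ 𝔸]

lemma hasDerivAt_trunc [CompleteSpace 𝔸] {κ T z : ℝ} {g : ℝ → 𝔸} (hg : Continuous g) (t : ℝ) :
    HasDerivAt (fun t => trunc κ T g t z) (ph (κ * z * t) • g t) t := by
  have hc : Continuous fun y => ph (κ * z * y) • g y := by fun_prop
  exact intervalIntegral.integral_hasDerivAt_right (hc.intervalIntegrable _ _)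
    hc.aestronglyMeasurable.stronglyMeasurableAtFilter hc.continuousAt

/-- Plancherel does not apply directly, because in the applications the amplitudes `Λ` and `N`
depend on `z`. Integrating by parts moves their variation onto the truncated Fourier integral `E` of
`g`, leaving a majorant that involves the amplitudes only through `B` and `q`. -/
lemma norm_integral_osc_le [CompleteSpace 𝔸] {κ T z B : ℝ} (hT : 0 ≤ T) {g Λ Λ' N N' : ℝ → 𝔸}
    {q : ℝ → ℝ} (hg : Continuous g) (hq : Continuous q) (hq0 : ∀ x, 0 ≤ q x) (hB : 0 ≤ B)
    (hΛ : ∀ x, HasDerivAt Λ (Λ' x) x) (hΛ' : Continuous Λ') (hN : ∀ x, HasDerivAt N (N' x) x)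
    (hN' : Continuous N') (bΛ : ∀ x, ‖Λ x‖ ≤ B) (bN : ∀ x, ‖N x‖ ≤ B)
    (bΛ' : ∀ x, ‖Λ' x‖ ≤ B * q x) (bN' : ∀ x, ‖N' x‖ ≤ B * q x) :
    ‖∫ y in (-T)..T, Λ y * (ph (κ * z * y) • g y) * N y‖
      ≤ majorant κ T (B ^ 2) (fun y => 2 * B ^ 2 * q y) g z := by
  have hΛc : Continuous Λ := continuous_iff_continuousAt.2 fun x => (hΛ x).continuousAt
  have hNc : Continuous N := continuous_iff_continuousAt.2 fun x => (hN x).continuousAt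
  set E : ℝ → 𝔸 := fun t => trunc κ T g t z with hE
  have hEd : ∀ t, HasDerivAt E (ph (κ * z * t) • g t) t := hasDerivAt_trunc hg
  have hEc : Continuous E := continuous_iff_continuousAt.2 fun x => (hEd x).continuousAt
  have hd : ∀ t, HasDerivAt (fun t => Λ t * E t * N t)
      ((Λ' t * E t * N t + Λ t * E t * N' t) + Λ t * (ph (κ * z * t) • g t) * N t) t := fun t =>
    (((hΛ t).mul (hEd t)).mul (hN t)).congr_deriv (by rw [add_mul]; abel)
  have c1 : Continuous fun t => Λ' t * E t * N t + Λ t * E t * N' t := by fun_prop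
  have c2 : Continuous fun t => Λ t * (ph (κ * z * t) • g t) * N t := by fun_prop
  have hint := intervalIntegral.integral_eq_sub_of_hasDerivAt (a := -T) (b := T)
    (fun t _ => hd t) ((c1.add c2).intervalIntegrable _ _)
  rw [intervalIntegral.integral_add (c1.intervalIntegrable _ _) (c2.intervalIntegrable _ _)] at hint
  have hE0 : E (-T) = 0 := by simp [hE, trunc]
  rw [hE0, mul_zero, zero_mul, sub_zero, ← eq_sub_iff_add_eq'] at hint
  rw [hint, majorant]
  refine (norm_sub_le _ _).trans (add_le_add ?_ ?_)
  · calc ‖Λ T * E T * N T‖ ≤ ‖Λ T‖ * ‖E T‖ * ‖N T‖ :=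
        (norm_mul_le _ _).trans (by gcongr; exact norm_mul_le _ _)
      _ ≤ B * ‖E T‖ * B := by gcongr; exacts [bΛ T, bN T]
      _ = _ := by ring
  · refine intervalIntegral.norm_integral_le_of_norm_le (by linarith) (ae_of_all _ fun t _ => ?_)
      (by
        apply Continuous.intervalIntegrable
        exact (continuous_const.mul hq).mul hEc.norm)
    calc ‖Λ' t * E t * N t + Λ t * E t * N' t‖
        ≤ ‖Λ' t‖ * ‖E t‖ * ‖N t‖ + ‖Λ t‖ * ‖E t‖ * ‖N' t‖ :=
          (norm_add_le _ _).trans (add_le_add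
            ((norm_mul_le _ _).trans (by gcongr; exact norm_mul_le _ _))
            ((norm_mul_le _ _).trans (by gcongr; exact norm_mul_le _ _)))
      _ ≤ (B * q t) * ‖E t‖ * B + B * ‖E t‖ * (B * q t) := by
          have := hq0 t
          gcongr
          exacts [bΛ' t, bN t, bΛ t, bN' t]
      _ = _ := by ring

/-- The one-sided variant for `g` without continuity, as needed for the last iterate of the
recursion, which contains a third weak derivative. -/
lemma norm_integral_osc_le_of_integrable [CompleteSpace 𝔸] {κ T z B : ℝ} (hT : 0 ≤ T)
    {g N N' : ℝ → 𝔸} {q : ℝ → ℝ} (hg : LocallyIntegrable g) (hq : Continuous q)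
    (hN : ∀ x, HasDerivAt N (N' x) x)
    (hN' : Continuous N') (bN : ∀ x, ‖N x‖ ≤ B) (bN' : ∀ x, ‖N' x‖ ≤ B * q x) :
    ‖∫ y in (-T)..T, (ph (κ * z * y) • g y) * N y‖
      ≤ majorant κ T B (fun y => B * q y) g z := by
  have hi : ∀ a b, IntervalIntegrable (fun y => ph (κ * z * y) • g y) volume a b := fun a b => by
    have h1 : LocallyIntegrable fun y => ph (κ * z * y) • g y := by
      have hc : Continuous fun y => ph (κ * z * y) := by fun_prop
      exact hg.continuous_smul hc
    exact (h1.integrableOn_isCompact isCompact_uIcc).intervalIntegrable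
  set E : ℝ → 𝔸 := fun t => trunc κ T g t z with hE
  have hE0 : E (-T) = 0 := by simp [hE, trunc]
  have hEc : Continuous E := intervalIntegral.continuous_primitive hi _
  rw [integral_mul_of_primitive (f := E) (by linarith) (hi _ _)
    (fun x _ => by rw [hE0, zero_add]; rfl) hN hN', hE0, zero_mul, sub_zero, majorant]
  refine (norm_sub_le _ _).trans (add_le_add ?_ ?_)
  · calc ‖E T * N T‖ ≤ ‖E T‖ * ‖N T‖ := norm_mul_le _ _
      _ ≤ ‖E T‖ * B := by gcongr; exact bN T
      _ = _ := mul_comm _ _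
  · refine intervalIntegral.norm_integral_le_of_norm_le (by linarith) (ae_of_all _ fun t _ => ?_)
      (by
        apply Continuous.intervalIntegrable
        exact (continuous_const.mul hq).mul hEc.norm)
    calc ‖E t * N' t‖ ≤ ‖E t‖ * ‖N' t‖ := norm_mul_le _ _
      _ ≤ ‖E t‖ * (B * q t) := by gcongr; exact bN' t
      _ = _ := mul_comm _ _

/-- The coefficient `e^{iκzy} Q₋(y) + e^{-iκzy} Q₊(y)`. -/
noncomputable def coeff (κ : ℝ) (Qm Qp : ℝ → 𝔸) (z y : ℝ) : 𝔸 :=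
  ph (κ * z * y) • Qm y + ph (-(κ * z * y)) • Qp y

lemma norm_coeff_le (κ : ℝ) (Qm Qp : ℝ → 𝔸) (z y : ℝ) :
    ‖coeff κ Qm Qp z y‖ ≤ ‖Qm y‖ + ‖Qp y‖ :=
  (norm_add_le _ _).trans (by rw [norm_ph_smul, norm_ph_smul])

lemma continuous_coeff {κ : ℝ} {Qm Qp : ℝ → 𝔸} (hm : Continuous Qm) (hp : Continuous Qp) (z : ℝ) :
    Continuous (coeff κ Qm Qp z) := by
  unfold coeff; fun_prop

/-- Regularity of the limit at `-∞` in the spectral parameter. -/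
theorem exists_transLip_of_hasDerivAt [FiniteDimensional ℂ 𝔸] {κ : ℝ} (hκ : κ ≠ 0) (U : ℝ)
    (hU : 0 ≤ U) :
    ∃ C : ℝ, 0 ≤ C ∧ ∀ (Qm Qp : ℝ → 𝔸) (N : ℝ → ℝ → 𝔸) (N₀ : 𝔸) (n : ℝ → 𝔸),
      Continuous Qm → Continuous Qp → Integrable Qm → Integrable Qp →
      (∫ y, ‖Qm y‖) ≤ U → (∫ y, ‖Qp y‖) ≤ U →
      L2le (fun y => (y : ℂ) • Qm y) U → L2le (fun y => (y : ℂ) • Qp y) U → ‖N₀‖ ≤ U →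
      (∀ z x, HasDerivAt (N z) (coeff κ Qm Qp z x * N z x) x) →
      (∀ z, Tendsto (N z) atTop (𝓝 N₀)) → (∀ z, Tendsto (N z) atBot (𝓝 (n z))) →
      (∀ z x, ‖N z x‖ ≤ C) ∧ (∀ z, ‖n z‖ ≤ C) ∧ TransLip n C ∧ Continuous n := by
  have : CompleteSpace 𝔸 := FiniteDimensional.complete ℂ 𝔸
  obtain ⟨C₁, hC₁, hP₁⟩ := exists_eLpNorm_integral_ph_smul_le 𝔸 hκ
  obtain ⟨C₂, hC₂, hP₂⟩ := exists_eLpNorm_integral_ph_smul_le 𝔸 (neg_ne_zero.2 hκ)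
  -- The Grönwall bound for both `N` and the adjoint solution: `U + ‖1‖` dominates both prescribed
  -- limits, and `2 * U` dominates the integral of `‖Qm‖ + ‖Qp‖`.
  set B : ℝ := 2 * (U + ‖(1 : 𝔸)‖) * Real.exp (2 * (2 * U)) with hB
  have hB0 : 0 ≤ B := by positivity
  set D : ℝ := (B ^ 2 + 2 * B ^ 2 * (2 * U)) * (C₁ * (|κ| * U))
    + (B ^ 2 + 2 * B ^ 2 * (2 * U)) * (C₂ * (|κ| * U)) with hD
  have hD0 : 0 ≤ D := by positivity
  refine ⟨B + D, by positivity, ?_⟩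
  intro Qm Qp N N₀ n hm hp im ip um up wm wp uN hN htop hbot
  set q : ℝ → ℝ := fun y => ‖Qm y‖ + ‖Qp y‖ with hq
  have hqc : Continuous q := hm.norm.add hp.norm
  have hqi : Integrable q := im.norm.add ip.norm
  have hq0 : ∀ y, 0 ≤ q y := fun y => by positivity
  have hqU : ∫ y, q y ≤ 2 * U := by
    rw [hq, integral_add im.norm ip.norm]; linarith
  have hNc : ∀ z, Continuous (N z) := fun z =>
    continuous_iff_continuousAt.2 fun x => (hN z x).continuousAt
  have hPc := continuous_coeff (κ := κ) hm hp
  have hexp : Real.exp (2 * ∫ y, q y) ≤ Real.exp (2 * (2 * U)) :=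
    Real.exp_le_exp.2 (by linarith)
  have hNB : ∀ z x, ‖N z x‖ ≤ B := fun z x => by
    refine (norm_le_of_hasDerivAt hqi hqc (hN z) ((hPc z).mul (hNc z)) (fun x => ?_) hq0 (htop z)
      (hbot z) x).trans ?_
    · refine (norm_mul_le _ _).trans ?_
      gcongr
      exact norm_coeff_le _ _ _ _ _
    · rw [hB]
      gcongr
      linarith [norm_nonneg (1 : 𝔸)]
  have hnB : ∀ z, ‖n z‖ ≤ B := fun z =>
    le_of_tendsto (hbot z).norm (Eventually.of_forall fun x => hNB z x)
  -- the adjoint solution normalised at `-∞`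
  have hΘ : ∀ z, ∃ (Θ : ℝ → 𝔸) (θ : 𝔸), (∀ x, HasDerivAt Θ (-(Θ x * coeff κ Qm Qp z x)) x) ∧
      Tendsto Θ atBot (𝓝 1) ∧ Tendsto Θ atTop (𝓝 θ) := fun z => by
    let L : ℝ → 𝔸 →L[ℝ] 𝔸 := fun x => -((ContinuousLinearMap.mul ℝ 𝔸).flip (coeff κ Qm Qp z x))
    have hL : Continuous L := ((ContinuousLinearMap.continuous _).comp (hPc z)).neg
    obtain ⟨Θ, θ, h1, h2, h3⟩ := exists_solution_atBot hL hqi hqc (fun x => by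
      rw [norm_neg]
      refine (ContinuousLinearMap.opNorm_le_bound _ (norm_nonneg _) fun y => ?_).trans
        (norm_coeff_le κ Qm Qp z x)
      rw [ContinuousLinearMap.flip_apply, ContinuousLinearMap.mul_apply', mul_comm ‖_‖ ‖y‖]
      exact norm_mul_le _ _) (1 : 𝔸)
    exact ⟨Θ, θ, fun x => by simpa [L] using h1 x, h2, h3⟩
  choose Θ θ hΘ hΘbot hΘtop using hΘ
  have hΘc : ∀ z, Continuous (Θ z) := fun z =>
    continuous_iff_continuousAt.2 fun x => (hΘ z x).continuousAt
  have hΘB : ∀ z x, ‖Θ z x‖ ≤ B := fun z x => by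
    refine (norm_le_of_hasDerivAt_atBot hqi hqc (hΘ z) ((hΘc z).mul (hPc z)).neg (fun x => ?_) hq0
      (hΘbot z) (hΘtop z) x).trans ?_
    · rw [norm_neg, mul_comm]
      refine (norm_mul_le _ _).trans ?_
      gcongr
      exact norm_coeff_le _ _ _ _ _
    · rw [hB]
      gcongr
      linarith
  -- the comparison formula
  have hcoeffi : ∀ z w, Integrable fun y =>
      Θ z y * (coeff κ Qm Qp w y - coeff κ Qm Qp z y) * N w y := fun z w => by
    refine (hqi.const_mul (B * 2 * B)).mono'
      (Continuous.aestronglyMeasurable (((hΘc z).mul ((hPc w).sub (hPc z))).mul (hNc w)))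
      (ae_of_all _ fun y => ?_)
    calc _ ≤ ‖Θ z y‖ * ‖coeff κ Qm Qp w y - coeff κ Qm Qp z y‖ * ‖N w y‖ :=
          (norm_mul_le _ _).trans (by gcongr; exact norm_mul_le _ _)
      _ ≤ B * (q y + q y) * B := by
          gcongr
          · exact hΘB z y
          · exact (norm_sub_le _ _).trans (add_le_add (norm_coeff_le _ _ _ _ _)
              (norm_coeff_le _ _ _ _ _))
          · exact hNB w y
      _ = _ := by ring
  -- Since `Θ_z' = -Θ_z P_z` and `N_w' = P_w N_w`, the product `Θ_z N_w` has derivative `Θ_z (P_w -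
  -- P_z) N_w`.
  have hform : ∀ z w, ∫ y, Θ z y * (coeff κ Qm Qp w y - coeff κ Qm Qp z y) * N w y
      = θ z * N₀ - n w := fun z w => by
    refine integral_of_hasDerivAt_of_tendsto (f := fun y => Θ z y * N w y) (fun y => ?_)
      (hcoeffi z w) ?_ ((hΘtop z).mul (htop w))
    · refine ((hΘ z y).mul (hN w y)).congr_deriv ?_
      noncomm_ring
    · simpa using (hΘbot z).mul (hbot w)
  -- The case `w = z` of `hform` identifies `θ z * N₀` with `n z`.
  have hdiff : ∀ z w, ∫ y, Θ z y * (coeff κ Qm Qp w y - coeff κ Qm Qp z y) * N w y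
      = n z - n w := fun z w => by
    have := hform z z
    simp only [sub_self, mul_zero, zero_mul, integral_zero] at this
    rw [hform z w, ← sub_eq_zero.1 this.symm]
  refine ⟨fun z x => (hNB z x).trans (by linarith), fun z => (hnB z).trans (by linarith), ?_, ?_⟩
  · intro h
    -- Factoring `e^{iκ(z+h)y} - e^{iκzy} = e^{iκzy} (e^{iκhy} - 1)` separates `z` from `h`. The
    -- second factor is at most `|κhy|`, so the weighted bound on the coefficients produces the
    -- factor `|h|`.
    set gm : ℝ → 𝔸 := fun y => (ph (κ * h * y) - 1) • Qm y with hgm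
    set gp : ℝ → 𝔸 := fun y => (ph (-(κ * h * y)) - 1) • Qp y with hgp
    have cgm : Continuous gm := by fun_prop
    have cgp : Continuous gp := by fun_prop
    have Lgm : L2le gm (|κ| * |h| * U) := by
      refine L2le.of_norm_le cgm.aestronglyMeasurable wm (by positivity) (ae_of_all _ fun y => ?_)
      rw [hgm, norm_smul, norm_smul, Complex.norm_real, Real.norm_eq_abs, ← mul_assoc]
      gcongr
      exact (norm_ph_sub_one_le _).trans_eq (by rw [abs_mul, abs_mul])
    have Lgp : L2le gp (|κ| * |h| * U) := by
      refine L2le.of_norm_le cgp.aestronglyMeasurable wp (by positivity) (ae_of_all _ fun y => ?_)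
      rw [hgp, norm_smul, norm_smul, Complex.norm_real, Real.norm_eq_abs, ← mul_assoc]
      gcongr
      exact (norm_ph_sub_one_le _).trans_eq (by rw [abs_neg, abs_mul, abs_mul])
    have hsplit : ∀ z y, Θ z y * (coeff κ Qm Qp (z + h) y - coeff κ Qm Qp z y) * N (z + h) y
        = Θ z y * (ph (κ * z * y) • gm y) * N (z + h) y
          + Θ z y * (ph (-κ * z * y) • gp y) * N (z + h) y := fun z y => by
      rw [← add_mul, ← mul_add]
      congr 2
      have e1 : ph (κ * (z + h) * y) = ph (κ * z * y) * ph (κ * h * y) := by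
        rw [← ph_add]; congr 1; ring
      have e2 : ph (-(κ * (z + h) * y)) = ph (-κ * z * y) * ph (-(κ * h * y)) := by
        rw [← ph_add]; congr 1; ring
      have e3 : ph (-(κ * z * y)) = ph (-κ * z * y) := by congr 1; ring
      simp only [coeff, hgm, hgp, e1, e2, e3]
      module
    have hmaj : ∀ (T : ℝ) (hT : 0 ≤ T) z,
        ‖∫ y in (-T)..T, Θ z y * (coeff κ Qm Qp (z + h) y - coeff κ Qm Qp z y) * N (z + h) y‖
          ≤ majorant κ T (B ^ 2) (fun y => 2 * B ^ 2 * q y) gm z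
            + majorant (-κ) T (B ^ 2) (fun y => 2 * B ^ 2 * q y) gp z := fun T hT z => by
      simp only [hsplit]
      have := hNc (z + h)
      have := hΘc z
      rw [intervalIntegral.integral_add
        (Continuous.intervalIntegrable (by fun_prop) _ _)
        (Continuous.intervalIntegrable (by fun_prop) _ _)]
      have bΘ' : ∀ x, ‖-(Θ z x * coeff κ Qm Qp z x)‖ ≤ B * q x := fun x => by
        rw [norm_neg]
        exact (norm_mul_le _ _).trans (mul_le_mul (hΘB z x) (norm_coeff_le _ _ _ _ _)
          (norm_nonneg _) hB0)
      have bN' : ∀ x, ‖coeff κ Qm Qp (z + h) x * N (z + h) x‖ ≤ B * q x := fun x => by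
        rw [mul_comm B]
        exact (norm_mul_le _ _).trans (mul_le_mul (norm_coeff_le _ _ _ _ _) (hNB _ x)
          (norm_nonneg _) (hq0 x))
      refine (norm_add_le _ _).trans (add_le_add ?_ ?_)
      · exact norm_integral_osc_le hT cgm hqc hq0 hB0 (hΘ z) ((hΘc z).mul (hPc z)).neg (hN (z + h))
          ((hPc _).mul (hNc _)) (hΘB z) (hNB _) bΘ' bN'
      · exact norm_integral_osc_le hT cgp hqc hq0 hB0 (hΘ z) ((hΘc z).mul (hPc z)).neg (hN (z + h))
          ((hPc _).mul (hNc _)) (hΘB z) (hNB _) bΘ' bN'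
    have hw : ∀ T : ℝ, 0 ≤ T →
        ∫ t in (-T)..T, 2 * B ^ 2 * q t ≤ 2 * B ^ 2 * (2 * U) := fun T hT => by
      rw [intervalIntegral.integral_const_mul, intervalIntegral.integral_of_le (by linarith)]
      gcongr
      exact (setIntegral_le_integral hqi (ae_of_all _ hq0)).trans hqU
    have M1 := fun (T : ℝ) (hT : 0 ≤ T) => eLpNorm_majorant_le (κ := κ) (T := T) (M := B ^ 2)
      (W := 2 * B ^ 2 * (2 * U)) hC₁ hP₁ Lgm hT (by positivity) (by positivity)
      (w := fun y => 2 * B ^ 2 * q y) (by fun_prop)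
      (fun t => by have := hq0 t; positivity) (hw T hT)
    have M2 := fun (T : ℝ) (hT : 0 ≤ T) => eLpNorm_majorant_le (κ := -κ) (T := T) (M := B ^ 2)
      (W := 2 * B ^ 2 * (2 * U)) hC₂ hP₂ Lgp hT (by positivity) (by positivity)
      (w := fun y => 2 * B ^ 2 * q y) (by fun_prop)
      (fun t => by have := hq0 t; positivity) (hw T hT)
    have hfin : eLpNorm (fun z => n z - n (z + h)) 2 volume ≤ ENNReal.ofReal (D * |h|) := by
      refine eLpNorm_le_of_tendsto
        (fn := fun k z => ∫ y in (-(k : ℝ))..k,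
          Θ z y * (coeff κ Qm Qp (z + h) y - coeff κ Qm Qp z y) * N (z + h) y)
        (D := fun k z => majorant κ k (B ^ 2) (fun y => 2 * B ^ 2 * q y) gm z
            + majorant (-κ) k (B ^ 2) (fun y => 2 * B ^ 2 * q y) gp z)
        (fun k => (M1 k k.cast_nonneg).1.add (M2 k k.cast_nonneg).1) (fun k => ?_)
        (fun k z => hmaj k k.cast_nonneg z) (fun z => ?_)
      · refine (eLpNorm_add_le (M1 k k.cast_nonneg).1.aestronglyMeasurable
          (M2 k k.cast_nonneg).1.aestronglyMeasurable (by norm_num)).trans ?_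
        refine (add_le_add (M1 k k.cast_nonneg).2 (M2 k k.cast_nonneg).2).trans_eq ?_
        rw [← ENNReal.ofReal_add (by positivity) (by positivity)]
        congr 1
        rw [hD]; ring
      · rw [← hdiff z (z + h)]
        exact intervalIntegral_tendsto_integral (hcoeffi z (z + h))
          (tendsto_neg_atTop_atBot.comp tendsto_natCast_atTop_atTop) tendsto_natCast_atTop_atTop
    have e : (fun z => n (z + h) - n z) = fun z => -(n z - n (z + h)) := by
      ext z; rw [neg_sub]
    rw [e]
    refine (eLpNorm_neg _ 2 volume).le.trans (hfin.trans (ENNReal.ofReal_le_ofReal ?_))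
    gcongr; linarith
  · rw [continuous_iff_continuousAt]
    intro z
    -- A scalar modulus of continuity: it dominates `‖n w - n z‖`, vanishes at `w = z`, and is
    -- continuous by dominated convergence.
    set m : ℝ → ℝ := fun w => ∫ y, B * (‖ph (κ * w * y) - ph (κ * z * y)‖ * ‖Qm y‖
      + ‖ph (-(κ * w * y)) - ph (-(κ * z * y))‖ * ‖Qp y‖) * B with hmdef
    have h2 : ∀ s t : ℝ, ‖ph s - ph t‖ ≤ 2 := fun s t =>
      (norm_sub_le _ _).trans (by rw [norm_ph, norm_ph]; norm_num)
    have hmb : ∀ w y, ‖B * (‖ph (κ * w * y) - ph (κ * z * y)‖ * ‖Qm y‖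
      + ‖ph (-(κ * w * y)) - ph (-(κ * z * y))‖ * ‖Qp y‖) * B‖ ≤ B * (2 * q y) * B := by
      intro w y
      rw [Real.norm_of_nonneg (by positivity)]
      refine mul_le_mul_of_nonneg_right (mul_le_mul_of_nonneg_left ?_ hB0) hB0
      have e : 2 * q y = 2 * ‖Qm y‖ + 2 * ‖Qp y‖ := by simp only [hq]; ring
      rw [e]
      exact add_le_add (mul_le_mul_of_nonneg_right (h2 _ _) (norm_nonneg _))
        (mul_le_mul_of_nonneg_right (h2 _ _) (norm_nonneg _))
    have hmi : Integrable fun y => B * (2 * q y) * B := ((hqi.const_mul 2).const_mul B).mul_const B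
    have hmc : Continuous m := by
      refine continuous_of_dominated (fun w => Continuous.aestronglyMeasurable (by fun_prop))
        (fun w => ae_of_all _ (hmb w)) hmi (ae_of_all _ fun y => by fun_prop)
    have hm0 : m z = 0 := by simp [hmdef]
    rw [ContinuousAt, tendsto_iff_norm_sub_tendsto_zero]
    have hmt := hmc.tendsto z
    rw [hm0] at hmt
    refine squeeze_zero (fun w => norm_nonneg _) (fun w => ?_) hmt
    rw [norm_sub_rev, ← hdiff z w]
    refine norm_integral_le_of_norm_le (hmi.mono' (Continuous.aestronglyMeasurable (by fun_prop))
      (ae_of_all _ (hmb w))) (ae_of_all _ fun y => ?_)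
    calc _ ≤ ‖Θ z y‖ * ‖coeff κ Qm Qp w y - coeff κ Qm Qp z y‖ * ‖N w y‖ :=
          (norm_mul_le _ _).trans (by gcongr; exact norm_mul_le _ _)
      _ ≤ _ := by
          gcongr
          · exact hΘB z y
          · have : coeff κ Qm Qp w y - coeff κ Qm Qp z y
                = (ph (κ * w * y) - ph (κ * z * y)) • Qm y
                  + (ph (-(κ * w * y)) - ph (-(κ * z * y))) • Qp y := by
              simp only [coeff]; module
            rw [this]
            refine (norm_add_le _ _).trans ?_
            rw [norm_smul, norm_smul]
          · exact hNB w y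

end Algebra

end AKNS

namespace AKNS
open Filter Topology FourierTransform
open scoped ENNReal

/-! ## Functions of Sobolev class `H¹` on the line -/

lemma L2le.locallyIntegrable {E : Type*} [NormedAddCommGroup E] {f : ℝ → E} {C : ℝ}
    (h : L2le f C) : LocallyIntegrable f :=
  h.memLp.locallyIntegrable (by norm_num)

lemma L2le.intervalIntegrable {E : Type*} [NormedAddCommGroup E] {f : ℝ → E} {C : ℝ}
    (h : L2le f C) (a b : ℝ) :
    IntervalIntegrable f volume a b :=
  (h.locallyIntegrable.integrableOn_isCompact isCompact_uIcc).intervalIntegrable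

section Sobolev
variable {E : Type*} [NormedAddCommGroup E] [NormedSpace ℝ E]

/-- `f` is a primitive of `f'` and both are square integrable, with norms at most `M`. -/
structure SobolevOne (f f' : ℝ → E) (M : ℝ) : Prop where
  prim : ∀ x, f x = f 0 + ∫ t in (0 : ℝ)..x, f' t
  l2 : L2le f M
  l2' : L2le f' M

/-- `f` is continuously differentiable with derivative `f'`, both square integrable. -/
structure SobolevC1 (f f' : ℝ → E) (M : ℝ) : Prop where
  deriv : ∀ x, HasDerivAt f (f' x) x
  cont' : Continuous f'
  l2 : L2le f M
  l2' : L2le f' M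

/-- `G` is continuously differentiable and bounded, with square integrable derivative. -/
structure BoundedC1 (G G' : ℝ → E) (M : ℝ) : Prop where
  deriv : ∀ x, HasDerivAt G (G' x) x
  cont' : Continuous G'
  bdd : ∀ x, ‖G x‖ ≤ M
  l2' : L2le G' M

lemma SobolevC1.cont {f f' : ℝ → E} {M : ℝ} (h : SobolevC1 f f' M) : Continuous f :=
  continuous_iff_continuousAt.2 fun x => (h.deriv x).continuousAt

lemma BoundedC1.cont {f f' : ℝ → E} {M : ℝ} (h : BoundedC1 f f' M) : Continuous f :=
  continuous_iff_continuousAt.2 fun x => (h.deriv x).continuousAt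

lemma SobolevOne.sub_eq {f f' : ℝ → E} {M : ℝ} (h : SobolevOne f f' M) (x y : ℝ) :
    f y = f x + ∫ t in x..y, f' t := by
  rw [h.prim y, h.prim x, add_assoc,
    intervalIntegral.integral_add_adjacent_intervals (h.l2'.intervalIntegrable _ _)
      (h.l2'.intervalIntegrable _ _)]

lemma SobolevOne.cont {f f' : ℝ → E} {M : ℝ} (h : SobolevOne f f' M) : Continuous f := by
  have : f = fun x => f 0 + ∫ t in (0 : ℝ)..x, f' t := funext h.prim
  rw [this]
  exact continuous_const.add
    (intervalIntegral.continuous_primitive h.l2'.intervalIntegrable _)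

lemma SobolevOne.mono {f f' : ℝ → E} {M M' : ℝ} (h : SobolevOne f f' M) (hM : M ≤ M') :
    SobolevOne f f' M' := ⟨h.prim, h.l2.mono hM, h.l2'.mono hM⟩

lemma SobolevC1.toSobolevOne [CompleteSpace E] {f f' : ℝ → E} {M : ℝ} (h : SobolevC1 f f' M) :
    SobolevOne f f' M := by
  refine ⟨fun x => ?_, h.l2, h.l2'⟩
  rw [intervalIntegral.integral_eq_sub_of_hasDerivAt (fun x _ => h.deriv x)
    (h.cont'.intervalIntegrable _ _)]
  abel

lemma SobolevOne.sub {f f' g g' : ℝ → E} {M M' : ℝ} (h : SobolevOne f f' M)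
    (k : SobolevOne g g' M') (hM : 0 ≤ M) (hM' : 0 ≤ M') :
    SobolevOne (fun x => f x - g x) (fun x => f' x - g' x) (M + M') := by
  refine ⟨fun x => ?_, h.l2.sub k.l2 hM hM', h.l2'.sub k.l2' hM hM'⟩
  rw [intervalIntegral.integral_sub (h.l2'.intervalIntegrable _ _) (k.l2'.intervalIntegrable _ _),
    h.prim x, k.prim x]
  abel

lemma SobolevC1.add {f f' g g' : ℝ → E} {M M' : ℝ} (h : SobolevC1 f f' M)
    (k : SobolevC1 g g' M') (hM : 0 ≤ M) (hM' : 0 ≤ M') :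
    SobolevC1 (fun x => f x + g x) (fun x => f' x + g' x) (M + M') :=
  ⟨fun x => (h.deriv x).add (k.deriv x), h.cont'.add k.cont', h.l2.add k.l2 hM hM',
    h.l2'.add k.l2' hM hM'⟩

lemma SobolevC1.sub {f f' g g' : ℝ → E} {M M' : ℝ} (h : SobolevC1 f f' M)
    (k : SobolevC1 g g' M') (hM : 0 ≤ M) (hM' : 0 ≤ M') :
    SobolevC1 (fun x => f x - g x) (fun x => f' x - g' x) (M + M') :=
  ⟨fun x => (h.deriv x).sub (k.deriv x), h.cont'.sub k.cont', h.l2.sub k.l2 hM hM',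
    h.l2'.sub k.l2' hM hM'⟩

/-- Averaging over a unit interval gives `‖f x‖ ≤ ∫ (‖f‖ + ‖f'‖)`, and `y ≤ η/2 + y²/(2η)` brings in
the squares. Taking `η = 1` yields a uniform bound, taking `η` small yields decay at infinity. -/
lemma SobolevOne.norm_le_add {f f' : ℝ → E} {M : ℝ} (h : SobolevOne f f' M) {η : ℝ} (hη : 0 < η)
    (x : ℝ) : ‖f x‖ ≤ η + 1 / (2 * η) * ∫ t in x..(x + 1), (‖f t‖ ^ 2 + ‖f' t‖ ^ 2) := by
  have i1 : ∀ a b, IntervalIntegrable (fun t => ‖f t‖) volume a b := fun a b =>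
    (h.l2.intervalIntegrable a b).norm
  have i2 : ∀ a b, IntervalIntegrable (fun t => ‖f' t‖) volume a b := fun a b =>
    (h.l2'.intervalIntegrable a b).norm
  have i3 : IntervalIntegrable (fun t => ‖f t‖ ^ 2 + ‖f' t‖ ^ 2) volume x (x + 1) :=
    (h.l2.integrable_sq.add h.l2'.integrable_sq).intervalIntegrable
  have hx1 : x ≤ x + 1 := by linarith
  have h1 : ∀ t ∈ Icc x (x + 1), ‖f x‖ ≤ ‖f t‖ + ∫ s in x..(x + 1), ‖f' s‖ := fun t ht => by
    have e : f x = f t - ∫ s in x..t, f' s := by rw [h.sub_eq x t]; abel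
    rw [e]
    refine (norm_sub_le _ _).trans ?_
    gcongr
    refine (intervalIntegral.norm_integral_le_integral_norm ht.1).trans ?_
    exact intervalIntegral.integral_mono_interval le_rfl ht.1 ht.2
      (ae_of_all _ fun s => norm_nonneg _) (i2 _ _)
  have h2 : ‖f x‖ ≤ (∫ t in x..(x + 1), ‖f t‖) + ∫ s in x..(x + 1), ‖f' s‖ := by
    have := intervalIntegral.integral_mono_on (μ := volume) hx1 (f := fun _ => ‖f x‖)
      (g := fun t => ‖f t‖ + ∫ s in x..(x + 1), ‖f' s‖) (by simp) ((i1 _ _).add (by simp)) h1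
    rw [intervalIntegral.integral_add (i1 _ _) (by simp)] at this
    simpa using this
  have hy : ∀ y : ℝ, 0 ≤ y → y ≤ η / 2 + 1 / (2 * η) * y ^ 2 := fun y _ => by
    have e : η / 2 + 1 / (2 * η) * y ^ 2 - y = (y - η) ^ 2 / (2 * η) := by field_simp; ring
    have : 0 ≤ (y - η) ^ 2 / (2 * η) := by positivity
    linarith
  rw [← intervalIntegral.integral_add (i1 _ _) (i2 _ _)] at h2
  have h3 : ∫ t in x..(x + 1), (‖f t‖ + ‖f' t‖)
      ≤ ∫ t in x..(x + 1), (η + 1 / (2 * η) * (‖f t‖ ^ 2 + ‖f' t‖ ^ 2)) := by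
    refine intervalIntegral.integral_mono_on hx1 ((i1 _ _).add (i2 _ _))
      ((intervalIntegrable_const (c := η)).add (i3.const_mul _)) fun t _ => ?_
    have a1 := hy _ (norm_nonneg (f t))
    have a2 := hy _ (norm_nonneg (f' t))
    linarith
  rw [intervalIntegral.integral_add (by simp) (i3.const_mul _),
    intervalIntegral.integral_const_mul] at h3
  have h4 : ∫ _ in x..(x + 1), η = η := by simp
  linarith

lemma SobolevOne.norm_le {f f' : ℝ → E} {M : ℝ} (h : SobolevOne f f' M) (hM : 0 ≤ M) (x : ℝ) :
    ‖f x‖ ≤ 1 + M ^ 2 := by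
  have h1 := h.norm_le_add one_pos x
  have hi : Integrable fun t => ‖f t‖ ^ 2 + ‖f' t‖ ^ 2 :=
    h.l2.integrable_sq.add h.l2'.integrable_sq
  have h2 : ∫ t in x..(x + 1), (‖f t‖ ^ 2 + ‖f' t‖ ^ 2) ≤ M ^ 2 + M ^ 2 := by
    rw [intervalIntegral.integral_of_le (by linarith)]
    refine (setIntegral_le_integral hi
      (ae_of_all _ fun t => by positivity)).trans ?_
    rw [integral_add h.l2.integrable_sq h.l2'.integrable_sq]
    exact add_le_add (h.l2.integral_sq_le hM) (h.l2'.integral_sq_le hM)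
  linarith

lemma SobolevOne.tendsto_zero {f f' : ℝ → E} {M : ℝ} (h : SobolevOne f f' M) {l : Filter ℝ}
    (hl : Tendsto (fun x => ∫ t in x..(x + 1), (‖f t‖ ^ 2 + ‖f' t‖ ^ 2)) l (𝓝 0)) :
    Tendsto f l (𝓝 0) := by
  rw [tendsto_zero_iff_norm_tendsto_zero, Metric.tendsto_nhds]
  intro ε hε
  have hη : 0 < ε / 2 := by linarith
  have h1 := (hl.const_mul (1 / (2 * (ε / 2)))).const_add (ε / 2)
  rw [mul_zero, add_zero] at h1
  filter_upwards [h1.eventually (gt_mem_nhds (show ε / 2 < ε by linarith))] with x hx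
  rw [dist_zero_right, norm_norm]
  exact (h.norm_le_add hη x).trans_lt hx

lemma tendsto_integral_unit_atTop {φ : ℝ → ℝ} (hφ : Integrable φ) :
    Tendsto (fun x => ∫ t in x..(x + 1), φ t) atTop (𝓝 0) := by
  have h1 := intervalIntegral_tendsto_integral_Ioi 0 hφ.integrableOn
    (tendsto_atTop_add_const_right atTop (1 : ℝ) tendsto_id)
  have h2 := intervalIntegral_tendsto_integral_Ioi 0 hφ.integrableOn tendsto_id
  have := h1.sub h2
  rw [sub_self] at this
  refine this.congr fun x => ?_
  rw [intervalIntegral.integral_interval_sub_left hφ.intervalIntegrable hφ.intervalIntegrable]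
  rfl

lemma tendsto_integral_unit_atBot {φ : ℝ → ℝ} (hφ : Integrable φ) :
    Tendsto (fun x => ∫ t in x..(x + 1), φ t) atBot (𝓝 0) := by
  have h1 := intervalIntegral_tendsto_integral_Iic 0 hφ.integrableOn
    (tendsto_atBot_add_const_right atBot (1 : ℝ) tendsto_id)
  have h2 := intervalIntegral_tendsto_integral_Iic 0 hφ.integrableOn tendsto_id
  have := h2.sub h1
  rw [sub_self] at this
  refine this.congr fun x => ?_
  have := intervalIntegral.integral_interval_sub_interval_comm (f := φ) (μ := volume)
    (a := x) (b := 0) (c := x + 1) (d := 0) hφ.intervalIntegrable hφ.intervalIntegrable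
    hφ.intervalIntegrable
  simp only [id] at *
  rw [this]; simp

lemma SobolevOne.tendsto_atTop {f f' : ℝ → E} {M : ℝ} (h : SobolevOne f f' M) :
    Tendsto f atTop (𝓝 0) :=
  h.tendsto_zero (tendsto_integral_unit_atTop (h.l2.integrable_sq.add h.l2'.integrable_sq))

lemma SobolevOne.tendsto_atBot {f f' : ℝ → E} {M : ℝ} (h : SobolevOne f f' M) :
    Tendsto f atBot (𝓝 0) :=
  h.tendsto_zero (tendsto_integral_unit_atBot (h.l2.integrable_sq.add h.l2'.integrable_sq))

lemma SobolevC1.toBoundedC1 [CompleteSpace E] {f f' : ℝ → E} {M : ℝ} (h : SobolevC1 f f' M)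
    (hM : 0 ≤ M) : BoundedC1 f f' (1 + M + M ^ 2) :=
  ⟨h.deriv, h.cont', fun x => (h.toSobolevOne.norm_le hM x).trans (by linarith),
    h.l2'.mono (by nlinarith)⟩

/-- Pointwise `‖f‖ ≤ (1 + y²)⁻¹ + (1 + y²) ‖f‖²`, the elementary form of Cauchy–Schwarz; the first
term integrates to `π`. -/
lemma integrable_of_weighted {E : Type*} [NormedAddCommGroup E] [NormedSpace ℂ E] {f : ℝ → E}
    {M : ℝ} (hM : 0 ≤ M) (h0 : L2le f M) (h1 : L2le (fun y => (y : ℂ) • f y) M) :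
    Integrable f ∧ ∫ y, ‖f y‖ ≤ Real.pi + 2 * M ^ 2 := by
  have i2 : Integrable fun y : ℝ => ‖f y‖ ^ 2 + ‖(y : ℂ) • f y‖ ^ 2 :=
    h0.integrable_sq.add h1.integrable_sq
  have i : Integrable fun y : ℝ => (1 + y ^ 2)⁻¹ + (‖f y‖ ^ 2 + ‖(y : ℂ) • f y‖ ^ 2) :=
    integrable_inv_one_add_sq.add i2
  have hb : ∀ y : ℝ, ‖f y‖ ≤ (1 + y ^ 2)⁻¹ + (‖f y‖ ^ 2 + ‖(y : ℂ) • f y‖ ^ 2) := fun y => by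
    have hp : 0 < 1 + y ^ 2 := by positivity
    rw [norm_smul, Complex.norm_real, Real.norm_eq_abs, mul_pow, sq_abs]
    have e : (1 + y ^ 2)⁻¹ + (‖f y‖ ^ 2 + y ^ 2 * ‖f y‖ ^ 2) - ‖f y‖
        = (1 + y ^ 2)⁻¹ * (((1 + y ^ 2) * ‖f y‖ - 1 / 2) ^ 2 + 3 / 4) := by
      field_simp; ring
    have : 0 ≤ (1 + y ^ 2)⁻¹ * (((1 + y ^ 2) * ‖f y‖ - 1 / 2) ^ 2 + 3 / 4) := by positivity
    linarith
  have hi : Integrable f := i.mono' h0.1 (ae_of_all _ hb)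
  refine ⟨hi, ?_⟩
  refine (integral_mono hi.norm i hb).trans ?_
  rw [integral_add integrable_inv_one_add_sq i2,
    integral_univ_inv_one_add_sq]
  have e : ∫ y, (‖f y‖ ^ 2 + ‖(y : ℂ) • f y‖ ^ 2)
      = (∫ y, ‖f y‖ ^ 2) + ∫ y : ℝ, ‖(y : ℂ) • f y‖ ^ 2 :=
    integral_add h0.integrable_sq h1.integrable_sq
  rw [e]
  have := h0.integral_sq_le hM
  have := h1.integral_sq_le hM
  linarith

end Sobolev

lemma L2le.bdd_mul {R : Type*} [NormedRing R] {f g : ℝ → R} {M K : ℝ}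
    (hf : AEStronglyMeasurable f volume)
    (hfM : ∀ x, ‖f x‖ ≤ M) (hM : 0 ≤ M) (hg : L2le g K) : L2le (fun x => f x * g x) (M * K) :=
  L2le.of_norm_le (hf.mul hg.1) hg hM (ae_of_all _ fun x =>
    (norm_mul_le _ _).trans (mul_le_mul_of_nonneg_right (hfM x) (norm_nonneg _)))

lemma L2le.mul_bdd {R : Type*} [NormedRing R] {f g : ℝ → R} {M K : ℝ}
    (hf : AEStronglyMeasurable f volume)
    (hfM : ∀ x, ‖f x‖ ≤ M) (hM : 0 ≤ M) (hg : L2le g K) : L2le (fun x => g x * f x) (M * K) :=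
  L2le.of_norm_le (hg.1.mul hf) hg hM (ae_of_all _ fun x =>
    (norm_mul_le _ _).trans (by rw [mul_comm]; gcongr; exact hfM x))

section Ring
variable {R : Type*} [NormedRing R] [NormedAlgebra ℂ R]

lemma BoundedC1.mul {G G' f f' : ℝ → R} {M K : ℝ} (hG : BoundedC1 G G' M) (hf : SobolevC1 f f' K)
    (hK : 0 ≤ K) [CompleteSpace R] :
    SobolevC1 (fun x => G x * f x) (fun x => G' x * f x + G x * f' x)
      ((1 + K ^ 2) * M + M * K) := by
  have hM : 0 ≤ M := (norm_nonneg _).trans (hG.bdd 0)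
  have hc := hf.cont
  have hGc := hG.cont
  have hGc' := hG.cont'
  have hc' := hf.cont'
  refine ⟨fun x => (hG.deriv x).mul (hf.deriv x), by fun_prop, ?_, ?_⟩
  · exact (L2le.bdd_mul hGc.aestronglyMeasurable hG.bdd hM hf.l2).mono
      (le_add_of_nonneg_left (by positivity))
  · exact (L2le.mul_bdd hc.aestronglyMeasurable (hf.toSobolevOne.norm_le hK) (by positivity)
      hG.l2').add (L2le.bdd_mul hGc.aestronglyMeasurable hG.bdd hM hf.l2') (by positivity)
      (by positivity)

/-- The primitive of a product of two `H¹` functions which vanishes at `-∞`. -/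
lemma exists_primitive_mul [CompleteSpace R] {f f' g g' : ℝ → R} {M K : ℝ}
    (hf : SobolevOne f f' M) (hg : SobolevOne g g' K) (hM : 0 ≤ M) (hK : 0 ≤ K) :
    ∃ G : ℝ → R, BoundedC1 G (fun x => f x * g x) ((1 + M ^ 2) * K + (M ^ 2 + K ^ 2)) ∧
      Tendsto G atBot (𝓝 0) := by
  have hb : ∀ x, ‖f x * g x‖ ≤ ‖f x‖ ^ 2 + ‖g x‖ ^ 2 := fun x => by
    refine (norm_mul_le _ _).trans ?_
    nlinarith [sq_nonneg (‖f x‖ - ‖g x‖), sq_nonneg (‖f x‖ + ‖g x‖)]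
  have hc : Continuous fun x => f x * g x := hf.cont.mul hg.cont
  have hi2 : Integrable fun x => ‖f x‖ ^ 2 + ‖g x‖ ^ 2 :=
    hf.l2.integrable_sq.add hg.l2.integrable_sq
  have hi : Integrable fun x => f x * g x :=
    hi2.mono' hc.aestronglyMeasurable (ae_of_all _ hb)
  have hbd : ∀ s : Set ℝ, ‖∫ y in s, f y * g y‖ ≤ M ^ 2 + K ^ 2 := fun s => by
    refine (norm_integral_le_of_norm_le hi2.integrableOn (ae_of_all _ hb)).trans ?_
    refine (setIntegral_le_integral hi2 (ae_of_all _ fun x => by positivity)).trans ?_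
    rw [integral_add hf.l2.integrable_sq hg.l2.integrable_sq]
    exact add_le_add (hf.l2.integral_sq_le hM) (hg.l2.integral_sq_le hK)
  have he : (fun x => ∫ y in Iic x, f y * g y)
      = fun x => (∫ y, f y * g y) - tail (fun y => f y * g y) x := by
    ext x
    rw [tail, ← intervalIntegral.integral_Iic_add_Ioi (b := x) hi.integrableOn hi.integrableOn]
    abel
  refine ⟨fun x => ∫ y in Iic x, f y * g y, ⟨fun x => ?_, hc, fun x => ?_, ?_⟩, ?_⟩
  · rw [he]
    simpa using (hasDerivAt_tail hi hc x).const_sub (∫ y, f y * g y)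
  · exact (hbd _).trans (le_add_of_nonneg_left (by positivity))
  · exact (L2le.bdd_mul hf.cont.aestronglyMeasurable (hf.norm_le hM) (by positivity)
      hg.l2).mono (le_add_of_nonneg_right (by positivity))
  · rw [he]
    simpa using (tendsto_tail_atBot hi).const_sub (∫ y, f y * g y)

end Ring

end AKNS

namespace AKNS
open Filter Topology FourierTransform
open scoped ENNReal

/-! ## The two-component model and its recursion operator -/

/-- `f` is twice continuously differentiable with derivatives `f₁`, `f₂`, and `f₂` is a primitive
of `f₃`; the norms which make up the norm of `H^{1,1} ∩ H^3` are at most `U`. -/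
structure Potential {E : Type*} [NormedAddCommGroup E] [NormedSpace ℂ E] (U : ℝ)
    (f f₁ f₂ f₃ : ℝ → E) : Prop where
  d0 : ∀ x, HasDerivAt f (f₁ x) x
  d1 : ∀ x, HasDerivAt f₁ (f₂ x) x
  s2 : SobolevOne f₂ f₃ U
  l0 : L2le f U
  w0 : L2le (fun y => (y : ℂ) • f y) U
  l1 : L2le f₁ U
  w1 : L2le (fun y => (y : ℂ) • f₁ y) U

lemma Potential.c0 {E : Type*} [NormedAddCommGroup E] [NormedSpace ℂ E] {U : ℝ}
    {f f₁ f₂ f₃ : ℝ → E} (h : Potential U f f₁ f₂ f₃) : SobolevC1 f f₁ U :=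
  ⟨h.d0, continuous_iff_continuousAt.2 fun x => (h.d1 x).continuousAt, h.l0, h.l1⟩

lemma Potential.c1 {E : Type*} [NormedAddCommGroup E] [NormedSpace ℂ E] {U : ℝ}
    {f f₁ f₂ f₃ : ℝ → E} (h : Potential U f f₁ f₂ f₃) : SobolevC1 f₁ f₂ U :=
  ⟨h.d1, h.s2.cont, h.l1, h.s2.l2⟩

lemma tendsto_mul_of_bdd {R : Type*} [NormedRing R] {l : Filter ℝ} {f g : ℝ → R} {K : ℝ}
    (hf : ∀ x, ‖f x‖ ≤ K)
    (hg : Tendsto g l (𝓝 0)) : Tendsto (fun x => f x * g x) l (𝓝 0) := by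
  rw [tendsto_zero_iff_norm_tendsto_zero] at hg ⊢
  refine squeeze_zero (fun x => norm_nonneg _) (fun x => (norm_mul_le _ _).trans
    (mul_le_mul_of_nonneg_right (hf x) (norm_nonneg _))) ?_
  simpa using hg.const_mul K

lemma tendsto_mul_of_bdd' {R : Type*} [NormedRing R] {l : Filter ℝ} {f g : ℝ → R} {K : ℝ}
    (hf : ∀ x, ‖f x‖ ≤ K)
    (hg : Tendsto g l (𝓝 0)) : Tendsto (fun x => g x * f x) l (𝓝 0) := by
  rw [tendsto_zero_iff_norm_tendsto_zero] at hg ⊢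
  refine squeeze_zero (fun x => norm_nonneg _) (fun x => (norm_mul_le _ _).trans
    (mul_le_mul_of_nonneg_left (hf x) (norm_nonneg _))) ?_
  simpa using hg.mul_const K

section Model
variable {R : Type*} [NormedRing R] [NormedAlgebra ℂ R]

/-- `(A, B)` solves `A' = e^{-iκzx} u B`, `B' = e^{iκzx} v A`, with limits `(1, 0)` at `+∞` and
`(a, b)` at `-∞`. -/
structure ModelSolution (κ z : ℝ) (u v A B : ℝ → R) (a b : R) : Prop where
  dA : ∀ x, HasDerivAt A (ph (-(κ * z * x)) • (u x * B x)) x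
  dB : ∀ x, HasDerivAt B (ph (κ * z * x) • (v x * A x)) x
  A_top : Tendsto A atTop (𝓝 1)
  B_top : Tendsto B atTop (𝓝 0)
  A_bot : Tendsto A atBot (𝓝 a)
  B_bot : Tendsto B atBot (𝓝 b)

/-- The truncated oscillatory integral of `g` against the amplitude `A`. -/
noncomputable def osc (κ z T : ℝ) (A g : ℝ → R) : R :=
  ∫ y in (-T)..T, (ph (κ * z * y) • g y) * A y

lemma ModelSolution.contA {κ z : ℝ} {u v A B : ℝ → R} {a b : R}
    (h : ModelSolution κ z u v A B a b) : Continuous A :=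
  continuous_iff_continuousAt.2 fun x => (h.dA x).continuousAt

lemma ModelSolution.contB {κ z : ℝ} {u v A B : ℝ → R} {a b : R}
    (h : ModelSolution κ z u v A B a b) : Continuous B :=
  continuous_iff_continuousAt.2 fun x => (h.dB x).continuousAt

lemma tendsto_osc_next {κ z : ℝ} {A g g₁ : ℝ → R} {w : R}
    (h : Tendsto (fun k : ℕ => osc κ z k A g) atTop (𝓝 w))
    (h1 : Tendsto (fun k : ℕ => (Complex.I * ((κ * z : ℝ) : ℂ)) • osc κ z k A g + osc κ z k A g₁)
      atTop (𝓝 0)) :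
    Tendsto (fun k : ℕ => osc κ z k A g₁) atTop (𝓝 (-((Complex.I * ((κ * z : ℝ) : ℂ)) • w))) := by
  have := h1.sub (h.const_smul (Complex.I * ((κ * z : ℝ) : ℂ)))
  simpa using this

variable [CompleteSpace R]

/-- Multiplication by the spectral parameter acts on oscillatory integrals through the recursion
operator `g ↦ g' - (∫_{-∞}^x g u) v`. -/
lemma tendsto_osc_recursion {κ z : ℝ} {u v A B : ℝ → R} {a b : R}
    (h : ModelSolution κ z u v A B a b) (hu : Continuous u) (hv : Continuous v)
    {g g' G : ℝ → R} {M K : ℝ} (hg : SobolevOne g g' M)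
    (hG : ∀ x, HasDerivAt G (g x * u x) x) (hG0 : Tendsto G atBot (𝓝 0)) (hGK : ∀ x, ‖G x‖ ≤ K) :
    Tendsto (fun k : ℕ => (Complex.I * ((κ * z : ℝ) : ℂ)) • osc κ z k A g
      + osc κ z k A (fun x => g' x - G x * v x)) atTop (𝓝 0) := by
  set lam : ℂ := Complex.I * ((κ * z : ℝ) : ℂ) with hlam
  have hA := h.contA
  have hB := h.contB
  have hgc := hg.cont
  have hGc : Continuous G := continuous_iff_continuousAt.2 fun x => (hG x).continuousAt
  -- In `F = e^{iκzy} A` the phase cancels the one in `A'`, so `F' = iκz F + u B` with no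
  -- oscillating factor left on `u B`.
  set F : ℝ → R := fun y => ph (κ * z * y) • A y with hF
  set F' : ℝ → R := fun y => lam • (ph (κ * z * y) • A y) + u y * B y with hF'
  have hFd : ∀ y, HasDerivAt F (F' y) y := fun y => by
    refine ((hasDerivAt_ph (κ * z) y).smul (h.dA y)).congr_deriv ?_
    simp only [hF', smul_smul]
    rw [← hlam, ph_mul_neg_self, one_smul, add_comm]
  have hF'c : Continuous F' := by fun_prop
  obtain ⟨CA, hCA⟩ := exists_norm_le_of_tendsto hA h.A_top h.A_bot
  obtain ⟨CB, hCB⟩ := exists_norm_le_of_tendsto hB h.B_top h.B_bot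
  -- An exact identity before the limit. Integrating `g' F` by parts produces `∫ g u B`; as `g u =
  -- G'`, a second integration by parts turns it into `-∫ G B'`, which is again an oscillatory
  -- integral against `A`.
  have key : ∀ k : ℕ, lam • osc κ z k A g + osc κ z k A (fun x => g' x - G x * v x)
      = (g k * F k - g (-k) * F (-k)) - (G k * B k - G (-k) * B (-k)) := fun k => by
    have hk : -(k : ℝ) ≤ k := by have : (0 : ℝ) ≤ k := k.cast_nonneg; linarith
    have e1 := integral_mul_of_primitive (f := g) (f' := g') (F := F) (F' := F') hk
      (hg.l2'.intervalIntegrable _ _) (fun x _ => hg.sub_eq _ _) hFd hF'c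
    have c1 : Continuous fun y => lam • ((ph (κ * z * y) • g y) * A y) := by fun_prop
    have c2 : Continuous fun y => (g y * u y) * B y := by fun_prop
    have c3 : Continuous fun y => (ph (κ * z * y) • (G y * v y)) * A y := by fun_prop
    have e2 : ∫ y in (-(k : ℝ))..k, g y * F' y
        = lam • osc κ z k A g + ∫ y in (-(k : ℝ))..k, (g y * u y) * B y := by
      rw [osc, ← intervalIntegral.integral_smul, ← intervalIntegral.integral_add
        (c1.intervalIntegrable _ _) (c2.intervalIntegrable _ _)]
      refine intervalIntegral.integral_congr fun y _ => ?_
      simp only [hF', mul_add, mul_smul_comm, smul_mul_assoc, mul_assoc]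
    have e3 := intervalIntegral.integral_eq_sub_of_hasDerivAt (a := -(k : ℝ)) (b := k)
      (f := fun y => G y * B y)
      (f' := fun y => (g y * u y) * B y + (ph (κ * z * y) • (G y * v y)) * A y)
      (fun y _ => ((hG y).mul (h.dB y)).congr_deriv (by
        simp only [mul_smul_comm, smul_mul_assoc, mul_assoc]))
      ((c2.add c3).intervalIntegrable _ _)
    rw [intervalIntegral.integral_add (c2.intervalIntegrable _ _) (c3.intervalIntegrable _ _)] at e3
    have i4 : IntervalIntegrable (fun y => (ph (κ * z * y) • g' y) * A y) volume (-(k : ℝ)) k := by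
      have h1 := (hg.l2'.intervalIntegrable (-(k : ℝ)) k).continuousOn_smul
        (f := fun y => ph (κ * z * y)) (by fun_prop)
      exact h1.mul_continuousOn hA.continuousOn
    have e4 : osc κ z k A (fun x => g' x - G x * v x)
        = (∫ y in (-(k : ℝ))..k, g' y * F y)
          - ∫ y in (-(k : ℝ))..k, (ph (κ * z * y) • (G y * v y)) * A y := by
      have : ∫ y in (-(k : ℝ))..k, g' y * F y
          = ∫ y in (-(k : ℝ))..k, (ph (κ * z * y) • g' y) * A y := by
        refine intervalIntegral.integral_congr fun y _ => ?_
        simp only [hF, mul_smul_comm, smul_mul_assoc]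
      rw [this, osc, ← intervalIntegral.integral_sub i4 (c3.intervalIntegrable _ _)]
      refine intervalIntegral.integral_congr fun y _ => ?_
      simp only [smul_sub, sub_mul]
    rw [e4, e1, e2, ← sub_eq_iff_eq_add'.2 e3.symm]
    abel
  simp only [key]
  have hbF : ∀ x, ‖F x‖ ≤ CA := fun x => by rw [hF, norm_ph_smul]; exact hCA x
  -- All four boundary terms vanish: `g` decays at both ends, while for `G B` it is `B` that decays
  -- at `+∞` and `G` at `-∞`. This is why `G` is the primitive based at `-∞`.
  have t1 : Tendsto (fun x => g x * F x) atTop (𝓝 0) := tendsto_mul_of_bdd' hbF hg.tendsto_atTop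
  have t2 : Tendsto (fun x => g x * F x) atBot (𝓝 0) := tendsto_mul_of_bdd' hbF hg.tendsto_atBot
  have t3 : Tendsto (fun x => G x * B x) atTop (𝓝 0) := tendsto_mul_of_bdd hGK h.B_top
  have t4 : Tendsto (fun x => G x * B x) atBot (𝓝 0) := tendsto_mul_of_bdd' hCB hG0
  have n1 : Tendsto (fun k : ℕ => (k : ℝ)) atTop atTop := tendsto_natCast_atTop_atTop
  have n2 : Tendsto (fun k : ℕ => -(k : ℝ)) atTop atBot := tendsto_neg_atTop_atBot.comp n1
  simpa using ((t1.comp n1).sub (t2.comp n2)).sub ((t3.comp n1).sub (t4.comp n2))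

lemma tendsto_osc {κ z : ℝ} {u v A B : ℝ → R} {a b : R}
    (h : ModelSolution κ z u v A B a b) (hv : Continuous v) :
    Tendsto (fun k : ℕ => osc κ z k A v) atTop (𝓝 (-b)) := by
  have hA := h.contA
  have key : ∀ k : ℕ, osc κ z k A v = B k - B (-k) := fun k => by
    have c : Continuous fun y => (ph (κ * z * y) • v y) * A y := by fun_prop
    rw [osc, intervalIntegral.integral_eq_sub_of_hasDerivAt (f := B) (fun y _ =>
      (h.dB y).congr_deriv (by rw [smul_mul_assoc])) (c.intervalIntegrable _ _)]
  simp only [key]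
  have n1 : Tendsto (fun k : ℕ => (k : ℝ)) atTop atTop := tendsto_natCast_atTop_atTop
  have n2 : Tendsto (fun k : ℕ => -(k : ℝ)) atTop atBot := tendsto_neg_atTop_atBot.comp n1
  simpa using (h.B_top.comp n1).sub (h.B_bot.comp n2)

/-- The first three iterates of the recursion operator, with bounds. -/
lemma exists_recursion_bounds (U : ℝ) (hU : 0 ≤ U) :
    ∃ K : ℝ, 0 ≤ K ∧ ∀ u u₁ u₂ u₃ v v₁ v₂ v₃ : ℝ → R, Potential U u u₁ u₂ u₃ →
      Potential U v v₁ v₂ v₃ → ∃ g₁ g₁' g₂ g₂' V G₁ G₂ : ℝ → R,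
        SobolevOne g₁ g₁' K ∧ L2le (fun y => (y : ℂ) • g₁ y) K ∧ SobolevOne g₂ g₂' K ∧
        L2le (fun x => g₂' x - G₂ x * v x) K ∧
        (BoundedC1 V (fun x => v x * u x) K ∧ Tendsto V atBot (𝓝 0)) ∧
        (BoundedC1 G₁ (fun x => g₁ x * u x) K ∧ Tendsto G₁ atBot (𝓝 0)) ∧
        (BoundedC1 G₂ (fun x => g₂ x * u x) K ∧ Tendsto G₂ atBot (𝓝 0)) ∧
        (∀ x, v₁ x - V x * v x = g₁ x) ∧ (∀ x, g₁' x - G₁ x * v x = g₂ x) := by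
  -- The constants are introduced through equations so that they stay opaque to the arithmetic
  -- tactics.
  obtain ⟨K₁, hK₁⟩ : ∃ K₁, K₁ = (1 + U ^ 2) * U + (U ^ 2 + U ^ 2) := ⟨_, rfl⟩
  obtain ⟨K₂, hK₂⟩ : ∃ K₂, K₂ = U + ((1 + U ^ 2) * K₁ + K₁ * U) := ⟨_, rfl⟩
  obtain ⟨K₃, hK₃⟩ : ∃ K₃, K₃ = (1 + K₂ ^ 2) * U + (K₂ ^ 2 + U ^ 2) := ⟨_, rfl⟩
  obtain ⟨W, hW⟩ : ∃ W, W = 1 + U + U ^ 2 := ⟨_, rfl⟩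
  obtain ⟨W₂, hW₂⟩ : ∃ W₂, W₂ = (1 + U ^ 2) * W + W * U := ⟨_, rfl⟩
  obtain ⟨W₃, hW₃⟩ : ∃ W₃, W₃ = (1 + U ^ 2) * (1 + W₂ + W₂ ^ 2) + (1 + W₂ + W₂ ^ 2) * U :=
    ⟨_, rfl⟩
  obtain ⟨K₄, hK₄⟩ : ∃ K₄, K₄ = U + (W₃ + ((1 + U ^ 2) * K₁ + K₁ * U)
    + ((1 + U ^ 2) * K₃ + K₃ * U)) := ⟨_, rfl⟩
  obtain ⟨K₅, hK₅⟩ : ∃ K₅, K₅ = (1 + K₄ ^ 2) * U + (K₄ ^ 2 + U ^ 2) := ⟨_, rfl⟩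
  have p1 : 0 ≤ K₁ := by rw [hK₁]; positivity
  have p2 : 0 ≤ K₂ := by rw [hK₂]; positivity
  have p3 : 0 ≤ K₃ := by rw [hK₃]; positivity
  have pW : 0 ≤ W := by rw [hW]; positivity
  have pW₂ : 0 ≤ W₂ := by rw [hW₂]; positivity
  have pW₃ : 0 ≤ W₃ := by rw [hW₃]; positivity
  have p4 : 0 ≤ K₄ := by rw [hK₄]; positivity
  have p5 : 0 ≤ K₅ := by rw [hK₅]; positivity
  have q1 : 0 ≤ K₁ * U := by positivity
  have q5 : 0 ≤ K₅ * U := by positivity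
  refine ⟨U + K₁ + K₂ + K₃ + K₄ + K₅ + K₁ * U + K₅ * U, by positivity, ?_⟩
  intro u u₁ u₂ u₃ v v₁ v₂ v₃ hu hv
  obtain ⟨V, hV, hV0⟩ := exists_primitive_mul hv.c0.toSobolevOne hu.c0.toSobolevOne hU hU
  rw [← hK₁] at hV
  have hVv := hV.mul hv.c0 hU
  have sg₁ := hv.c1.sub hVv hU (by positivity)
  rw [← hK₂] at sg₁
  obtain ⟨G₁, hG₁, hG₁0⟩ := exists_primitive_mul sg₁.toSobolevOne hu.c0.toSobolevOne p2 hU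
  rw [← hK₃] at hG₁
  -- Preparation for `g₂ = v'' - ((V v)' + G₁ v)` with `(V v)' = v u v + V v'`. The sum in
  -- parentheses must be of class `C¹`, because `g₂` is differentiated once more; for `v''` only a
  -- square integrable weak derivative is available.
  have bv := hv.c0.toBoundedC1 hU
  rw [← hW] at bv
  have hvu := bv.mul hu.c0 hU
  rw [← hW₂] at hvu
  have hvuv := (hvu.toBoundedC1 pW₂).mul hv.c0 hU
  rw [← hW₃] at hvuv
  have hVv₁ := hV.mul hv.c1 hU
  have hG₁v := hG₁.mul hv.c0 hU
  have sum := (hvuv.add hVv₁ pW₃ (by positivity)).add hG₁v (by positivity) (by positivity)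
  have sg₂ := hv.s2.sub sum.toSobolevOne hU (by positivity)
  rw [← hK₄] at sg₂
  obtain ⟨G₂, hG₂, hG₂0⟩ := exists_primitive_mul sg₂ hu.c0.toSobolevOne p4 hU
  rw [← hK₅] at hG₂
  refine ⟨_, _, _, _, V, G₁, G₂, sg₁.toSobolevOne.mono ?_, ?_, sg₂.mono ?_, ?_,
    ⟨⟨hV.deriv, hV.cont', fun x => (hV.bdd x).trans ?_, hV.l2'.mono ?_⟩, hV0⟩,
    ⟨⟨hG₁.deriv, hG₁.cont', fun x => (hG₁.bdd x).trans ?_, hG₁.l2'.mono ?_⟩, hG₁0⟩,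
    ⟨⟨hG₂.deriv, hG₂.cont', fun x => (hG₂.bdd x).trans ?_, hG₂.l2'.mono ?_⟩, hG₂0⟩,
    fun x => rfl, fun x => ?_⟩
  any_goals linarith
  · have h1 := L2le.bdd_mul hV.cont.aestronglyMeasurable hV.bdd p1 hv.w0
    have h2 := hv.w1.sub h1 hU q1
    refine (h2.congr (ae_of_all _ fun x => ?_)).mono (by linarith)
    simp only [mul_smul_comm, smul_sub]
  · have h1 := L2le.bdd_mul hG₂.cont.aestronglyMeasurable hG₂.bdd p5 hv.l0
    exact (sg₂.l2'.sub h1 p4 q5).mono (by linarith)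
  · abel

end Model

end AKNS

namespace AKNS
open Filter Topology FourierTransform
open scoped ENNReal

/-! ## Bounds for the scattering coefficients of the model -/

lemma TransLip.clm {E F : Type*} [NormedAddCommGroup E] [NormedSpace ℂ E] [NormedAddCommGroup F]
    [NormedSpace ℂ F] {f : ℝ → E} {C : ℝ} (hf : TransLip f C) (L : E →L[ℂ] F) :
    TransLip (fun z => L (f z)) (‖L‖ * C) := fun h => by
  refine (eLpNorm_le_mul_eLpNorm_of_ae_le_mul (g := fun z => f (z + h) - f z) (c := ‖L‖)
    (ae_of_all _ fun z => ?_) 2).trans ?_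
  · rw [← map_sub]; exact L.le_opNorm _
  · rw [mul_assoc, ENNReal.ofReal_mul (norm_nonneg _)]
    gcongr
    exact hf h

lemma TransLip.mono {E : Type*} [NormedAddCommGroup E] {f : ℝ → E} {C D : ℝ} (hf : TransLip f C)
    (h : C ≤ D) : TransLip f D := fun t =>
  (hf t).trans (ENNReal.ofReal_le_ofReal (by gcongr))

section Block
variable {R E : Type*} [NormedRing R] [NormedAlgebra ℂ R] [NormedAddCommGroup E] [NormedSpace ℂ E]

/-- The operator `w ↦ i (x * p w)` as a function of `x`. -/
noncomputable def blockMul (i : R →L[ℂ] E) (p : E →L[ℂ] R) : R →L[ℂ] (E →L[ℂ] E) :=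
  (ContinuousLinearMap.compL ℂ E R E i) ∘L
    ((ContinuousLinearMap.compL ℂ E R R).flip p) ∘L (ContinuousLinearMap.mul ℂ R)

@[simp] lemma blockMul_apply (i : R →L[ℂ] E) (p : E →L[ℂ] R) (x : R) (w : E) :
    blockMul i p x w = i (x * p w) := rfl

lemma norm_blockMul_apply_le (i : R →L[ℂ] E) (p : E →L[ℂ] R) {k : ℝ} (hk : ‖blockMul i p‖ ≤ k)
    (x : R) : ‖blockMul i p x‖ ≤ k * ‖x‖ :=
  (blockMul i p).le_of_opNorm_le hk x

lemma hasDerivAt_blockMul (i : R →L[ℂ] E) (p : E →L[ℂ] R) {f : ℝ → R} {f' : R} {x : ℝ}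
    (hf : HasDerivAt f f' x) : HasDerivAt (fun x => blockMul i p (f x)) (blockMul i p f') x :=
  ((blockMul i p).restrictScalars ℝ).hasFDerivAt.comp_hasDerivAt x hf

end Block

section Bounds
variable {R : Type*} [NormedRing R] [NormedAlgebra ℂ R]

/-- The variation of `A` is controlled by `M ‖u‖` uniformly in `z`, so the truncated integrals lie
below the majorants of the single function `g`, and the bound passes to the limit by Fatou. -/
lemma eLpNorm_le_of_tendsto_osc [CompleteSpace R] {κ C₀ M W K : ℝ} (hC₀ : 0 ≤ C₀)
    (hP : ∀ g : ℝ → R, Integrable g → MemLp g 2 volume →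
      eLpNorm (fun z => ∫ y, ph (κ * z * y) • g y) 2 volume
        ≤ ENNReal.ofReal C₀ * eLpNorm g 2 volume)
    {u v : ℝ → R} {A B : ℝ → ℝ → R} {a b : ℝ → R}
    (h : ∀ z, ModelSolution κ z u v (A z) (B z) (a z) (b z)) (hu : Continuous u)
    (ui : Integrable u) (hW : ∫ y, ‖u y‖ ≤ W) (hM : 0 ≤ M) (hA : ∀ z x, ‖A z x‖ ≤ M)
    (hB : ∀ z x, ‖B z x‖ ≤ M) {g f : ℝ → R} (hg : L2le g K)
    (hf : ∀ z, Tendsto (fun k : ℕ => osc κ z k (A z) g) atTop (𝓝 (f z))) :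
    eLpNorm f 2 volume ≤ ENNReal.ofReal ((M + M * W) * (C₀ * K)) := by
  have hW0 : 0 ≤ W := (integral_nonneg fun y => norm_nonneg _).trans hW
  have hcB := fun z => (h z).contB
  have hmaj := fun k : ℕ => eLpNorm_majorant_le (κ := κ) (T := k) (M := M) (W := M * W) hC₀ hP hg
    k.cast_nonneg hM (by positivity) (w := fun y => M * ‖u y‖) (by fun_prop)
    (fun t => by positivity) (by
      have hk : -(k : ℝ) ≤ k := by have : (0 : ℝ) ≤ k := k.cast_nonneg; linarith
      rw [intervalIntegral.integral_const_mul, intervalIntegral.integral_of_le hk]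
      gcongr
      exact (setIntegral_le_integral ui.norm (ae_of_all _ fun y => norm_nonneg _)).trans hW)
  refine eLpNorm_le_of_tendsto (D := fun k z => majorant κ k M (fun y => M * ‖u y‖) g z)
    (fun k => (hmaj k).1) (fun k => (hmaj k).2) (fun k z => ?_) hf
  refine norm_integral_osc_le_of_integrable k.cast_nonneg hg.locallyIntegrable hu.norm
    (h z).dA ?_ (hA z) fun x => ?_
  · have := hcB z
    fun_prop
  · rw [norm_ph_smul]
    calc ‖u x * B z x‖ ≤ ‖u x‖ * ‖B z x‖ := norm_mul_le _ _
      _ ≤ ‖u x‖ * M := by gcongr; exact hB z x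
      _ = _ := mul_comm _ _

lemma hasDerivAt_osc_primitive [CompleteSpace R] {κ z : ℝ} {A g : ℝ → R} (hA : Continuous A)
    (hg : Continuous g) (hi : Integrable fun y => ph (κ * z * y) • (g y * A y)) (x : ℝ) :
    HasDerivAt (fun x => -tail (fun y => ph (κ * z * y) • (g y * A y)) x)
      (ph (κ * z * x) • (g x * A x)) x := by
  have := (hasDerivAt_tail hi (by fun_prop) x).neg
  rwa [neg_neg] at this

/-- In `1 - a = ∫ e^{-iκzy} u B` one integration by parts gains a factor `z`. The derivative falls
on `u`, which uses that `u'` is integrable, or on `B`, whose derivative cancels the phase and leaves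
the absolutely convergent integral of `u v A`. -/
lemma ModelSolution.norm_mul_sub_one_le [CompleteSpace R] {κ z : ℝ} {u u₁ v A B : ℝ → R}
    {a b : R} {M U W : ℝ} (h : ModelSolution κ z u v A B a b) (hu : SobolevC1 u u₁ U)
    (hv : Continuous v) (ui : Integrable u) (u₁i : Integrable u₁) (hv2 : L2le v U) (hU : 0 ≤ U)
    (hW : ∫ y, ‖u₁ y‖ ≤ W) (hA : ∀ x, ‖A x‖ ≤ M) (hB : ∀ x, ‖B x‖ ≤ M) :
    ‖(Complex.I * ((κ * z : ℝ) : ℂ)) • (a - 1)‖ ≤ W * M + (U ^ 2 + U ^ 2) * M := by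
  have hM : 0 ≤ M := (norm_nonneg _).trans (hA 0)
  have cA := h.contA
  have cB := h.contB
  have cu := hu.cont
  have cu₁ := hu.cont'
  set lam : ℂ := Complex.I * ((κ * z : ℝ) : ℂ) with hlam
  have bi : ∀ {f : ℝ → R}, Continuous f → Integrable f → ∀ s : ℝ → ℂ, Continuous s →
      (∀ y, ‖s y‖ = 1) → Integrable fun y => s y • (f y * B y) := by
    intro f hf hfi s hs hs1
    refine (hfi.norm.mul_const M).mono' (Continuous.aestronglyMeasurable (by fun_prop))
      (ae_of_all _ fun y => ?_)
    rw [norm_smul, hs1, one_mul]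
    exact (norm_mul_le _ _).trans (mul_le_mul_of_nonneg_left (hB y) (norm_nonneg _))
  have i1 : Integrable fun y => ph (-(κ * z * y)) • (u y * B y) :=
    bi cu ui _ (by fun_prop) fun y => norm_ph _
  have i2 : Integrable fun y => ph (-(κ * z * y)) • (u₁ y * B y) :=
    bi cu₁ u₁i _ (by fun_prop) fun y => norm_ph _
  have hsq : Integrable fun y => ‖u y‖ ^ 2 + ‖v y‖ ^ 2 :=
    hu.l2.integrable_sq.add hv2.integrable_sq
  have b3 : ∀ y, ‖u y * (v y * A y)‖ ≤ (‖u y‖ ^ 2 + ‖v y‖ ^ 2) * M := fun y => by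
    calc ‖u y * (v y * A y)‖ ≤ ‖u y‖ * (‖v y‖ * ‖A y‖) :=
          (norm_mul_le _ _).trans (by gcongr; exact norm_mul_le _ _)
      _ ≤ ‖u y‖ * (‖v y‖ * M) := by gcongr; exact hA y
      _ = (‖u y‖ * ‖v y‖) * M := by ring
      _ ≤ _ := by
          gcongr
          nlinarith [sq_nonneg (‖u y‖ - ‖v y‖), sq_nonneg (‖u y‖ + ‖v y‖)]
  have i3 : Integrable fun y => u y * (v y * A y) :=
    (hsq.mul_const M).mono' (Continuous.aestronglyMeasurable (by fun_prop)) (ae_of_all _ b3)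
  have e1 : ∫ y, ph (-(κ * z * y)) • (u y * B y) = 1 - a :=
    integral_of_hasDerivAt_of_tendsto h.dA i1 h.A_bot h.A_top
  -- The integrand is the derivative of `e^{-iκzy} u B`, which vanishes at both ends because `u`
  -- does.
  have e2 : ∫ y, ((-lam) • (ph (-(κ * z * y)) • (u y * B y))
      + (ph (-(κ * z * y)) • (u₁ y * B y) + u y * (v y * A y))) = 0 - 0 := by
    refine integral_of_hasDerivAt_of_tendsto (f := fun y => ph (-(κ * z * y)) • (u y * B y))
      (fun y => ?_) ((i1.smul (-lam)).add (i2.add i3)) ?_ ?_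
    · have hp : HasDerivAt (fun y => ph (-(κ * z * y))) (-lam * ph (-(κ * z * y))) y := by
        have := hasDerivAt_ph (-(κ * z)) y
        simp only [neg_mul] at this
        refine this.congr_deriv ?_
        rw [hlam]; push_cast; ring
      refine (hp.smul ((hu.deriv y).mul (h.dB y))).congr_deriv ?_
      rw [mul_smul_comm, smul_add, smul_smul, smul_smul, ph_neg_mul_self, one_smul]
      abel
    · have := tendsto_mul_of_bdd' hB hu.toSobolevOne.tendsto_atBot
      rw [tendsto_zero_iff_norm_tendsto_zero] at this ⊢
      simpa only [norm_ph_smul] using this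
    · have := tendsto_mul_of_bdd' hB hu.toSobolevOne.tendsto_atTop
      rw [tendsto_zero_iff_norm_tendsto_zero] at this ⊢
      simpa only [norm_ph_smul] using this
  have i1' : Integrable fun y => (-lam) • (ph (-(κ * z * y)) • (u y * B y)) := i1.smul (-lam)
  have i23 : Integrable fun y => ph (-(κ * z * y)) • (u₁ y * B y) + u y * (v y * A y) := i2.add i3
  rw [integral_add i1' i23, integral_smul, e1, integral_add i2 i3] at e2
  have e3 : lam • (a - 1) = -((∫ y, ph (-(κ * z * y)) • (u₁ y * B y))
      + ∫ y, u y * (v y * A y)) := by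
    rw [sub_zero, neg_smul, ← smul_neg, neg_sub] at e2
    exact eq_neg_of_add_eq_zero_left e2
  rw [e3, norm_neg]
  refine (norm_add_le _ _).trans (add_le_add ?_ ?_)
  · refine (norm_integral_le_of_norm_le (u₁i.norm.mul_const M) (ae_of_all _ fun y => ?_)).trans ?_
    · rw [norm_ph_smul]
      exact (norm_mul_le _ _).trans (mul_le_mul_of_nonneg_left (hB y) (norm_nonneg _))
    · rw [integral_mul_const]; gcongr
  · refine (norm_integral_le_of_norm_le (hsq.mul_const M) (ae_of_all _ b3)).trans ?_
    rw [integral_mul_const, integral_add hu.l2.integrable_sq hv2.integrable_sq]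
    gcongr
    exacts [hu.l2.integral_sq_le hU, hv2.integral_sq_le hU]

lemma TransLip.const_smul {E : Type*} [NormedAddCommGroup E] [NormedSpace ℂ E] {f : ℝ → E} {C : ℝ}
    (hf : TransLip f C) (c : ℂ) : TransLip (fun z => c • f z) (‖c‖ * C) := fun h => by
  refine (eLpNorm_le_mul_eLpNorm_of_ae_le_mul (g := fun z => f (z + h) - f z) (c := ‖c‖)
    (ae_of_all _ fun z => ?_) 2).trans ?_
  · rw [← smul_sub, norm_smul]
  · rw [mul_assoc, ENNReal.ofReal_mul (norm_nonneg _)]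
    gcongr
    exact hf h

/-- Bounds for the scattering coefficients `a`, `b` of the model. -/
structure CoefficientBounds (C : ℝ) (a b : ℝ → R) : Prop where
  a_cont : Continuous a
  b_cont : Continuous b
  a_le : ∀ z, ‖a z‖ ≤ C
  b_le : ∀ z, ‖b z‖ ≤ C
  zb_le : ∀ z : ℝ, ‖(z : ℂ) • b z‖ ≤ C
  za_le : ∀ z : ℝ, ‖(z : ℂ) • (a z - 1)‖ ≤ C
  a_lip : TransLip a C
  b_lip : TransLip b C
  zb_lip : TransLip (fun z => (z : ℂ) • b z) C
  b_l2 : eLpNorm b 2 volume ≤ ENNReal.ofReal C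
  z3b_l2 : eLpNorm (fun z : ℝ => (z : ℂ) ^ 3 • b z) 2 volume ≤ ENNReal.ofReal C

/-- Bounds for the model extended by the oscillatory primitive of a third function `g`; the spaces
of the three components are the images of the idempotents given by `i₁`, `i₂`, `i₃` and `p₁`, `p₂`,
`p₃`. -/
theorem exists_extended_bounds [FiniteDimensional ℂ R] {E : Type*} [NormedAddCommGroup E]
    [NormedSpace ℂ E] [FiniteDimensional ℂ E] {i₁ i₂ i₃ : R →L[ℂ] E} {p₁ p₂ p₃ : E →L[ℂ] R}
    (h11 : ∀ x, p₁ (i₁ x) = x) (h12 : ∀ x, p₁ (i₂ x) = 0) (h13 : ∀ x, p₁ (i₃ x) = 0)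
    (h21 : ∀ x, p₂ (i₁ x) = 0) (h22 : ∀ x, p₂ (i₂ x) = x) (h23 : ∀ x, p₂ (i₃ x) = 0)
    (h31 : ∀ x, p₃ (i₁ x) = 0) (h32 : ∀ x, p₃ (i₂ x) = 0) (h33 : ∀ x, p₃ (i₃ x) = x)
    {κ : ℝ} (hκ : κ ≠ 0) (U : ℝ) (hU : 0 ≤ U) :
    ∃ M : ℝ, 0 ≤ M ∧ ∀ u v g : ℝ → R, Continuous u → Continuous v → Continuous g →
      L2le u U → L2le v U → L2le g U → L2le (fun y : ℝ => (y : ℂ) • u y) U →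
      L2le (fun y : ℝ => (y : ℂ) • v y) U → L2le (fun y : ℝ => (y : ℂ) • g y) U →
      ∀ (A B D : ℝ → ℝ → R) (a b d : ℝ → R),
      (∀ z, ModelSolution κ z u v (A z) (B z) (a z) (b z)) →
      (∀ z x, HasDerivAt (D z) (ph (κ * z * x) • (g x * A z x)) x) →
      (∀ z, Tendsto (D z) atTop (𝓝 0)) → (∀ z, Tendsto (D z) atBot (𝓝 (d z))) →
      (∀ z x, ‖A z x‖ ≤ M) ∧ (∀ z x, ‖B z x‖ ≤ M) ∧ Continuous a ∧ Continuous b ∧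
      (∀ z, ‖a z‖ ≤ M) ∧ (∀ z, ‖b z‖ ≤ M) ∧ (∀ z, ‖d z‖ ≤ M) ∧
      TransLip a M ∧ TransLip b M ∧ TransLip d M := by
  have : CompleteSpace R := FiniteDimensional.complete ℂ R
  have : CompleteSpace E := FiniteDimensional.complete ℂ E
  obtain ⟨k, hk0, k21, k31, k12⟩ : ∃ k : ℝ, 0 ≤ k ∧ ‖blockMul i₂ p₁‖ ≤ k ∧
      ‖blockMul i₃ p₁‖ ≤ k ∧ ‖blockMul i₁ p₂‖ ≤ k :=
    ⟨max ‖blockMul i₂ p₁‖ (max ‖blockMul i₃ p₁‖ ‖blockMul i₁ p₂‖),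
      (norm_nonneg (blockMul i₂ p₁)).trans (le_max_left _ _), le_max_left _ _,
      (le_max_left _ _).trans (le_max_right _ _), (le_max_right _ _).trans (le_max_right _ _)⟩
  have bm : ∀ {i : R →L[ℂ] E} {p : E →L[ℂ] R}, ‖blockMul i p‖ ≤ k → ∀ x,
      ‖blockMul i p x‖ ≤ k * ‖x‖ := fun {i p} hh x => norm_blockMul_apply_le i p hh x
  set W : ℝ := Real.pi + 2 * U ^ 2 with hW
  have hW0 : 0 ≤ W := by positivity
  obtain ⟨U', hU'0, hU'1, hU'2, hU'3⟩ : ∃ U' : ℝ, 0 ≤ U' ∧ k * (W + W) ≤ U' ∧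
      k * (U + U) ≤ U' ∧ ‖blockMul i₁ p₁ 1‖ ≤ U' :=
    ⟨max (k * (W + W)) (max (k * (U + U)) ‖blockMul i₁ p₁ 1‖),
      (mul_nonneg hk0 (add_nonneg hW0 hW0)).trans (le_max_left _ _), le_max_left _ _,
      (le_max_left _ _).trans (le_max_right _ _), (le_max_right _ _).trans (le_max_right _ _)⟩
  obtain ⟨M, hM, hmain⟩ := exists_transLip_of_hasDerivAt (𝔸 := E →L[ℂ] E) hκ U' hU'0
  -- The system is a vector in `E`, whereas the theorem above is about solutions in an algebra. The
  -- vector is stored as the column of an operator over the first summand and recovered by applying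
  -- that operator to `i₁ 1`.
  let ev : (E →L[ℂ] R) → ((E →L[ℂ] E) →L[ℂ] R) := fun p =>
    p ∘L (ContinuousLinearMap.apply ℂ E (i₁ 1))
  have ev_apply : ∀ p T, ev p T = p (T (i₁ 1)) := fun p T => rfl
  clear_value ev
  obtain ⟨e, he0, e1, e2, e3⟩ : ∃ e : ℝ, 0 ≤ e ∧ ‖ev p₁‖ ≤ e ∧ ‖ev p₂‖ ≤ e ∧ ‖ev p₃‖ ≤ e :=
    ⟨max ‖ev p₁‖ (max ‖ev p₂‖ ‖ev p₃‖),
      (norm_nonneg (ev p₁)).trans (le_max_left _ _), le_max_left _ _,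
      (le_max_left _ _).trans (le_max_right _ _), (le_max_right _ _).trans (le_max_right _ _)⟩
  refine ⟨e * M, by positivity, ?_⟩
  intro u v g cu cv cg lu lv lg wu wv wg A B D a b d h dD Dtop Dbot
  obtain ⟨ui, uW⟩ := integrable_of_weighted hU lu wu
  obtain ⟨vi, vW⟩ := integrable_of_weighted hU lv wv
  obtain ⟨gi, gW⟩ := integrable_of_weighted hU lg wg
  have hkU : 0 ≤ k * U := by positivity
  -- The functions `v` and `g` both map the first component onward with the phase `e^{iκzx}`, and
  -- `u` leads back from the second component with the opposite phase; hence the adjoined component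
  -- fits the same form of coefficient.
  set Qm : ℝ → E →L[ℂ] E := fun y => blockMul i₂ p₁ (v y) + blockMul i₃ p₁ (g y) with hQm
  set Qp : ℝ → E →L[ℂ] E := fun y => blockMul i₁ p₂ (u y) with hQp
  have cQm : Continuous Qm := by fun_prop
  have cQp : Continuous Qp := by fun_prop
  have bQm : ∀ y, ‖Qm y‖ ≤ k * ‖v y‖ + k * ‖g y‖ := fun y =>
    (norm_add_le _ _).trans (add_le_add (bm k21 _) (bm k31 _))
  have bQp : ∀ y, ‖Qp y‖ ≤ k * ‖u y‖ := fun y => bm k12 _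
  have iQm' : Integrable fun y => k * ‖v y‖ + k * ‖g y‖ :=
    (vi.norm.const_mul k).add (gi.norm.const_mul k)
  have iQm : Integrable Qm := iQm'.mono' cQm.aestronglyMeasurable (ae_of_all _ bQm)
  have iQp : Integrable Qp := (ui.norm.const_mul k).mono' cQp.aestronglyMeasurable
    (ae_of_all _ bQp)
  have nQm : ∫ y, ‖Qm y‖ ≤ U' := by
    refine (integral_mono iQm.norm iQm' bQm).trans (le_trans ?_ hU'1)
    rw [integral_add (vi.norm.const_mul k) (gi.norm.const_mul k), integral_const_mul,
      integral_const_mul, mul_add]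
    gcongr
  have nQp : ∫ y, ‖Qp y‖ ≤ U' := by
    refine (integral_mono iQp.norm (ui.norm.const_mul k) bQp).trans (le_trans ?_ hU'1)
    rw [integral_const_mul]
    exact mul_le_mul_of_nonneg_left (uW.trans (le_add_of_nonneg_left hW0)) hk0
  have wQm : L2le (fun y => (y : ℂ) • Qm y) U' := by
    have h1 : L2le (fun y : ℝ => blockMul i₂ p₁ ((y : ℂ) • v y)) (k * U) :=
      L2le.of_norm_le (Continuous.aestronglyMeasurable (by fun_prop)) wv hk0
        (ae_of_all _ fun y => bm k21 _)
    have h2 : L2le (fun y : ℝ => blockMul i₃ p₁ ((y : ℂ) • g y)) (k * U) :=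
      L2le.of_norm_le (Continuous.aestronglyMeasurable (by fun_prop)) wg hk0
        (ae_of_all _ fun y => bm k31 _)
    refine ((h1.add h2 hkU hkU).mono ((mul_add k U U).symm.le.trans hU'2)).congr
      (ae_of_all _ fun y => ?_)
    simp only [hQm, map_smul, smul_add]
  have wQp : L2le (fun y => (y : ℂ) • Qp y) U' := by
    have h1 : L2le (fun y : ℝ => blockMul i₁ p₂ ((y : ℂ) • u y)) (k * U) :=
      L2le.of_norm_le (Continuous.aestronglyMeasurable (by fun_prop)) wu hk0
        (ae_of_all _ fun y => bm k12 _)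
    refine (h1.mono ((mul_le_mul_of_nonneg_left (le_add_of_nonneg_left hU) hk0).trans
      hU'2)).congr (ae_of_all _ fun y => ?_)
    simp only [hQp, map_smul]
  set N : ℝ → ℝ → E →L[ℂ] E := fun z x =>
    blockMul i₁ p₁ (A z x) + blockMul i₂ p₁ (B z x) + blockMul i₃ p₁ (D z x) with hN
  set n : ℝ → E →L[ℂ] E := fun z => blockMul i₁ p₁ (a z) + blockMul i₂ p₁ (b z)
    + blockMul i₃ p₁ (d z) with hn
  have lim : ∀ {l : Filter ℝ} {f : ℝ → R} {w : R} (i : R →L[ℂ] E) (p : E →L[ℂ] R),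
      Tendsto f l (𝓝 w) → Tendsto (fun x => blockMul i p (f x)) l (𝓝 (blockMul i p w)) :=
    fun i p hf => ((blockMul i p).continuous.tendsto _).comp hf
  obtain ⟨r1, r2, r3, r4⟩ := hmain Qm Qp N (blockMul i₁ p₁ 1) n cQm cQp iQm iQp nQm nQp wQm wQp
    hU'3 (fun z x => by
      refine (((hasDerivAt_blockMul i₁ p₁ ((h z).dA x)).add
        (hasDerivAt_blockMul i₂ p₁ ((h z).dB x))).add
        (hasDerivAt_blockMul i₃ p₁ (dD z x))).congr_deriv ?_
      ext w
      simp [coeff, hQm, hQp, hN, h11, h12, h13, h21, h22, h23, mul_assoc]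
      abel)
    (fun z => by
      have := ((lim i₁ p₁ (h z).A_top).add (lim i₂ p₁ (h z).B_top)).add (lim i₃ p₁ (Dtop z))
      simpa using this)
    (fun z => ((lim i₁ p₁ (h z).A_bot).add (lim i₂ p₁ (h z).B_bot)).add (lim i₃ p₁ (Dbot z)))
  have evA : ∀ z x, ev p₁ (N z x) = A z x := fun z x => by simp [ev_apply, hN, h11, h12, h13]
  have evB : ∀ z x, ev p₂ (N z x) = B z x := fun z x => by
    simp [ev_apply, hN, h11, h21, h22, h23]
  have eva : ∀ z, ev p₁ (n z) = a z := fun z => by simp [ev_apply, hn, h11, h12, h13]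
  have evb : ∀ z, ev p₂ (n z) = b z := fun z => by simp [ev_apply, hn, h11, h21, h22, h23]
  have evd : ∀ z, ev p₃ (n z) = d z := fun z => by simp [ev_apply, hn, h11, h31, h32, h33]
  have bev : ∀ {p : E →L[ℂ] R}, ‖ev p‖ ≤ e → ∀ w, ‖w‖ ≤ M → ‖ev p w‖ ≤ e * M := fun hp w hw =>
    ((ev _).le_opNorm w).trans (mul_le_mul hp hw (norm_nonneg _) he0)
  have lipev : ∀ {p : E →L[ℂ] R}, ‖ev p‖ ≤ e → TransLip (fun z => ev p (n z)) (e * M) := fun hp =>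
    (r3.clm _).mono (mul_le_mul_of_nonneg_right hp hM)
  refine ⟨fun z x => evA z x ▸ bev e1 _ (r1 z x), fun z x => evB z x ▸ bev e2 _ (r1 z x),
    ((ev p₁).continuous.comp r4).congr eva, ((ev p₂).continuous.comp r4).congr evb,
    fun z => eva z ▸ bev e1 _ (r2 z), fun z => evb z ▸ bev e2 _ (r2 z),
    fun z => evd z ▸ bev e3 _ (r2 z), ?_, ?_, ?_⟩
  · simpa only [eva] using lipev e1
  · simpa only [evb] using lipev e2
  · simpa only [evd] using lipev e3

/-- The oscillatory integrals of `v`, `g₁`, `g₂`, `g₃` against `A` converge to `-b` times successive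
powers of `-iκz`. The first and last of these give the `L²` bounds of `b` and `z³ b`. The integral
of `g₁` is adjoined to the system as a third component, which makes `z b` a scattering coefficient
of the same kind as `a` and `b`. -/
theorem exists_coefficientBounds [FiniteDimensional ℂ R] {κ : ℝ} (hκ : κ ≠ 0) (U : ℝ)
    (hU : 0 ≤ U) :
    ∃ C : ℝ, 0 ≤ C ∧ ∀ u u₁ u₂ u₃ v v₁ v₂ v₃ : ℝ → R, Potential U u u₁ u₂ u₃ →
      Potential U v v₁ v₂ v₃ → ∀ (A B : ℝ → ℝ → R) (a b : ℝ → R),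
      (∀ z, ModelSolution κ z u v (A z) (B z) (a z) (b z)) → CoefficientBounds C a b := by
  have : CompleteSpace R := FiniteDimensional.complete ℂ R
  obtain ⟨K, hK, hrec⟩ := exists_recursion_bounds (R := R) U hU
  obtain ⟨C₀, hC₀, hP⟩ := exists_eLpNorm_integral_ph_smul_le R hκ
  set W : ℝ := Real.pi + 2 * U ^ 2 with hW
  have hW0 : 0 ≤ W := by positivity
  -- Three copies of `R` carry `A`, `B` and the oscillatory primitive of `g₁`; `U + K` bounds both
  -- the potentials and `g₁`.
  obtain ⟨M₁, hM₁0, hext⟩ := exists_extended_bounds (R := R) (E := R × R × R)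
    (i₁ := ContinuousLinearMap.inl ℂ R (R × R))
    (i₂ := (ContinuousLinearMap.inr ℂ R (R × R)) ∘L (ContinuousLinearMap.inl ℂ R R))
    (i₃ := (ContinuousLinearMap.inr ℂ R (R × R)) ∘L (ContinuousLinearMap.inr ℂ R R))
    (p₁ := ContinuousLinearMap.fst ℂ R (R × R))
    (p₂ := (ContinuousLinearMap.fst ℂ R R) ∘L (ContinuousLinearMap.snd ℂ R (R × R)))
    (p₃ := (ContinuousLinearMap.snd ℂ R R) ∘L (ContinuousLinearMap.snd ℂ R (R × R)))
    (fun _ => rfl) (fun _ => rfl) (fun _ => rfl) (fun _ => rfl) (fun _ => rfl) (fun _ => rfl)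
    (fun _ => rfl) (fun _ => rfl) (fun _ => rfl) hκ (U + K) (by positivity)
  have hκ' : ‖(Complex.I * (κ : ℂ))⁻¹‖ = |κ|⁻¹ := by simp
  have hb1 : 0 ≤ |κ|⁻¹ * M₁ := by positivity
  have hb2 : 0 ≤ |κ|⁻¹ * (W * M₁ + (U ^ 2 + U ^ 2) * M₁) := by positivity
  have hb3 : 0 ≤ (M₁ + M₁ * W) * (C₀ * U) := by positivity
  have hb4 : 0 ≤ |κ|⁻¹ ^ 3 * ((M₁ + M₁ * W) * (C₀ * K)) := by positivity
  refine ⟨M₁ + |κ|⁻¹ * M₁ + |κ|⁻¹ * (W * M₁ + (U ^ 2 + U ^ 2) * M₁)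
    + (M₁ + M₁ * W) * (C₀ * U) + |κ|⁻¹ ^ 3 * ((M₁ + M₁ * W) * (C₀ * K)), by positivity, ?_⟩
  intro u u₁ u₂ u₃ v v₁ v₂ v₃ hu hv A B a b h
  obtain ⟨g₁, g₁', g₂, g₂', V, G₁, G₂, sg₁, wg₁, sg₂, lg₃, ⟨hV, hV0⟩, ⟨hG₁, hG₁0⟩, ⟨hG₂, hG₂0⟩,
    eg₁, eg₂⟩ := hrec u u₁ u₂ u₃ v v₁ v₂ v₃ hu hv
  have cu := hu.c0.cont
  have cv := hv.c0.cont
  have cg₁ := sg₁.cont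
  have cA := fun z => (h z).contA
  have cB := fun z => (h z).contB
  obtain ⟨ui, uW⟩ := integrable_of_weighted hU hu.l0 hu.w0
  obtain ⟨vi, vW⟩ := integrable_of_weighted hU hv.l0 hv.w0
  obtain ⟨u₁i, u₁W⟩ := integrable_of_weighted hU hu.l1 hu.w1
  obtain ⟨gi, gW⟩ := integrable_of_weighted hK sg₁.l2 wg₁
  -- the limits of the oscillatory integrals
  have t0 : ∀ z, Tendsto (fun n : ℕ => osc κ z n (A z) v) atTop (𝓝 (-b z)) := fun z =>
    tendsto_osc (h z) cv
  have t1 : ∀ z : ℝ, Tendsto (fun n : ℕ => osc κ z n (A z) g₁) atTop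
      (𝓝 ((Complex.I * ((κ * z : ℝ) : ℂ)) • b z)) := fun z => by
    have := tendsto_osc_next (t0 z) (g₁ := g₁) (by
      simpa only [eg₁] using tendsto_osc_recursion (h z) cu cv hv.c0.toSobolevOne hV.deriv hV0
        hV.bdd)
    simpa using this
  have t2 : ∀ z : ℝ, Tendsto (fun n : ℕ => osc κ z n (A z) g₂) atTop
      (𝓝 (-((Complex.I * ((κ * z : ℝ) : ℂ)) • (Complex.I * ((κ * z : ℝ) : ℂ)) • b z))) := fun z =>
    tendsto_osc_next (t1 z) (by
      simpa only [eg₂] using tendsto_osc_recursion (h z) cu cv sg₁ hG₁.deriv hG₁0 hG₁.bdd)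
  have t3 : ∀ z : ℝ, Tendsto (fun n : ℕ => osc κ z n (A z) fun x => g₂' x - G₂ x * v x) atTop
      (𝓝 ((Complex.I * ((κ * z : ℝ) : ℂ)) • (Complex.I * ((κ * z : ℝ) : ℂ)) •
        (Complex.I * ((κ * z : ℝ) : ℂ)) • b z)) := fun z => by
    simpa only [smul_neg, neg_neg] using tendsto_osc_next (t2 z)
      (tendsto_osc_recursion (h z) cu cv sg₂ hG₂.deriv hG₂0 hG₂.bdd)
  -- the extended system
  have ci : ∀ z, Integrable fun y => ph (κ * z * y) • (g₁ y * A z y) := fun z => by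
    obtain ⟨m, hm⟩ := exists_norm_le_of_tendsto (cA z) (h z).A_top (h z).A_bot
    have := cA z
    refine (gi.norm.mul_const m).mono' (Continuous.aestronglyMeasurable (by fun_prop))
      (ae_of_all _ fun y => ?_)
    rw [norm_ph_smul]
    exact (norm_mul_le _ _).trans (mul_le_mul_of_nonneg_left (hm y) (norm_nonneg _))
  set D : ℝ → ℝ → R := fun z x => -tail (fun y => ph (κ * z * y) • (g₁ y * A z y)) x with hD
  have dD : ∀ z x, HasDerivAt (D z) (ph (κ * z * x) • (g₁ x * A z x)) x := fun z =>
    hasDerivAt_osc_primitive (cA z) cg₁ (ci z)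
  have Dtop : ∀ z, Tendsto (D z) atTop (𝓝 0) := fun z => by
    simpa using (tendsto_tail_atTop (ci z)).neg
  have Dbot : ∀ z : ℝ,
      Tendsto (D z) atBot (𝓝 (-((Complex.I * ((κ * z : ℝ) : ℂ)) • b z))) := fun z => by
    have h1 := intervalIntegral_tendsto_integral (ci z)
      (tendsto_neg_atTop_atBot.comp tendsto_natCast_atTop_atTop) tendsto_natCast_atTop_atTop
    have h2 := tendsto_nhds_unique h1 ((t1 z).congr fun n => by
      simp only [osc, smul_mul_assoc]; rfl)
    rw [← h2]
    exact (tendsto_tail_atBot (ci z)).neg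
  obtain ⟨hAM, hBM, ca, cb, ba, bb, bd, la, lb, ld⟩ := hext u v g₁ cu cv cg₁
    (hu.l0.mono (by linarith)) (hv.l0.mono (by linarith)) (sg₁.l2.mono (by linarith))
    (hu.w0.mono (by linarith)) (hv.w0.mono (by linarith)) (wg₁.mono (by linarith)) A B D a b _ h dD
    Dtop Dbot
  -- The recursion yields multiples of `iκz`; the factor `iκ` is divided out here, whence the powers
  -- of `|κ|⁻¹` in the constant.
  have hz : ∀ (z : ℝ) (w : R),
      (z : ℂ) • w = (Complex.I * (κ : ℂ))⁻¹ • (Complex.I * ((κ * z : ℝ) : ℂ)) • w := fun z w => by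
    rw [smul_smul]
    congr 1
    have : (κ : ℂ) ≠ 0 := by exact_mod_cast hκ
    push_cast
    field_simp
  have zb : ∀ z : ℝ, (z : ℂ) • b z = (-(Complex.I * (κ : ℂ))⁻¹) •
      (-((Complex.I * ((κ * z : ℝ) : ℂ)) • b z)) := fun z => by rw [hz, neg_smul_neg]
  constructor
  · exact ca
  · exact cb
  · exact fun z => (ba z).trans (by linarith)
  · exact fun z => (bb z).trans (by linarith)
  · intro z
    rw [zb, norm_smul, norm_neg, hκ']
    have := mul_le_mul_of_nonneg_left (bd z) (inv_nonneg.2 (abs_nonneg κ))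
    linarith
  · intro z
    rw [hz, norm_smul, hκ']
    have := mul_le_mul_of_nonneg_left ((h z).norm_mul_sub_one_le hu.c0 cv ui u₁i hv.l0 hU u₁W
      (hAM z) (hBM z)) (inv_nonneg.2 (abs_nonneg κ))
    linarith
  · exact la.mono (by linarith)
  · exact lb.mono (by linarith)
  · simp only [zb]
    refine (ld.const_smul _).mono ?_
    rw [norm_neg, hκ']; linarith
  · have := eLpNorm_le_of_tendsto_osc hC₀ hP h cu ui uW hM₁0 hAM hBM hv.l0 t0
    rw [show (fun z => -b z) = -b from rfl, eLpNorm_neg] at this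
    exact this.trans (ENNReal.ofReal_le_ofReal (by linarith))
  · have := eLpNorm_le_of_tendsto_osc hC₀ hP h cu ui uW hM₁0 hAM hBM lg₃ t3
    refine (eLpNorm_le_mul_eLpNorm_of_ae_le_mul (c := |κ|⁻¹ ^ 3) (ae_of_all _ fun z => ?_) 2).trans
      ((mul_le_mul_right this (ENNReal.ofReal (|κ|⁻¹ ^ 3))).trans ?_)
    · rw [norm_smul, norm_smul, norm_smul, norm_smul, norm_pow]
      simp only [norm_mul, Complex.norm_I, Complex.norm_real, Real.norm_eq_abs, one_mul]
      have : |κ| ≠ 0 := abs_ne_zero.2 hκ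
      apply le_of_eq
      field_simp
    · rw [← ENNReal.ofReal_mul (by positivity)]
      exact ENNReal.ofReal_le_ofReal (by linarith)

end Bounds

end AKNS

namespace AKNS
open Filter Topology FourierTransform
open scoped ENNReal

/-! ## Divided differences as elements of an operator algebra -/

/-- The algebra of operators on `ℂ × ℂ`. -/
abbrev PairAlgebra : Type := (ℂ × ℂ) →L[ℂ] (ℂ × ℂ)

/-- The projection to the first factor. -/
noncomputable def projFst : PairAlgebra :=
  (ContinuousLinearMap.inl ℂ ℂ ℂ) ∘L (ContinuousLinearMap.fst ℂ ℂ ℂ)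

/-- The projection to the second factor. -/
noncomputable def projSnd : PairAlgebra :=
  (ContinuousLinearMap.inr ℂ ℂ ℂ) ∘L (ContinuousLinearMap.snd ℂ ℂ ℂ)

/-- The nilpotent operator `(x, y) ↦ (0, x)`. -/
noncomputable def shift : PairAlgebra :=
  (ContinuousLinearMap.inr ℂ ℂ ℂ) ∘L (ContinuousLinearMap.fst ℂ ℂ ℂ)

lemma projFst_apply (w : ℂ × ℂ) : projFst w = (w.1, 0) := rfl
lemma projSnd_apply (w : ℂ × ℂ) : projSnd w = (0, w.2) := rfl
lemma shift_apply (w : ℂ × ℂ) : shift w = (0, w.1) := rfl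

/-- The operator with matrix `(s, 0; (t - s) / ε, t)`. It depends multiplicatively on `(s, t)`. -/
noncomputable def pair (ε : ℝ) : (ℂ × ℂ) →L[ℂ] PairAlgebra :=
  (ContinuousLinearMap.fst ℂ ℂ ℂ).smulRight projFst
    + (ContinuousLinearMap.snd ℂ ℂ ℂ).smulRight projSnd
    + (((ε : ℂ)⁻¹) •
      (ContinuousLinearMap.snd ℂ ℂ ℂ - ContinuousLinearMap.fst ℂ ℂ ℂ)).smulRight shift

lemma pair_apply (ε : ℝ) (w : ℂ × ℂ) :
    pair ε w = w.1 • projFst + w.2 • projSnd + ((ε : ℂ)⁻¹ * (w.2 - w.1)) • shift := rfl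

lemma pair_apply_apply (ε : ℝ) (w x : ℂ × ℂ) :
    pair ε w x = (w.1 * x.1, w.2 * x.2 + (ε : ℂ)⁻¹ * (w.2 - w.1) * x.1) := by
  simp [pair_apply, projFst_apply, projSnd_apply, shift_apply]

/-- The matrix is the conjugate of `diag(s, t)` by the unipotent matrix with lower left entry
`-1/ε`. The conjugating matrix degenerates as `ε → 0`, but the result stays bounded as long as `|t -
s| = O(ε)`. -/
lemma pair_mul (ε : ℝ) (w x : ℂ × ℂ) : pair ε w * pair ε x = pair ε (w * x) := by
  refine ContinuousLinearMap.ext fun y => ?_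
  rw [mul_apply_eq_comp, pair_apply_apply, pair_apply_apply, pair_apply_apply]
  ext
  · simp [mul_assoc]
  · simp only [Prod.fst_mul, Prod.snd_mul]
    ring

lemma pair_one (ε : ℝ) : pair ε 1 = 1 := by
  refine ContinuousLinearMap.ext fun y => ?_
  rw [pair_apply_apply]
  simp

/-- A bound for the norm of `pair ε w` in terms of the entries of `w`. -/
noncomputable def pairConst : ℝ := ‖projFst‖ + ‖projSnd‖ + ‖shift‖

lemma pairConst_nonneg : 0 ≤ pairConst :=
  add_nonneg (add_nonneg (norm_nonneg _) (norm_nonneg _)) (norm_nonneg _)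

lemma norm_projFst_le : ‖projFst‖ ≤ pairConst := by
  unfold pairConst; linarith [norm_nonneg projSnd, norm_nonneg shift]
lemma norm_projSnd_le : ‖projSnd‖ ≤ pairConst := by
  unfold pairConst; linarith [norm_nonneg projFst, norm_nonneg shift]
lemma norm_shift_le : ‖shift‖ ≤ pairConst := by
  unfold pairConst; linarith [norm_nonneg projSnd, norm_nonneg projFst]

lemma norm_pair_le {ε : ℝ} (hε : 0 < ε) (w : ℂ × ℂ) :
    ‖pair ε w‖ ≤ pairConst * (‖w.1‖ + ‖w.2‖ + ε⁻¹ * ‖w.2 - w.1‖) := by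
  rw [pair_apply]
  refine (norm_add₃_le).trans ?_
  rw [norm_smul, norm_smul, norm_smul, norm_mul, norm_inv, Complex.norm_real, Real.norm_eq_abs,
    abs_of_pos hε]
  have h1 := mul_le_mul_of_nonneg_left norm_projFst_le (norm_nonneg w.1)
  have h2 := mul_le_mul_of_nonneg_left norm_projSnd_le (norm_nonneg w.2)
  have h3 := mul_le_mul_of_nonneg_left norm_shift_le
    (mul_nonneg (inv_nonneg.2 hε.le) (norm_nonneg (w.2 - w.1)))
  linarith

/-- The functional reading off the divided difference. -/
noncomputable def divDiff : PairAlgebra →L[ℂ] ℂ :=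
  (ContinuousLinearMap.snd ℂ ℂ ℂ) ∘L (ContinuousLinearMap.apply ℂ (ℂ × ℂ) ((1, 0) : ℂ × ℂ))

/-- The functional reading off the first entry. -/
noncomputable def readFst : PairAlgebra →L[ℂ] ℂ :=
  (ContinuousLinearMap.fst ℂ ℂ ℂ) ∘L (ContinuousLinearMap.apply ℂ (ℂ × ℂ) ((1, 0) : ℂ × ℂ))

/-- The functional reading off the second entry. -/
noncomputable def readSnd : PairAlgebra →L[ℂ] ℂ :=
  (ContinuousLinearMap.snd ℂ ℂ ℂ) ∘L (ContinuousLinearMap.apply ℂ (ℂ × ℂ) ((0, 1) : ℂ × ℂ))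

lemma divDiff_pair (ε : ℝ) (w : ℂ × ℂ) : divDiff (pair ε w) = (ε : ℂ)⁻¹ * (w.2 - w.1) := by
  change (pair ε w (1, 0)).2 = _
  rw [pair_apply_apply]; simp

lemma readFst_pair (ε : ℝ) (w : ℂ × ℂ) : readFst (pair ε w) = w.1 := by
  change (pair ε w (1, 0)).1 = _
  rw [pair_apply_apply]; simp

lemma readSnd_pair (ε : ℝ) (w : ℂ × ℂ) : readSnd (pair ε w) = w.2 := by
  change (pair ε w (0, 1)).2 = _
  rw [pair_apply_apply]; simp

lemma hasDerivAt_pair (ε : ℝ) {f g : ℝ → ℂ} {f' g' : ℂ} {x : ℝ} (hf : HasDerivAt f f' x)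
    (hg : HasDerivAt g g' x) :
    HasDerivAt (fun x => pair ε (f x, g x)) (pair ε (f', g')) x :=
  ((pair ε).restrictScalars ℝ).hasFDerivAt.comp_hasDerivAt x (hf.prodMk hg)

lemma tendsto_pair (ε : ℝ) {l : Filter ℝ} {f g : ℝ → ℂ} {s t : ℂ} (hf : Tendsto f l (𝓝 s))
    (hg : Tendsto g l (𝓝 t)) : Tendsto (fun x => pair ε (f x, g x)) l (𝓝 (pair ε (s, t))) :=
  ((pair ε).continuous.tendsto _).comp (hf.prodMk_nhds hg)

/-- The bound `ε` on the difference exactly compensates the factor `ε⁻¹`, so the constant does not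
depend on `ε`. -/
lemma L2le.pair {ε U : ℝ} (hε : 0 < ε) (hU : 0 ≤ U) {f g : ℝ → ℂ} (hf : L2le f U) (hg : L2le g U)
    (hd : L2le (fun x => g x - f x) ε) :
    L2le (fun x => AKNS.pair ε (f x, g x)) (pairConst * (U + U + 1)) := by
  have h1 := L2le.of_norm_le (f := fun x => f x • projFst) (hf.1.smul_const _) hf pairConst_nonneg
    (ae_of_all _ fun x => by
      rw [norm_smul, mul_comm]
      exact mul_le_mul_of_nonneg_right norm_projFst_le (norm_nonneg _))
  have h2 := L2le.of_norm_le (f := fun x => g x • projSnd) (hg.1.smul_const _) hg pairConst_nonneg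
    (ae_of_all _ fun x => by
      rw [norm_smul, mul_comm]
      exact mul_le_mul_of_nonneg_right norm_projSnd_le (norm_nonneg _))
  have h3 := L2le.of_norm_le (f := fun x => ((ε : ℂ)⁻¹ * (g x - f x)) • shift)
    ((hd.1.const_mul _).smul_const _) hd (K := pairConst * ε⁻¹)
    (mul_nonneg pairConst_nonneg (inv_nonneg.2 hε.le))
    (ae_of_all _ fun x => by
      rw [norm_smul, norm_mul, norm_inv, Complex.norm_real, Real.norm_eq_abs, abs_of_pos hε]
      have := mul_le_mul_of_nonneg_left norm_shift_le
        (mul_nonneg (inv_nonneg.2 hε.le) (norm_nonneg (g x - f x)))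
      linarith)
  have hp := mul_nonneg pairConst_nonneg hU
  have he : pairConst * ε⁻¹ * ε = pairConst := by field_simp
  refine (((h1.add h2 hp hp).add h3 (by positivity) (by rw [he]; exact pairConst_nonneg)).mono
    (by rw [he]; linarith)).congr (ae_of_all _ fun x => ?_)
  simp [pair_apply]

lemma SobolevOne.pair {ε U : ℝ} (hε : 0 < ε) (hU : 0 ≤ U) {f f' g g' : ℝ → ℂ}
    (hf : SobolevOne f f' U) (hg : SobolevOne g g' U)
    (hd : SobolevOne (fun x => g x - f x) (fun x => g' x - f' x) ε) :
    SobolevOne (fun x => AKNS.pair ε (f x, g x)) (fun x => AKNS.pair ε (f' x, g' x))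
      (pairConst * (U + U + 1)) := by
  refine ⟨fun x => ?_, hf.l2.pair hε hU hg.l2 hd.l2, hf.l2'.pair hε hU hg.l2' hd.l2'⟩
  have if' := hf.l2'.intervalIntegrable 0 x
  have ig' := hg.l2'.intervalIntegrable 0 x
  have sc : ∀ {k : ℝ → ℂ}, IntervalIntegrable k volume 0 x → ∀ P : PairAlgebra,
      IntervalIntegrable (fun t => k t • P) volume 0 x := fun hk P =>
    ⟨hk.1.smul_const P, hk.2.smul_const P⟩
  simp only [pair_apply]
  rw [intervalIntegral.integral_add, intervalIntegral.integral_add,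
    intervalIntegral.integral_smul_const, intervalIntegral.integral_smul_const,
    intervalIntegral.integral_smul_const, intervalIntegral.integral_const_mul,
    intervalIntegral.integral_sub ig' if', hf.prim x, hg.prim x]
  · module
  · exact sc if' _
  · exact sc ig' _
  · exact (sc if' _).add (sc ig' _)
  · exact sc ((ig'.sub if').const_mul _) _

lemma Potential.pair {ε U : ℝ} (hε : 0 < ε) (hU : 0 ≤ U) {f f₁ f₂ f₃ g g₁ g₂ g₃ : ℝ → ℂ}
    (hf : Potential U f f₁ f₂ f₃) (hg : Potential U g g₁ g₂ g₃)
    (hd : Potential ε (fun x => g x - f x) (fun x => g₁ x - f₁ x) (fun x => g₂ x - f₂ x)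
      (fun x => g₃ x - f₃ x)) :
    Potential (pairConst * (U + U + 1)) (fun x => AKNS.pair ε (f x, g x))
      (fun x => AKNS.pair ε (f₁ x, g₁ x)) (fun x => AKNS.pair ε (f₂ x, g₂ x))
      (fun x => AKNS.pair ε (f₃ x, g₃ x)) where
  d0 x := hasDerivAt_pair ε (hf.d0 x) (hg.d0 x)
  d1 x := hasDerivAt_pair ε (hf.d1 x) (hg.d1 x)
  s2 := hf.s2.pair hε hU hg.s2 hd.s2
  l0 := hf.l0.pair hε hU hg.l0 hd.l0
  l1 := hf.l1.pair hε hU hg.l1 hd.l1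
  w0 := by
    refine (hf.w0.pair hε hU hg.w0 (by simpa only [smul_sub] using hd.w0)).congr
      (ae_of_all _ fun x => ?_)
    simp only [← map_smul, Prod.smul_mk]
  w1 := by
    refine (hf.w1.pair hε hU hg.w1 (by simpa only [smul_sub] using hd.w1)).congr
      (ae_of_all _ fun x => ?_)
    simp only [← map_smul, Prod.smul_mk]

/-- Since `pair ε` is a continuous unital algebra homomorphism, it carries two scalar solutions to
one solution of the model over `PairAlgebra`, and the bounds for the model become bounds for divided
differences. -/
lemma ModelSolution.pair {κ z : ℝ} (ε : ℝ) {u v A B u' v' A' B' : ℝ → ℂ} {a b a' b' : ℂ}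
    (h : ModelSolution κ z u v A B a b) (h' : ModelSolution κ z u' v' A' B' a' b') :
    ModelSolution κ z (fun x => AKNS.pair ε (u x, u' x)) (fun x => AKNS.pair ε (v x, v' x))
      (fun x => AKNS.pair ε (A x, A' x)) (fun x => AKNS.pair ε (B x, B' x))
      (AKNS.pair ε (a, a')) (AKNS.pair ε (b, b')) where
  dA x := by
    rw [pair_mul, ← map_smul]
    exact hasDerivAt_pair ε (h.dA x) (h'.dA x)
  dB x := by
    rw [pair_mul, ← map_smul]
    exact hasDerivAt_pair ε (h.dB x) (h'.dB x)
  A_top := by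
    rw [← pair_one ε]
    exact tendsto_pair ε h.A_top h'.A_top
  B_top := by
    rw [← map_zero (AKNS.pair ε)]
    exact tendsto_pair ε h.B_top h'.B_top
  A_bot := tendsto_pair ε h.A_bot h'.A_bot
  B_bot := tendsto_pair ε h.B_bot h'.B_bot

/-! ## Quotients of scattering coefficients -/

/-- The resolvent identity `i(z+h) - i(z) = -i(z+h) (a(z+h) - a(z)) i(z)` reduces the inverse to
`a`; it uses the inverse on both sides, since the ring need not be commutative. -/
lemma TransLip.inv_mul {R : Type*} [NormedRing R] {a i b : ℝ → R} {C D : ℝ} (hC : 0 ≤ C)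
    (hD : 0 ≤ D) (ai : ∀ z, a z * i z = 1) (ia : ∀ z, i z * a z = 1) (hi : ∀ z, ‖i z‖ ≤ D)
    (hb : ∀ z, ‖b z‖ ≤ C) (la : TransLip a C) (lb : TransLip b C)
    (ma : AEStronglyMeasurable a volume) (mb : AEStronglyMeasurable b volume) :
    TransLip (fun z => i z * b z) (D * C + D * D * C * C) := fun h => by
  have sh : ∀ {f : ℝ → R}, AEStronglyMeasurable f volume →
      AEStronglyMeasurable (fun z => f (z + h) - f z) volume := fun hf =>
    (hf.comp_measurePreserving (measurePreserving_add_right volume h)).sub hf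
  have e : ∀ z, i (z + h) * b (z + h) - i z * b z
      = i (z + h) * (b (z + h) - b z) - i (z + h) * (a (z + h) - a z) * (i z * b z) := fun z => by
    have h1 : i (z + h) * (a (z + h) - a z) * (i z * b z)
        = (i (z + h) * a (z + h)) * (i z * b z) - i (z + h) * (a z * i z) * b z := by noncomm_ring
    rw [h1, ia, ai]
    noncomm_ring
  have h1 : ∀ z, ‖i (z + h) * b (z + h) - i z * b z‖ ≤
      ‖D * ‖b (z + h) - b z‖ + D * D * C * ‖a (z + h) - a z‖‖ := fun z => by
    rw [e, Real.norm_of_nonneg (by positivity)]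
    refine (norm_sub_le _ _).trans (add_le_add ?_ ?_)
    · exact (norm_mul_le _ _).trans (mul_le_mul_of_nonneg_right (hi _) (norm_nonneg _))
    · calc ‖i (z + h) * (a (z + h) - a z) * (i z * b z)‖
          ≤ (‖i (z + h)‖ * ‖a (z + h) - a z‖) * (‖i z‖ * ‖b z‖) :=
            (norm_mul_le _ _).trans (by gcongr <;> exact norm_mul_le _ _)
        _ ≤ (D * ‖a (z + h) - a z‖) * (D * C) := by gcongr <;> first | exact hi _ | exact hb _
        _ = _ := by ring
  refine (eLpNorm_mono h1).trans ?_
  refine (eLpNorm_add_le ((sh mb).norm.const_mul D) ((sh ma).norm.const_mul _)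
    (by norm_num)).trans ?_
  have h2 : ∀ (c : ℝ) (f : ℝ → R), 0 ≤ c → TransLip f C →
      eLpNorm (fun z => c * ‖f (z + h) - f z‖) 2 volume ≤ ENNReal.ofReal (c * (C * |h|)) := by
    intro c f hc hf
    rw [ENNReal.ofReal_mul hc]
    refine (eLpNorm_le_mul_eLpNorm_of_ae_le_mul (g := fun z => f (z + h) - f z) (c := c)
      (ae_of_all _ fun z => ?_) 2).trans (by gcongr; exact hf h)
    rw [norm_mul, norm_norm, Real.norm_of_nonneg hc]
  refine (add_le_add (h2 _ b hD lb) (h2 _ a (by positivity) la)).trans ?_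
  rw [← ENNReal.ofReal_add (by positivity) (by positivity)]
  exact ENNReal.ofReal_le_ofReal (by linarith)

/-- Bounds which control the norm of `f` in `H^{1,1} ∩ L^{2,3}`. -/
structure ReflectionBounds (K : ℝ) (f : ℝ → ℂ) : Prop where
  cont : Continuous f
  l2 : eLpNorm f 2 volume ≤ ENNReal.ofReal K
  z3_l2 : eLpNorm (fun z : ℝ => (z : ℂ) ^ 3 • f z) 2 volume ≤ ENNReal.ofReal K
  lip : TransLip f K
  z_lip : TransLip (fun z => (z : ℂ) • f z) K

lemma clm_mul_smul {R : Type*} [NormedRing R] [NormedAlgebra ℂ R] (L : R →L[ℂ] ℂ) (i f : R)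
    (c : ℂ) : L (i * (c • f)) = c • L (i * f) := by
  rw [mul_smul_comm, map_smul]

lemma eLpNorm_clm_mul_le {R : Type*} [NormedRing R] [NormedAlgebra ℂ R] (L : R →L[ℂ] ℂ)
    {i f : ℝ → R} {D C : ℝ} (hD : 0 ≤ D) (hi : ∀ z, ‖i z‖ ≤ D)
    (hf : eLpNorm f 2 volume ≤ ENNReal.ofReal C) :
    eLpNorm (fun z => L (i z * f z)) 2 volume ≤ ENNReal.ofReal (‖L‖ * D * C) := by
  rw [ENNReal.ofReal_mul (by positivity)]
  refine (eLpNorm_le_mul_eLpNorm_of_ae_le_mul (g := f) (c := ‖L‖ * D)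
    (ae_of_all _ fun z => ?_) 2).trans (by gcongr)
  calc ‖L (i z * f z)‖ ≤ ‖L‖ * (‖i z‖ * ‖f z‖) :=
        (L.le_opNorm _).trans (by gcongr; exact norm_mul_le _ _)
    _ ≤ ‖L‖ * (D * ‖f z‖) := by gcongr; exact hi z
    _ = _ := by ring

/-- The bounds for the model over `PairAlgebra` are read off in the lower left entry, and
multiplying back by `ε` gives differences. The constants are chosen before `ε`, which makes the
result a Lipschitz estimate; a lower bound on `a`, `a'` is needed only for the quotients. -/
theorem exists_reflectionBounds {κ : ℝ} (hκ : κ ≠ 0) (U : ℝ) (hU : 0 ≤ U) :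
    ∃ (C : ℝ) (K : ℝ → ℝ), 0 ≤ C ∧ (∀ δ > 0, 0 ≤ K δ) ∧ ∀ ε > 0,
      ∀ u u₁ u₂ u₃ v v₁ v₂ v₃ u' u₁' u₂' u₃' v' v₁' v₂' v₃' : ℝ → ℂ,
      Potential U u u₁ u₂ u₃ → Potential U v v₁ v₂ v₃ →
      Potential U u' u₁' u₂' u₃' → Potential U v' v₁' v₂' v₃' →
      Potential ε (fun x => u' x - u x) (fun x => u₁' x - u₁ x) (fun x => u₂' x - u₂ x)
        (fun x => u₃' x - u₃ x) →
      Potential ε (fun x => v' x - v x) (fun x => v₁' x - v₁ x) (fun x => v₂' x - v₂ x)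
        (fun x => v₃' x - v₃ x) →
      ∀ (A B A' B' : ℝ → ℝ → ℂ) (a b a' b' : ℝ → ℂ),
      (∀ z, ModelSolution κ z u v (A z) (B z) (a z) (b z)) →
      (∀ z, ModelSolution κ z u' v' (A' z) (B' z) (a' z) (b' z)) →
      Continuous a ∧ (∀ z : ℝ, ‖(z : ℂ) * (a z - 1)‖ ≤ C) ∧ (∀ z, ‖a' z - a z‖ ≤ C * ε) ∧
      ∀ δ > 0, (∀ z, δ ≤ ‖a z‖) → (∀ z, δ ≤ ‖a' z‖) →
        ReflectionBounds (K δ * ε) (fun z => b' z / a' z - b z / a z) := by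
  obtain ⟨C, hC, hmain⟩ := exists_coefficientBounds (R := PairAlgebra) hκ
    (pairConst * (U + U + 1)) (mul_nonneg pairConst_nonneg (by positivity))
  -- This bounds the inverse of the paired coefficient: its diagonal entries are at most `δ⁻¹`, and
  -- the divided difference of `1/a` is minus that of `a` divided by `a a'`.
  set D : ℝ → ℝ := fun δ => pairConst * (δ⁻¹ + δ⁻¹ + ‖divDiff‖ * C * (δ⁻¹ * δ⁻¹)) with hD
  have hD0 : ∀ δ > 0, 0 ≤ D δ := fun δ hδ => by
    have := pairConst_nonneg
    positivity
  refine ⟨‖readFst‖ * C + ‖divDiff‖ * C,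
    fun δ => ‖divDiff‖ * (D δ * C + D δ * D δ * C * C), by positivity, fun δ hδ => ?_, ?_⟩
  · have := hD0 δ hδ
    positivity
  intro ε hε u u₁ u₂ u₃ v v₁ v₂ v₃ u' u₁' u₂' u₃' v' v₁' v₂' v₃' hu hv hu' hv' hdu hdv
    A B A' B' a b a' b' h h'
  have hc := hmain _ _ _ _ _ _ _ _ (hu.pair hε hU hu' hdu) (hv.pair hε hU hv' hdv) _ _ _ _
    fun z => (h z).pair ε (h' z)
  have ca : Continuous a := (readFst.continuous.comp hc.a_cont).congr fun z => readFst_pair ε _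
  have cb : Continuous b := (readFst.continuous.comp hc.b_cont).congr fun z => readFst_pair ε _
  have ca' : Continuous a' := (readSnd.continuous.comp hc.a_cont).congr fun z => readSnd_pair ε _
  have cb' : Continuous b' := (readSnd.continuous.comp hc.b_cont).congr fun z => readSnd_pair ε _
  have hε' : (ε : ℂ) ≠ 0 := by exact_mod_cast hε.ne'
  have hdd : ∀ w : ℂ × ℂ, w.2 - w.1 = (ε : ℂ) * divDiff (pair ε w) := fun w => by
    rw [divDiff_pair, mul_inv_cancel_left₀ hε']
  have hda : ∀ z, ‖a' z - a z‖ ≤ ‖divDiff‖ * C * ε := fun z => by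
    rw [hdd (a z, a' z), norm_mul, Complex.norm_real, Real.norm_of_nonneg hε.le, mul_comm]
    gcongr
    exact divDiff.le_opNorm_of_le (hc.a_le z)
  refine ⟨ca, fun z => ?_, fun z => ?_, fun δ hδ ha ha' => ?_⟩
  · have h1 : (z : ℂ) * (a z - 1) = readFst ((z : ℂ) • (pair ε (a z, a' z) - 1)) := by
      rw [map_smul, map_sub, readFst_pair, ← pair_one ε, readFst_pair, smul_eq_mul]
      rfl
    rw [h1]
    refine (readFst.le_opNorm_of_le (hc.za_le z)).trans ?_
    have : 0 ≤ ‖divDiff‖ * C := by positivity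
    linarith
  · refine (hda z).trans ?_
    have : 0 ≤ ‖readFst‖ * C * ε := by positivity
    linarith
  have na : ∀ z, a z ≠ 0 := fun z => norm_pos_iff.1 (hδ.trans_le (ha z))
  have na' : ∀ z, a' z ≠ 0 := fun z => norm_pos_iff.1 (hδ.trans_le (ha' z))
  set i : ℝ → PairAlgebra := fun z => pair ε ((a z)⁻¹, (a' z)⁻¹) with hi
  have ni : ∀ z, ‖i z‖ ≤ D δ := fun z => by
    refine (norm_pair_le hε _).trans ?_
    have i1 : ‖(a z)⁻¹‖ ≤ δ⁻¹ := by rw [norm_inv]; exact inv_anti₀ hδ (ha z)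
    have i2 : ‖(a' z)⁻¹‖ ≤ δ⁻¹ := by rw [norm_inv]; exact inv_anti₀ hδ (ha' z)
    have i3 : ε⁻¹ * ‖(a' z)⁻¹ - (a z)⁻¹‖ ≤ ‖divDiff‖ * C * (δ⁻¹ * δ⁻¹) := by
      have : (a' z)⁻¹ - (a z)⁻¹ = -((a' z - a z) * ((a' z)⁻¹ * (a z)⁻¹)) := by
        have := na z
        have := na' z
        field_simp
        ring
      rw [this, norm_neg, norm_mul, norm_mul]
      calc ε⁻¹ * (‖a' z - a z‖ * (‖(a' z)⁻¹‖ * ‖(a z)⁻¹‖))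
          ≤ ε⁻¹ * ((‖divDiff‖ * C * ε) * (δ⁻¹ * δ⁻¹)) := by
            gcongr
            exact hda z
        _ = _ := by field_simp
    exact mul_le_mul_of_nonneg_left (add_le_add (add_le_add i1 i2) i3) pairConst_nonneg
  have hai : ∀ z, pair ε (a z, a' z) * i z = 1 := fun z => by
    rw [hi, pair_mul, ← pair_one ε]
    congr 1
    ext <;> simp [na z, na' z]
  have hia : ∀ z, i z * pair ε (a z, a' z) = 1 := fun z => by
    rw [hi, pair_mul, ← pair_one ε]
    congr 1
    ext <;> simp [na z, na' z]
  -- Multiplicativity of `pair ε` turns the product into the pair of the two quotients, whose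
  -- divided difference is then read off.
  have hr : ∀ z, b' z / a' z - b z / a z = (ε : ℂ) • divDiff (i z * pair ε (b z, b' z)) := by
    intro z
    rw [hi, pair_mul, smul_eq_mul, ← hdd]
    simp only [Prod.snd_mul, Prod.fst_mul]
    ring
  have hzr : ∀ z : ℝ, (z : ℂ) • (b' z / a' z - b z / a z)
      = (ε : ℂ) • divDiff (i z * ((z : ℂ) • pair ε (b z, b' z))) := fun z => by
    rw [hr, clm_mul_smul, smul_comm]
  have hz3r : ∀ z : ℝ, (z : ℂ) ^ 3 • (b' z / a' z - b z / a z)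
      = (ε : ℂ) • divDiff (i z * ((z : ℂ) ^ 3 • pair ε (b z, b' z))) := fun z => by
    rw [hr, clm_mul_smul, smul_comm]
  have hne : ‖(ε : ℂ)‖ = ε := by rw [Complex.norm_real, Real.norm_of_nonneg hε.le]
  have hDδ := hD0 δ hδ
  have ma := hc.a_cont.aestronglyMeasurable (μ := volume)
  have mb := hc.b_cont.aestronglyMeasurable (μ := volume)
  have mzb : AEStronglyMeasurable (fun z : ℝ => (z : ℂ) • pair ε (b z, b' z)) volume :=
    (Complex.continuous_ofReal.smul hc.b_cont).aestronglyMeasurable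
  have bound : ∀ {f : ℝ → PairAlgebra}, eLpNorm f 2 volume ≤ ENNReal.ofReal C →
      eLpNorm (fun z => (ε : ℂ) • divDiff (i z * f z)) 2 volume
        ≤ ENNReal.ofReal (‖divDiff‖ * (D δ * C + D δ * D δ * C * C) * ε) := fun {f} hf => by
    have := eLpNorm_const_smul (ε : ℂ) (fun z => divDiff (i z * f z)) 2 volume
    refine this.le.trans ?_
    rw [mul_comm, ENNReal.ofReal_mul (by positivity), ← ofReal_norm, hne]
    gcongr
    refine (eLpNorm_clm_mul_le divDiff hDδ ni hf).trans (ENNReal.ofReal_le_ofReal ?_)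
    have : 0 ≤ ‖divDiff‖ * (D δ * D δ * C * C) := by positivity
    linarith
  constructor
  · exact (cb'.div ca' na').sub (cb.div ca na)
  · simp only [hr]
    exact bound hc.b_l2
  · simp only [hz3r]
    exact bound hc.z3b_l2
  · simp only [hr]
    refine (((TransLip.inv_mul hC hDδ hai hia ni hc.b_le hc.a_lip hc.b_lip ma mb).clm
      divDiff).const_smul ε).mono (le_of_eq ?_)
    rw [hne, mul_comm]
  · simp only [hzr]
    refine (((TransLip.inv_mul hC hDδ hai hia ni hc.zb_le hc.a_lip hc.zb_lip ma mzb).clm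
      divDiff).const_smul ε).mono (le_of_eq ?_)
    rw [hne, mul_comm]

end AKNS

namespace NonlocalMKdV
open Filter Topology AKNS
open scoped ENNReal

/-! ## Weak derivatives on the line -/

lemma HasWeakDeriv.congr {f g f' g' : ℝ → ℂ} (h : HasWeakDeriv f g) (hf : f =ᵐ[volume] f')
    (hg : g =ᵐ[volume] g') : HasWeakDeriv f' g' := by
  refine ⟨h.1.congr hf, h.2.1.congr hg, fun φ hφ hc => ?_⟩
  rw [← integral_congr_ae (hf.mono fun x hx => by simp only [hx] :
      (fun x => deriv φ x • f x) =ᵐ[volume] fun x => deriv φ x • f' x),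
    ← integral_congr_ae (hg.mono fun x hx => by simp only [hx] :
      (fun x => φ x • g x) =ᵐ[volume] fun x => φ x • g' x)]
  exact h.2.2 φ hφ hc

lemma HasWeakDeriv.unique {f g g' : ℝ → ℂ} (h : HasWeakDeriv f g) (h' : HasWeakDeriv f g') :
    g =ᵐ[volume] g' := by
  refine ae_eq_of_integral_contDiff_smul_eq h.2.1 h'.2.1 fun φ hφ hc => ?_
  rw [← neg_inj, ← h.2.2 φ hφ hc, h'.2.2 φ hφ hc]

lemma integrable_test_smul {φ : ℝ → ℝ} {f : ℝ → ℂ} (hφ : Continuous φ) (hc : HasCompactSupport φ)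
    (hf : LocallyIntegrable f) : Integrable fun x => φ x • f x :=
  hf.integrable_smul_left_of_hasCompactSupport hφ hc

lemma HasWeakDeriv.sub {f g f' g' : ℝ → ℂ} (h : HasWeakDeriv f f') (k : HasWeakDeriv g g') :
    HasWeakDeriv (f - g) (f' - g') := by
  refine ⟨h.1.sub k.1, h.2.1.sub k.2.1, fun φ hφ hc => ?_⟩
  have c' : Continuous (deriv φ) := hφ.continuous_deriv (by simp)
  simp only [Pi.sub_apply, smul_sub]
  rw [integral_sub (integrable_test_smul c' hc.deriv h.1) (integrable_test_smul c' hc.deriv k.1),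
    integral_sub (integrable_test_smul hφ.continuous hc h.2.1)
      (integrable_test_smul hφ.continuous hc k.2.1), h.2.2 φ hφ hc, k.2.2 φ hφ hc]
  ring

lemma exists_tsupport_subset_Ioo {φ : ℝ → ℝ} (hc : HasCompactSupport φ) :
    ∃ T > 0, tsupport φ ⊆ Ioo (-T) T := by
  obtain ⟨T, hT, h⟩ := hc.isCompact.isBounded.subset_ball_lt 0 (0 : ℝ)
  rw [Real.ball_eq_Ioo, zero_sub, zero_add] at h
  exact ⟨T, hT, h⟩

/-- Vanishing of the integral is what makes the primitive zero to the right of the support as well.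
-/
lemma exists_test_primitive {χ : ℝ → ℝ} (hχ : ContDiff ℝ ∞ χ) (hc : HasCompactSupport χ)
    (h0 : ∫ x, χ x = 0) :
    ∃ ψ : ℝ → ℝ, ContDiff ℝ ∞ ψ ∧ HasCompactSupport ψ ∧ deriv ψ = χ := by
  obtain ⟨T, hT, hT'⟩ := exists_tsupport_subset_Ioo hc
  have hs : ∀ x, x ∉ Ioo (-T) T → χ x = 0 := fun x hx =>
    image_eq_zero_of_notMem_tsupport fun h => hx (hT' h)
  set ψ : ℝ → ℝ := fun x => ∫ t in (-T)..x, χ t with hψ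
  have hd : ∀ x, HasDerivAt ψ (χ x) x := fun x =>
    intervalIntegral.integral_hasDerivAt_right (hχ.continuous.intervalIntegrable _ _)
      (hχ.continuous.stronglyMeasurableAtFilter _ _) hχ.continuous.continuousAt
  have hd' : deriv ψ = χ := funext fun x => (hd x).deriv
  refine ⟨ψ, contDiff_infty_iff_deriv.2 ⟨fun x => (hd x).differentiableAt, hd' ▸ hχ⟩,
    HasCompactSupport.intro (isCompact_Icc (a := -T) (b := T)) fun x hx => ?_, hd'⟩
  rcases lt_or_ge x (-T) with h1 | h1
  · rw [hψ]
    simp only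
    rw [intervalIntegral.integral_congr (g := fun _ => (0 : ℝ)) fun t ht => hs t fun h => ?_]
    · simp
    · rw [uIcc_of_ge h1.le] at ht
      exact absurd h.1 (not_lt.2 ht.2)
  · have h2 : T < x := not_le.1 fun h => hx ⟨h1, h⟩
    rw [hψ]
    simp only
    rw [intervalIntegral.integral_eq_integral_of_support_subset, h0]
    intro t ht
    by_contra h
    refine ht (hs t fun h' => h ⟨h'.1, h'.2.le.trans h2.le⟩)

/-- The du Bois-Reymond lemma: for a fixed bump `ρ` of integral one, `φ - (∫ φ) ρ` is the derivative
of a test function, so `∫ φ f = (∫ φ) (∫ ρ f)` for every test function `φ`. -/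
lemma HasWeakDeriv.ae_eq_const {f : ℝ → ℂ} (h : HasWeakDeriv f 0) :
    ∃ c : ℂ, f =ᵐ[volume] fun _ => c := by
  let η : ContDiffBump (0 : ℝ) := ⟨1, 2, one_pos, one_lt_two⟩
  set ρ : ℝ → ℝ := η.normed volume with hρ
  have ρs : ContDiff ℝ ∞ ρ := η.contDiff_normed
  have ρc : HasCompactSupport ρ := η.hasCompactSupport_normed
  have ρi : ∫ x, ρ x = 1 := η.integral_normed
  refine ⟨∫ x, ρ x • f x, ae_eq_of_integral_contDiff_smul_eq h.1 (locallyIntegrable_const _)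
    fun φ hφ hc => ?_⟩
  have iφ : Integrable φ := hφ.continuous.integrable_of_hasCompactSupport hc
  have iρ : Integrable ρ := ρs.continuous.integrable_of_hasCompactSupport ρc
  obtain ⟨ψ, hψ, hψc, hd⟩ := exists_test_primitive (χ := fun x => φ x - (∫ y, φ y) * ρ x)
    (hφ.sub (contDiff_const.mul ρs)) (hc.sub (ρc.mul_left)) (by
      rw [integral_sub iφ (iρ.const_mul _), integral_const_mul, ρi]; ring)
  have h1 := h.2.2 ψ hψ hψc
  rw [hd] at h1
  simp only [sub_smul, mul_smul, Pi.zero_apply, smul_zero, integral_zero, neg_zero] at h1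
  have i2 : Integrable fun x => (∫ y, φ y) • ρ x • f x :=
    (integrable_test_smul ρs.continuous ρc h.1).smul (∫ y, φ y)
  rw [integral_sub (integrable_test_smul hφ.continuous hc h.1) i2, integral_smul,
    sub_eq_zero] at h1
  rw [h1, integral_smul_const]

lemma hasWeakDeriv_primitive {g : ℝ → ℂ} (hg : LocallyIntegrable g) (c : ℂ) :
    HasWeakDeriv (fun x => c + ∫ t in (0 : ℝ)..x, g t) g := by
  have gi : ∀ a b, IntervalIntegrable g volume a b := fun a b =>
    (hg.integrableOn_isCompact isCompact_uIcc).intervalIntegrable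
  have hcont : Continuous fun x => c + ∫ t in (0 : ℝ)..x, g t :=
    continuous_const.add (intervalIntegral.continuous_primitive gi _)
  refine ⟨hcont.locallyIntegrable, hg, fun φ hφ hc => ?_⟩
  obtain ⟨T, hT, hs⟩ := exists_tsupport_subset_Ioo hc
  have hT' : -T ≤ T := by linarith
  have c' : Continuous (deriv φ) := hφ.continuous_deriv (by simp)
  have hφ0 : ∀ x, x ∉ Ioo (-T) T → φ x = 0 := fun x hx =>
    image_eq_zero_of_notMem_tsupport fun h => hx (hs h)
  have hφ1 : ∀ x, x ∉ Ioo (-T) T → deriv φ x = 0 := fun x hx =>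
    image_eq_zero_of_notMem_tsupport fun h => hx (hs (tsupport_deriv_subset (f := φ) h))
  have restrict : ∀ {χ : ℝ → ℝ} (k : ℝ → ℂ), (∀ x, x ∉ Ioo (-T) T → χ x = 0) →
      ∫ x, χ x • k x = ∫ x in (-T)..T, χ x • k x := fun k h0 =>
    (intervalIntegral.integral_eq_integral_of_support_subset fun x hx => by
      by_contra h
      exact hx (by simp only [h0 x fun h' => h (Ioo_subset_Ioc_self h'), zero_smul])).symm
  rw [restrict _ hφ0, restrict _ hφ1]
  have key := integral_mul_of_primitive (f := fun x => c + ∫ t in (0 : ℝ)..x, g t) (f' := g)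
    (F := fun x => ((φ x : ℝ) : ℂ)) (F' := fun x => ((deriv φ x : ℝ) : ℂ)) hT' (gi _ _)
    (fun x _ => by
      rw [add_assoc, intervalIntegral.integral_add_adjacent_intervals (gi _ _) (gi _ _)])
    (fun x => ((hφ.differentiable (by simp)) x).hasDerivAt.ofReal_comp) (by fun_prop)
  rw [hφ0 T (by simp), hφ0 (-T) (by simp), Complex.ofReal_zero, mul_zero, mul_zero, sub_zero,
    zero_sub] at key
  simp only [Complex.real_smul]
  simp only [mul_comm _ (g _)]
  rw [key, neg_neg]
  simp only [mul_comm]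

/-- The difference between `f` and the primitive of `g` has weak derivative zero, hence is constant.
-/
lemma HasWeakDeriv.exists_ae_eq_primitive {f g : ℝ → ℂ} (h : HasWeakDeriv f g) :
    ∃ c : ℂ, f =ᵐ[volume] fun x => c + ∫ t in (0 : ℝ)..x, g t := by
  have h1 := h.sub (hasWeakDeriv_primitive h.2.1 0)
  rw [sub_self] at h1
  obtain ⟨c, hc⟩ := h1.ae_eq_const
  refine ⟨c, hc.mono fun x hx => ?_⟩
  rw [Pi.sub_apply, zero_add, sub_eq_iff_eq_add] at hx
  exact hx

lemma hasWeakDeriv_weakDeriv {f : ℝ → ℂ} (h : ∃ g, HasWeakDeriv f g) :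
    HasWeakDeriv f (weakDeriv f) := by
  unfold weakDeriv
  rw [dif_pos h]
  exact h.choose_spec

lemma HasWeakDeriv.weakDeriv_ae_eq {f g : ℝ → ℂ} (h : HasWeakDeriv f g) :
    weakDeriv f =ᵐ[volume] g :=
  (hasWeakDeriv_weakDeriv ⟨g, h⟩).unique h

/-! ## Representatives of potentials -/

lemma MemH.hasWeakDeriv {k j : ℕ} {f : ℝ → ℂ} (h : MemH k f) (hj : j < k) :
    HasWeakDeriv (weakDeriv^[j] f) (weakDeriv^[j + 1] f) := by
  rw [Function.iterate_succ_apply']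
  exact hasWeakDeriv_weakDeriv (h.1 j hj)

/-- A member of `H^{1,1} ∩ H^3` has a representative of class `C^2`. -/
lemma MemX.exists_representative {u : ℝ → ℂ} (h : MemX u) :
    ∃ u₀ u₁ u₂ : ℝ → ℂ, u =ᵐ[volume] u₀ ∧ weakDeriv u =ᵐ[volume] u₁ ∧
      weakDeriv^[2] u =ᵐ[volume] u₂ ∧ (∀ x, HasDerivAt u₀ (u₁ x) x) ∧
      (∀ x, HasDerivAt u₁ (u₂ x) x) ∧
      ∀ x, u₂ x = u₂ 0 + ∫ t in (0 : ℝ)..x, (weakDeriv^[3] u) t := by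
  have w0 := h.2.hasWeakDeriv (j := 0) (by norm_num)
  have w1 := h.2.hasWeakDeriv (j := 1) (by norm_num)
  have w2 := h.2.hasWeakDeriv (j := 2) (by norm_num)
  have cp : ∀ {g : ℝ → ℂ} (c : ℂ), LocallyIntegrable g →
      Continuous fun x => c + ∫ t in (0 : ℝ)..x, g t := fun c hg =>
    continuous_const.add (intervalIntegral.continuous_primitive
      (fun a b => (hg.integrableOn_isCompact isCompact_uIcc).intervalIntegrable) _)
  have dp : ∀ {g : ℝ → ℂ} (c : ℂ), Continuous g → ∀ x,
      HasDerivAt (fun x => c + ∫ t in (0 : ℝ)..x, g t) (g x) x := fun c hg x =>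
    (intervalIntegral.integral_hasDerivAt_right (hg.intervalIntegrable _ _)
      (hg.stronglyMeasurableAtFilter _ _) hg.continuousAt).const_add c
  -- The representative is built downwards from the third weak derivative: each level is first
  -- replaced by its continuous representative, so that the next primitive is differentiable at
  -- every point.
  obtain ⟨c₂, e2⟩ := w2.exists_ae_eq_primitive
  set u₂ : ℝ → ℂ := fun x => c₂ + ∫ t in (0 : ℝ)..x, (weakDeriv^[3] u) t with hu₂
  obtain ⟨c₁, e1⟩ := (w1.congr (ae_eq_refl _) e2).exists_ae_eq_primitive
  set u₁ : ℝ → ℂ := fun x => c₁ + ∫ t in (0 : ℝ)..x, u₂ t with hu₁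
  obtain ⟨c₀, e0⟩ := (w0.congr (ae_eq_refl _) e1).exists_ae_eq_primitive
  have k2 : Continuous u₂ := cp c₂ w2.2.1
  have k1 : ∀ x, HasDerivAt u₁ (u₂ x) x := dp c₁ k2
  refine ⟨_, u₁, u₂, e0, e1, e2,
    dp c₀ (continuous_iff_continuousAt.2 fun x => (k1 x).continuousAt), k1, fun x => ?_⟩
  simp [hu₂]

lemma toReal_eLpNorm_nonneg (f : ℝ → ℂ) : 0 ≤ (eLpNorm f 2 volume).toReal := ENNReal.toReal_nonneg

lemma normX_eq (u : ℝ → ℂ) : normX u = normL2w 1 u + normL2w 1 (weakDeriv u) +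
    ((eLpNorm u 2 volume).toReal + (eLpNorm (weakDeriv u) 2 volume).toReal
      + (eLpNorm (weakDeriv^[2] u) 2 volume).toReal
      + (eLpNorm (weakDeriv^[3] u) 2 volume).toReal) := by
  simp only [normX, normH11, normH, Finset.sum_range_succ, Finset.sum_range_zero, zero_add]
  rfl

lemma normX_nonneg (u : ℝ → ℂ) : 0 ≤ normX u := by
  rw [normX_eq]
  simp only [normL2w]
  positivity

lemma l2le_of_toReal_le {f : ℝ → ℂ} {K : ℝ} (hf : MemLp f 2 volume)
    (h : (eLpNorm f 2 volume).toReal ≤ K) : L2le f K :=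
  ⟨hf.1, (ENNReal.le_ofReal_iff_toReal_le hf.2.ne (ENNReal.toReal_nonneg.trans h)).2 h⟩

lemma aestronglyMeasurable_of_memL2w {s : ℕ} {f : ℝ → ℂ} (hf : MemL2w s f) :
    AEStronglyMeasurable f volume := by
  have h1 : f = fun x : ℝ => (Real.sqrt (1 + x ^ 2) ^ s)⁻¹ • weighted s f x := by
    funext x
    have : Real.sqrt (1 + x ^ 2) ≠ 0 := (Real.sqrt_pos.2 (by positivity)).ne'
    rw [weighted, smul_smul, inv_mul_cancel₀ (pow_ne_zero _ this), one_smul]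
  rw [h1]
  have h2 : Measurable fun x : ℝ => (Real.sqrt (1 + x ^ 2) ^ s)⁻¹ := by fun_prop
  exact h2.aestronglyMeasurable.smul hf.1

lemma l2le_mul_of_memL2w {f : ℝ → ℂ} {K : ℝ} (hf : MemL2w 1 f) (h : normL2w 1 f ≤ K) :
    L2le (fun y : ℝ => (y : ℂ) • f y) K := by
  have h1 := L2le.of_norm_le (f := fun y : ℝ => (y : ℂ) • f y) (K := 1)
    (AEStronglyMeasurable.smul (f := fun y : ℝ => (y : ℂ)) (by fun_prop)
      (aestronglyMeasurable_of_memL2w hf))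
    (l2le_of_toReal_le hf h) zero_le_one (ae_of_all _ fun y => by
      rw [one_mul, weighted, norm_smul, norm_smul, Complex.norm_real, pow_one, Real.norm_eq_abs,
        Real.norm_of_nonneg (Real.sqrt_nonneg _)]
      gcongr
      exact Real.abs_le_sqrt (by linarith))
  rwa [one_mul] at h1

/-- The functions on the right are arbitrary representatives, including at third order. This freedom
is used for differences, where the chosen weak derivative of `u - v` agrees with the difference of
the chosen ones only almost everywhere. -/
lemma potential_of_memX {w f f₁ f₂ f₃ : ℝ → ℂ} (hw : MemX w) (h0 : w =ᵐ[volume] f)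
    (h1 : weakDeriv w =ᵐ[volume] f₁) (h2 : weakDeriv^[2] w =ᵐ[volume] f₂)
    (h3 : weakDeriv^[3] w =ᵐ[volume] f₃) (d0 : ∀ x, HasDerivAt f (f₁ x) x)
    (d1 : ∀ x, HasDerivAt f₁ (f₂ x) x) (hp : ∀ x, f₂ x = f₂ 0 + ∫ t in (0 : ℝ)..x, f₃ t) :
    Potential (normX w) f f₁ f₂ f₃ := by
  have n0 := toReal_eLpNorm_nonneg w
  have n1 := toReal_eLpNorm_nonneg (weakDeriv w)
  have n2 := toReal_eLpNorm_nonneg (weakDeriv^[2] w)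
  have n3 := toReal_eLpNorm_nonneg (weakDeriv^[3] w)
  have m0 : 0 ≤ normL2w 1 w := ENNReal.toReal_nonneg
  have m1 : 0 ≤ normL2w 1 (weakDeriv w) := ENNReal.toReal_nonneg
  have e := normX_eq w
  have sm : ∀ {k g : ℝ → ℂ}, k =ᵐ[volume] g →
      (fun y : ℝ => (y : ℂ) • k y) =ᵐ[volume] fun y : ℝ => (y : ℂ) • g y := fun h =>
    h.mono fun y hy => by simp only [hy]
  exact
    { d0 := d0
      d1 := d1
      s2 := ⟨hp, (l2le_of_toReal_le (hw.2.2 2 (by norm_num)) (by linarith)).congr h2,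
        (l2le_of_toReal_le (hw.2.2 3 (by norm_num)) (by linarith)).congr h3⟩
      l0 := (l2le_of_toReal_le (hw.2.2 0 (by norm_num)) (by
        rw [Function.iterate_zero_apply]; linarith)).congr h0
      w0 := (l2le_mul_of_memL2w hw.1.1 (by linarith)).congr (sm h0)
      l1 := (l2le_of_toReal_le (hw.2.2 1 (by norm_num)) (by
        rw [Function.iterate_one]; linarith)).congr h1
      w1 := (l2le_mul_of_memL2w hw.1.2.2 (by linarith)).congr (sm h1) }

/-! ## Differences of potentials -/

lemma weighted_sub (s : ℕ) (f g : ℝ → ℂ) : weighted s (f - g) = weighted s f - weighted s g := by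
  funext x
  simp [weighted, smul_sub]

lemma weighted_congr (s : ℕ) {f g : ℝ → ℂ} (h : f =ᵐ[volume] g) :
    weighted s f =ᵐ[volume] weighted s g :=
  h.mono fun x hx => by simp only [weighted, hx]

/-- Because `weakDeriv` is defined by choice, it is additive only up to null sets, and each
iteration has to pass through the uniqueness of weak derivatives. -/
lemma MemX.iterate_weakDeriv_sub {u v : ℝ → ℂ} (hu : MemX u) (hv : MemX v) (j : ℕ) (hj : j ≤ 3) :
    weakDeriv^[j] (u - v) =ᵐ[volume] weakDeriv^[j] u - weakDeriv^[j] v := by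
  induction j with
  | zero => rfl
  | succ j ih =>
    rw [Function.iterate_succ_apply' weakDeriv j (u - v)]
    have h1 := (hu.2.hasWeakDeriv (show j < 3 by omega)).sub
      (hv.2.hasWeakDeriv (show j < 3 by omega))
    exact (h1.congr (ih (by omega)).symm (ae_eq_refl _)).weakDeriv_ae_eq

lemma MemX.sub {u v : ℝ → ℂ} (hu : MemX u) (hv : MemX v) : MemX (u - v) := by
  have e := MemX.iterate_weakDeriv_sub hu hv
  have hd : ∀ j < 3, ∃ g, HasWeakDeriv (weakDeriv^[j] (u - v)) g := fun j hj =>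
    ⟨_, ((hu.2.hasWeakDeriv hj).sub (hv.2.hasWeakDeriv hj)).congr (e j hj.le).symm (ae_eq_refl _)⟩
  refine ⟨⟨?_, hd 0 (by norm_num), ?_⟩, hd, fun j hj => ?_⟩
  · rw [MemL2w, weighted_sub]
    exact MemLp.sub hu.1.1 hv.1.1
  · have h1 := MemLp.sub hu.1.2.2 hv.1.2.2
    rw [← weighted_sub] at h1
    exact h1.ae_eq (weighted_congr 1 (e 1 (by norm_num)).symm)
  · exact ((hu.2.2 j hj).sub (hv.2.2 j hj)).ae_eq (e j hj).symm

lemma toReal_eLpNorm_le_add {f g h : ℝ → ℂ} (hf : MemLp f 2 volume) (hg : MemLp g 2 volume)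
    (e : h =ᵐ[volume] f - g) : (eLpNorm f 2 volume).toReal ≤
      (eLpNorm h 2 volume).toReal + (eLpNorm g 2 volume).toReal := by
  have h1 := hf.sub hg
  rw [eLpNorm_congr_ae e, ← ENNReal.toReal_add h1.2.ne hg.2.ne]
  refine ENNReal.toReal_mono (ENNReal.add_ne_top.2 ⟨h1.2.ne, hg.2.ne⟩) ?_
  have := eLpNorm_add_le h1.1 hg.1 (p := 2) (by norm_num)
  rwa [sub_add_cancel] at this

lemma normX_le_add {u w : ℝ → ℂ} (hu : MemX u) (hw : MemX w) :
    normX u ≤ normX (u - w) + normX w := by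
  have e := MemX.iterate_weakDeriv_sub hu hw
  have h0 := toReal_eLpNorm_le_add (hu.2.2 0 (by norm_num)) (hw.2.2 0 (by norm_num))
    (e 0 (by norm_num))
  have h1 := toReal_eLpNorm_le_add (hu.2.2 1 (by norm_num)) (hw.2.2 1 (by norm_num))
    (e 1 (by norm_num))
  have h2 := toReal_eLpNorm_le_add (hu.2.2 2 (by norm_num)) (hw.2.2 2 (by norm_num))
    (e 2 (by norm_num))
  have h3 := toReal_eLpNorm_le_add (hu.2.2 3 (by norm_num)) (hw.2.2 3 (by norm_num))
    (e 3 (by norm_num))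
  have k0 := toReal_eLpNorm_le_add hu.1.1 hw.1.1 (weighted_sub 1 u w).eventuallyEq
  have k1 := toReal_eLpNorm_le_add hu.1.2.2 hw.1.2.2
    ((weighted_congr 1 (e 1 (by norm_num))).trans (weighted_sub 1 _ _).eventuallyEq)
  rw [normX_eq u, normX_eq (u - w), normX_eq w]
  simp only [normL2w, Function.iterate_zero_apply, Function.iterate_one] at *
  linarith

end NonlocalMKdV

namespace AKNS
open Filter Topology NonlocalMKdV
open scoped ENNReal

/-! ## Translation-Lipschitz functions are weakly differentiable -/

/-- Banach–Alaoglu, transported by the Riesz isomorphism. Limits along an ultrafilter replace the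
extraction of a subsequence, so separability plays no role, and the closed dual ball preserves the
norm bound. -/
lemma exists_weak_limit {H : Type*} [NormedAddCommGroup H] [InnerProductSpace ℂ H]
    [CompleteSpace H] {x : ℕ → H} {K : ℝ} (hx : ∀ n, ‖x n‖ ≤ K) :
    ∃ g : H, ‖g‖ ≤ K ∧ ∃ l : Filter ℕ, l.NeBot ∧ l ≤ atTop ∧
      ∀ y, Tendsto (fun n => inner ℂ (x n) y) l (𝓝 (inner ℂ g y)) := by
  let J : H → WeakDual ℂ H := fun y => StrongDual.toWeakDual (InnerProductSpace.toDual ℂ H y)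
  have hJ : ∀ y w, J y w = inner ℂ y w := fun y w => InnerProductSpace.toDual_apply_apply
  let F := Ultrafilter.of (atTop : Filter ℕ)
  obtain ⟨L, hL, hlim⟩ := (WeakDual.isCompact_closedBall (𝕜 := ℂ) (E := H) 0 K).ultrafilter_le_nhds
    (F.map fun n => J (x n)) (by
      rw [le_principal_iff]
      refine Filter.mem_map.2 (Filter.mem_of_superset univ_mem fun n _ => ?_)
      simp only [mem_preimage, Metric.mem_closedBall, dist_zero_right]
      exact ((InnerProductSpace.toDual ℂ H).norm_map (x n)).le.trans (hx n))
  obtain ⟨g, hg⟩ := (InnerProductSpace.toDual ℂ H).surjective (WeakDual.toStrongDual L)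
  have hgL : ∀ w, L w = inner ℂ g w := fun w => by
    rw [← InnerProductSpace.toDual_apply_apply, hg]
    rfl
  refine ⟨g, ?_, F, F.neBot, Ultrafilter.of_le _, fun y => ?_⟩
  · simp only [mem_preimage, Metric.mem_closedBall, dist_zero_right] at hL
    rwa [← (InnerProductSpace.toDual ℂ H).norm_map, hg]
  · have h1 : Tendsto (fun n => J (x n)) F (𝓝 L) := hlim
    have h2 := ((WeakDual.eval_continuous (𝕜 := ℂ) y).tendsto L).comp h1
    rw [← hgL]
    exact h2.congr fun n => hJ _ _

/-- A change of variable moves the difference quotient onto `φ`. Its Lipschitz constant gives the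
dominating function, and the support grows by at most one because the steps are at most one. -/
lemma tendsto_integral_diffQuotient {f : ℝ → ℂ} (hf : Continuous f) {φ : ℝ → ℝ}
    (hφ : ContDiff ℝ ∞ φ) (hc : HasCompactSupport φ) :
    Tendsto (fun n : ℕ => ∫ z, φ z • (((n : ℂ) + 1) * (f (z + ((n : ℝ) + 1)⁻¹) - f z))) atTop
      (𝓝 (-∫ z, deriv φ z • f z)) := by
  obtain ⟨L, hL⟩ := hφ.lipschitzWith_of_hasCompactSupport hc (by simp)
  obtain ⟨T, hT, hs⟩ := exists_tsupport_subset_Ioo hc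
  have hφ0 : ∀ x, x ∉ Ioo (-T) T → φ x = 0 := fun x hx =>
    image_eq_zero_of_notMem_tsupport fun h => hx (hs h)
  have cφ := hφ.continuous
  set t : ℕ → ℝ := fun n => ((n : ℝ) + 1)⁻¹ with ht
  have t0 : ∀ n, 0 < t n := fun n => by positivity
  have t1 : ∀ n, t n ≤ 1 := fun n => inv_le_one_of_one_le₀ (by simp)
  have htinv : ∀ n : ℕ, ((n : ℂ) + 1) = (((t n)⁻¹ : ℝ) : ℂ) := fun n => by simp [ht]
  have shift : ∀ n : ℕ, ∫ z, φ z • (((n : ℂ) + 1) * (f (z + t n) - f z))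
      = ∫ z, ((t n)⁻¹ * (φ (z + -t n) - φ z)) • f z := fun n => by
    have i1 : Integrable fun z => φ z • (((n : ℂ) + 1) * f (z + t n)) :=
      Continuous.integrable_of_hasCompactSupport (by fun_prop) hc.smul_right
    have i2 : Integrable fun z => φ z • (((n : ℂ) + 1) * f z) :=
      Continuous.integrable_of_hasCompactSupport (by fun_prop) hc.smul_right
    have i3 : Integrable fun z => φ (z + -t n) • (((n : ℂ) + 1) * f z) := by
      have := i1.comp_add_right (-t n)
      simpa using this
    simp only [mul_sub, smul_sub]
    rw [integral_sub i1 i2, ← integral_add_right_eq_self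
      (fun z => φ z • (((n : ℂ) + 1) * f (z + t n))) (-t n)]
    simp only [neg_add_cancel_right]
    rw [← integral_sub i3 i2]
    refine integral_congr_ae (ae_of_all _ fun z => ?_)
    simp only [htinv, Complex.real_smul]
    push_cast
    ring
  refine Tendsto.congr (fun n => (shift n).symm) ?_
  rw [← integral_neg]
  refine tendsto_integral_of_dominated_convergence
    (fun z => (Icc (-T - 1) (T + 1)).indicator (fun z => (L : ℝ) * ‖f z‖) z)
    (fun n => Continuous.aestronglyMeasurable (by fun_prop)) ?_ (fun n => ae_of_all _ fun z => ?_)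
    (ae_of_all _ fun z => ?_)
  · exact (Continuous.integrableOn_Icc (by fun_prop)).integrable_indicator measurableSet_Icc
  · by_cases hz : z ∈ Icc (-T - 1) (T + 1)
    · rw [indicator_of_mem hz, norm_smul, norm_mul, Real.norm_of_nonneg (inv_nonneg.2 (t0 n).le)]
      gcongr
      have := hL.dist_le_mul (z + -t n) z
      rw [Real.dist_eq, Real.dist_eq, add_sub_cancel_left, abs_neg, abs_of_pos (t0 n)] at this
      rw [Real.norm_eq_abs, inv_mul_le_iff₀ (t0 n)]
      linarith
    · have h1 : φ z = 0 := hφ0 z fun h => hz ⟨by linarith [h.1], by linarith [h.2]⟩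
      have h2 : φ (z + -t n) = 0 := hφ0 _ fun h =>
        hz ⟨by linarith [h.1, t0 n], by linarith [h.2, t1 n]⟩
      rw [indicator_of_notMem hz, h1, h2]
      simp
  · have hd := (((hφ.differentiable (by simp)) z).hasDerivAt)
    rw [hasDerivAt_iff_tendsto_slope_zero] at hd
    have ht0 : Tendsto (fun n => -t n) atTop (𝓝[≠] 0) := by
      refine tendsto_nhdsWithin_iff.2 ⟨?_, Eventually.of_forall fun n => (neg_neg_of_pos (t0 n)).ne⟩
      rw [← neg_zero]
      exact tendsto_one_div_add_atTop_nhds_zero_nat.neg.congr fun n => by simp [ht]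
    rw [← neg_smul]
    refine Tendsto.smul_const ?_ _
    refine (hd.comp ht0).neg.congr fun n => ?_
    simp only [Function.comp_apply, smul_eq_mul, inv_neg]
    ring

/-- The hypothesis says that difference quotients are bounded by `K` in `L²`; any weak limit of them
is a weak derivative, with the same bound. -/
theorem TransLip.exists_hasWeakDeriv {f : ℝ → ℂ} {K : ℝ} (hf : Continuous f) (hK : 0 ≤ K)
    (h : TransLip f K) : ∃ g, L2le g K ∧ HasWeakDeriv f g := by
  set D : ℕ → ℝ → ℂ := fun n z => ((n : ℂ) + 1) * (f (z + ((n : ℝ) + 1)⁻¹) - f z) with hD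
  have hDn : ∀ n, eLpNorm (D n) 2 volume ≤ ENNReal.ofReal K := fun n => by
    have h1 := h ((n : ℝ) + 1)⁻¹
    rw [abs_of_pos (by positivity)] at h1
    refine (eLpNorm_le_mul_eLpNorm_of_ae_le_mul
      (g := fun z => f (z + ((n : ℝ) + 1)⁻¹) - f z) (c := (n : ℝ) + 1)
      (ae_of_all _ fun z => ?_) 2).trans ((mul_le_mul_right h1 _).trans ?_)
    · rw [hD, norm_mul]
      gcongr
      exact_mod_cast (Complex.norm_natCast (n + 1)).le
    · rw [← ENNReal.ofReal_mul (by positivity)]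
      exact ENNReal.ofReal_le_ofReal (le_of_eq (by field_simp))
  have hDm : ∀ n, MemLp (D n) 2 volume := fun n =>
    ⟨Continuous.aestronglyMeasurable (by fun_prop), (hDn n).trans_lt ENNReal.ofReal_lt_top⟩
  obtain ⟨g, hg, l, hl, hle, hlim⟩ := exists_weak_limit (H := Lp ℂ 2 (volume : Measure ℝ))
    (x := fun n => (hDm n).toLp) (K := K) fun n => by
      rw [Lp.norm_toLp]
      exact ENNReal.toReal_le_of_le_ofReal hK (hDn n)
  have hgL : L2le g K := l2le_of_toReal_le (Lp.memLp g) (by rwa [← Lp.norm_def])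
  refine ⟨g, hgL, hf.locallyIntegrable, hgL.locallyIntegrable, fun φ hφ hc => ?_⟩
  have hφm : MemLp (fun z => ((φ z : ℝ) : ℂ)) 2 volume :=
    Continuous.memLp_of_hasCompactSupport (Complex.continuous_ofReal.comp hφ.continuous)
      (hc.comp_left (g := ((↑) : ℝ → ℂ)) Complex.ofReal_zero)
  -- The inner product is conjugate linear in its first argument, where the difference quotient
  -- stands. As the test function is real, conjugating gives the bilinear pairing.
  have inner_eq : ∀ {w : ℝ → ℂ} {W : Lp ℂ 2 (volume : Measure ℝ)}, W =ᵐ[volume] w →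
      (starRingEnd ℂ) (inner ℂ W hφm.toLp) = ∫ z, φ z • w z := fun {w W} hW => by
    rw [L2.inner_def, ← integral_conj]
    refine integral_congr_ae ?_
    filter_upwards [hW, hφm.coeFn_toLp] with z h1 h2
    rw [h1, h2, RCLike.inner_apply, Complex.real_smul]
    simp
  have lim1 := (Complex.continuous_conj.tendsto _).comp (hlim hφm.toLp)
  rw [inner_eq (ae_eq_refl _)] at lim1
  have lim2 := (tendsto_integral_diffQuotient hf hφ hc).mono_left hle
  have := tendsto_nhds_unique (lim1.congr fun n => inner_eq (hDm n).coeFn_toLp) lim2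
  rw [this, neg_neg]

/-- The weak derivative of `f` is tested against `z φ(z)`. -/
lemma hasWeakDeriv_mul {f g : ℝ → ℂ} (hf : Continuous f) (h : HasWeakDeriv f g) :
    HasWeakDeriv (fun z : ℝ => (z : ℂ) • f z) (fun z : ℝ => f z + (z : ℂ) • g z) := by
  have lz : LocallyIntegrable fun z : ℝ => (z : ℂ) • g z := by
    refine (locallyIntegrable_iff).2 fun K hK => ?_
    exact (h.2.1.integrableOn_isCompact hK).continuousOn_mul
      (Complex.continuous_ofReal.continuousOn) hK
  refine ⟨Continuous.locallyIntegrable (by fun_prop), hf.locallyIntegrable.add lz,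
    fun φ hφ hc => ?_⟩
  have c' : Continuous (deriv φ) := hφ.continuous_deriv (by simp)
  have hd : ∀ z, deriv (fun z => z * φ z) z = φ z + z * deriv φ z := fun z => by
    have := (hasDerivAt_id z).mul ((hφ.differentiable (by simp)) z).hasDerivAt
    exact this.deriv.trans (by simp)
  have hzc : HasCompactSupport fun z => z * φ z := hc.mul_left
  have key := h.2.2 (fun z => z * φ z) (contDiff_id.mul hφ) hzc
  simp only [hd] at key
  have i1 := integrable_test_smul hφ.continuous hc h.1
  have i2 : Integrable fun z => deriv φ z • ((z : ℂ) • f z) :=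
    integrable_test_smul c' hc.deriv (Continuous.locallyIntegrable (by fun_prop))
  have i3 := integrable_test_smul hφ.continuous hc lz
  have e1 : ∀ z, (φ z + z * deriv φ z) • f z = φ z • f z + deriv φ z • ((z : ℂ) • f z) :=
    fun z => by
      simp only [Complex.real_smul, smul_eq_mul]
      push_cast
      ring
  have e2 : ∀ z : ℝ, (z * φ z) • g z = φ z • ((z : ℂ) • g z) := fun z => by
    simp only [Complex.real_smul, smul_eq_mul]
    push_cast
    ring
  simp only [e1, e2] at key
  rw [integral_add i1 i2] at key
  simp only [smul_add]
  rw [integral_add i1 i3]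
  linear_combination key

/-! ## The norm of the reflection coefficients -/

lemma memL2w_of_l2le {s : ℕ} {f : ℝ → ℂ} {K : ℝ} (hK : 0 ≤ K) (h : L2le (weighted s f) K) :
    MemL2w s f ∧ normL2w s f ≤ K :=
  ⟨h.memLp, ENNReal.toReal_le_of_le_ofReal hK h.2⟩

lemma L2le.norm {E : Type*} [NormedAddCommGroup E] {f : ℝ → E} {K : ℝ} (h : L2le f K) :
    L2le (fun z => ‖f z‖) K :=
  ⟨h.1.norm, (eLpNorm_norm f).le.trans h.2⟩

lemma sqrt_one_add_sq_le (z : ℝ) : Real.sqrt (1 + z ^ 2) ≤ 1 + |z| := by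
  rw [Real.sqrt_le_left (by positivity)]
  nlinarith [abs_nonneg z, sq_abs z]

/-- If `k` is the weak derivative of `z f`, then `z f' = k - f`, so the weighted bound on `f'`
follows from translation bounds on `f` and `z f`. The constant is `14 = 3 + 3 + 8`, for the weighted
norms of `f`, of `f'` and of `f` with cubic weight. -/
theorem ReflectionBounds.memY {K : ℝ} {f : ℝ → ℂ} (hK : 0 ≤ K) (h : ReflectionBounds K f) :
    MemY f ∧ normY f ≤ 14 * K := by
  have cf := h.cont
  have l0 : L2le f K := ⟨cf.aestronglyMeasurable, h.l2⟩
  have l3 : L2le (fun z : ℝ => (z : ℂ) ^ 3 • f z) K :=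
    ⟨Continuous.aestronglyMeasurable (by fun_prop), h.z3_l2⟩
  obtain ⟨g, lg, hg⟩ := h.lip.exists_hasWeakDeriv cf hK
  obtain ⟨k, lk, hk⟩ := h.z_lip.exists_hasWeakDeriv (by fun_prop) hK
  have hw := hg.weakDeriv_ae_eq
  have ek := hk.unique (hasWeakDeriv_mul cf hg)
  have hwm : AEStronglyMeasurable (weakDeriv f) volume := lg.1.congr hw.symm
  have m : ∀ (s : ℕ) {w : ℝ → ℂ}, AEStronglyMeasurable w volume →
      AEStronglyMeasurable (weighted s w) volume := fun s w hm =>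
    AEStronglyMeasurable.smul (f := fun x : ℝ => Real.sqrt (1 + x ^ 2) ^ s)
      (Continuous.aestronglyMeasurable (by fun_prop)) hm
  have hn : ∀ (s : ℕ) (w : ℝ → ℂ) (z : ℝ), ‖weighted s w z‖ ≤ (1 + |z|) ^ s * ‖w z‖ :=
    fun s w z => by
      rw [weighted, norm_smul, norm_pow, Real.norm_of_nonneg (Real.sqrt_nonneg _)]
      gcongr
      exact sqrt_one_add_sq_le z
  have k1 : L2le (weighted 1 f) (3 * K) := by
    have := L2le.of_norm_le (K := 1) (m 1 l0.1) ((l0.norm.add l0.norm hK hK).add l3.norm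
      (by positivity) hK) zero_le_one (ae_of_all _ fun z => (hn 1 f z).trans (by
        rw [norm_smul, norm_pow, Complex.norm_real, one_mul, pow_one]
        refine le_trans ?_ (Real.le_norm_self _)
        rw [Real.norm_eq_abs]
        have h1 : 1 + |z| ≤ 1 + 1 + |z| ^ 3 := by
          nlinarith [abs_nonneg z, sq_nonneg (|z| - 1), sq_nonneg |z|,
            mul_nonneg (abs_nonneg z) (sq_nonneg (|z| - 1))]
        have := mul_le_mul_of_nonneg_right h1 (norm_nonneg (f z))
        linarith))
    exact this.mono (by linarith)
  have k2 : L2le (weighted 1 (weakDeriv f)) (3 * K) := by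
    have := L2le.of_norm_le (K := 1) (m 1 hwm) ((lg.norm.add lk.norm hK hK).add l0.norm
      (by positivity) hK) zero_le_one (by
        filter_upwards [hw, ek] with z h1 h2
        refine (hn 1 _ z).trans ?_
        have h3 : |z| * ‖g z‖ ≤ ‖k z‖ + ‖f z‖ := by
          have : (z : ℂ) • g z = k z - f z := by rw [h2]; ring
          rw [← Real.norm_eq_abs, ← Complex.norm_real, ← norm_smul, this]
          exact norm_sub_le _ _
        rw [h1, pow_one, one_mul, Real.norm_of_nonneg (by positivity)]
        linarith)
    exact this.mono (by linarith)
  have k3 : L2le (weighted 3 f) (8 * K) := by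
    have := L2le.of_norm_le (K := 4) (m 3 l0.1) (l0.norm.add l3.norm hK hK) (by norm_num)
      (ae_of_all _ fun z => (hn 3 f z).trans (by
        rw [norm_smul, norm_pow, Complex.norm_real]
        refine le_trans ?_ (mul_le_mul_of_nonneg_left (Real.le_norm_self _) (by norm_num))
        rw [Real.norm_eq_abs]
        have h1 : (1 + |z|) ^ 3 ≤ 4 * (1 + |z| ^ 3) := by
          nlinarith [abs_nonneg z, mul_nonneg (add_nonneg zero_le_one (abs_nonneg z))
            (sq_nonneg (|z| - 1))]
        have := mul_le_mul_of_nonneg_right h1 (norm_nonneg (f z))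
        linarith))
    exact this.mono (by linarith)
  obtain ⟨m1, n1⟩ := memL2w_of_l2le (by positivity) k1
  obtain ⟨m2, n2⟩ := memL2w_of_l2le (by positivity) k2
  obtain ⟨m3, n3⟩ := memL2w_of_l2le (by positivity) k3
  refine ⟨⟨⟨m1, ⟨g, hg⟩, m2⟩, m3⟩, ?_⟩
  rw [normY, normH11]
  linarith

end AKNS

namespace AKNS
open Filter Topology NonlocalMKdV

/-! ## Jost functions and the model -/

/-- The entry `-σ u(-x)` of the potential matrix. -/
noncomputable def reflected (σ : ℝ) (u : ℝ → ℂ) (x : ℝ) : ℂ := -(σ : ℂ) * u (-x)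

/-- `(P, R)` solves the system `P' = e^{-2izx} u R`, `R' = e^{2izx} v P`. -/
structure SystemSolution (z : ℝ) (u v P R : ℝ → ℂ) : Prop where
  fst : ∀ x, HasDerivAt P (ph (-(2 * z * x)) * (u x * R x)) x
  snd : ∀ x, HasDerivAt R (ph (2 * z * x) * (v x * P x)) x

lemma SystemSolution.wronskian {z : ℝ} {u v P R P' R' : ℝ → ℂ} (h : SystemSolution z u v P R)
    (h' : SystemSolution z u v P' R') (x y : ℝ) :
    P x * R' x - R x * P' x = P y * R' y - R y * P' y := by
  refine is_const_of_deriv_eq_zero (f := fun x => P x * R' x - R x * P' x)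
    (fun x => (((h.fst x).mul (h'.snd x)).sub ((h.snd x).mul (h'.fst x))).differentiableAt)
    (fun x => ?_) x y
  have := (((h.fst x).mul (h'.snd x)).sub ((h.snd x).mul (h'.fst x))).deriv
  refine this.trans ?_
  ring

/-- The conserved Wronskian can be evaluated at infinity, where the Jost columns have known limits.
-/
lemma SystemSolution.wronskian_eq {z : ℝ} {u v P R P' R' : ℝ → ℂ} {p r p' r' : ℂ} {l : Filter ℝ}
    [l.NeBot] (h : SystemSolution z u v P R) (h' : SystemSolution z u v P' R')
    (hp : Tendsto P l (𝓝 p)) (hr : Tendsto R l (𝓝 r)) (hp' : Tendsto P' l (𝓝 p'))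
    (hr' : Tendsto R' l (𝓝 r')) (x : ℝ) : P x * R' x - R x * P' x = p * r' - r * p' :=
  tendsto_nhds_unique (tendsto_const_nhds.congr fun y => h.wronskian h' x y)
    ((hp.mul hr').sub (hr.mul hp'))

/-- The columns `(A, B)` and `(C, D)` solve the system, with limits `(1, 0)` and `(0, 1)` along the
filter `l`. -/
structure FundamentalSolution (z : ℝ) (u v A B C D : ℝ → ℂ) (l : Filter ℝ) : Prop where
  left : SystemSolution z u v A B
  right : SystemSolution z u v C D
  tendsto_A : Tendsto A l (𝓝 1)
  tendsto_B : Tendsto B l (𝓝 0)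
  tendsto_C : Tendsto C l (𝓝 0)
  tendsto_D : Tendsto D l (𝓝 1)

section Entries
variable (σ : ℝ) (u : ℝ → ℂ) (z : ℝ) (m : ℝ → Matrix (Fin 2) (Fin 2) ℂ) (x y : ℝ)

lemma expSigma3_eq (t : ℝ) : expSigma3 t = !![ph t, 0; 0, ph (-t)] := by
  simp [expSigma3, ph]

lemma volterraIntegrand_zero_zero :
    volterraIntegrand σ u z m x y 0 0 = u y * m y 1 0 := by
  have := ph_neg_mul_self (z * (y - x))
  simp only [volterraIntegrand, expSigma3_eq, Q, Matrix.mul_apply, Fin.sum_univ_two,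
    Matrix.of_apply, Matrix.cons_val', Matrix.cons_val_zero, Matrix.cons_val_one,
    Matrix.cons_val_fin_one]
  linear_combination (u y * m y 1 0) * this

lemma volterraIntegrand_one_one :
    volterraIntegrand σ u z m x y 1 1 = reflected σ u y * m y 0 1 := by
  have := ph_neg_mul_self (z * (y - x))
  simp only [volterraIntegrand, expSigma3_eq, Q, Matrix.mul_apply, Fin.sum_univ_two,
    Matrix.of_apply, Matrix.cons_val', Matrix.cons_val_zero, Matrix.cons_val_one,
    Matrix.cons_val_fin_one, neg_neg, reflected]
  linear_combination (-(σ : ℂ) * u (-y) * m y 0 1) * this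

/-- The conjugation doubles the phase off the diagonal, which is where `κ = ±2` comes from. The
factor depending on `x` splits off and is removed by passing to `colB`. -/
lemma volterraIntegrand_one_zero : volterraIntegrand σ u z m x y 1 0
    = ph (-(2 * z * x)) * (ph (2 * z * y) * (reflected σ u y * m y 0 0)) := by
  have : ph (z * (y - x)) * ph (z * (y - x)) = ph (-(2 * z * x)) * ph (2 * z * y) := by
    rw [← ph_add, ← ph_add]; congr 1; ring
  simp only [volterraIntegrand, expSigma3_eq, Q, Matrix.mul_apply, Fin.sum_univ_two,
    Matrix.of_apply, Matrix.cons_val', Matrix.cons_val_zero, Matrix.cons_val_one,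
    Matrix.cons_val_fin_one, neg_neg, reflected]
  linear_combination (-(σ : ℂ) * u (-y) * m y 0 0) * this

lemma volterraIntegrand_zero_one : volterraIntegrand σ u z m x y 0 1
    = ph (2 * z * x) * (ph (-(2 * z * y)) * (u y * m y 1 1)) := by
  have : ph (-(z * (y - x))) * ph (-(z * (y - x))) = ph (2 * z * x) * ph (-(2 * z * y)) := by
    rw [← ph_add, ← ph_add]; congr 1; ring
  simp only [volterraIntegrand, expSigma3_eq, Q, Matrix.mul_apply, Fin.sum_univ_two,
    Matrix.of_apply, Matrix.cons_val', Matrix.cons_val_zero, Matrix.cons_val_one,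
    Matrix.cons_val_fin_one]
  linear_combination (u y * m y 1 1) * this

end Entries

/-- A function given by tail integrals of `f`. -/
lemma hasDerivAt_of_eq_sub_tail {X f : ℝ → ℂ} {X₀ : ℂ} (hf : Integrable f) (hc : Continuous f)
    (h : ∀ x, X x = X₀ - tail f x) :
    (∀ x, HasDerivAt X (f x) x) ∧ Tendsto X atTop (𝓝 X₀) ∧ ∃ X₁, Tendsto X atBot (𝓝 X₁) := by
  have hX : X = fun x => X₀ - tail f x := funext h
  refine ⟨fun x => ?_, ?_, X₀ - ∫ y, f y, ?_⟩
  · have := (hasDerivAt_tail hf hc x).const_sub X₀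
    rwa [neg_neg, ← hX] at this
  · have := (tendsto_tail_atTop hf).const_sub X₀
    rwa [sub_zero, ← hX] at this
  · have := (tendsto_tail_atBot hf).const_sub X₀
    rwa [← hX] at this

lemma hasDerivAt_of_eq_add_integral_Iic {X f : ℝ → ℂ} {X₀ : ℂ} (hf : Integrable f)
    (hc : Continuous f) (h : ∀ x, X x = X₀ + ∫ y in Iic x, f y) :
    (∀ x, HasDerivAt X (f x) x) ∧ Tendsto X atBot (𝓝 X₀) := by
  have e : ∀ x, X x = (X₀ + ∫ y, f y) - tail f x := fun x => by
    rw [h, ← intervalIntegral.integral_Iic_add_Ioi hf.integrableOn hf.integrableOn (b := x), tail]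
    ring
  refine ⟨(hasDerivAt_of_eq_sub_tail hf hc e).1, ?_⟩
  have := (tendsto_tail_atBot hf).const_sub (X₀ + ∫ y, f y)
  rwa [add_sub_cancel_right, ← (funext e : X = _)] at this

/-! ### From the Volterra equations to the interaction picture -/

section Jost
variable {σ : ℝ} {u : ℝ → ℂ} {z : ℝ} {m : ℝ → Matrix (Fin 2) (Fin 2) ℂ}

lemma continuous_reflected (hu : Continuous u) : Continuous (reflected σ u) := by
  unfold reflected; fun_prop

lemma integrable_reflected (hi : Integrable u) : Integrable (reflected σ u) :=
  hi.comp_neg.const_mul _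

lemma integrable_phase_mul {w g : ℝ → ℂ} {C : ℝ} {s : ℝ → ℝ} (hs : Continuous s)
    (hw : Continuous w) (hwi : Integrable w) (hg : Continuous g) (hC : ∀ x, ‖g x‖ ≤ C) :
    Integrable fun y => ph (s y) * (w y * g y) := by
  refine (hwi.norm.mul_const C).mono' (Continuous.aestronglyMeasurable (by fun_prop))
    (ae_of_all _ fun y => ?_)
  rw [norm_mul, norm_ph, one_mul, norm_mul]
  exact mul_le_mul_of_nonneg_left (hC y) (norm_nonneg _)

/-- The upper left entry of the Jost function in the interaction picture. -/
noncomputable def colA (m : ℝ → Matrix (Fin 2) (Fin 2) ℂ) (x : ℝ) : ℂ := m x 0 0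

/-- The lower left entry in the interaction picture. -/
noncomputable def colB (z : ℝ) (m : ℝ → Matrix (Fin 2) (Fin 2) ℂ) (x : ℝ) : ℂ :=
  ph (2 * z * x) * m x 1 0

/-- The upper right entry in the interaction picture. -/
noncomputable def colC (z : ℝ) (m : ℝ → Matrix (Fin 2) (Fin 2) ℂ) (x : ℝ) : ℂ :=
  ph (-(2 * z * x)) * m x 0 1

/-- The lower right entry in the interaction picture. -/
noncomputable def colD (m : ℝ → Matrix (Fin 2) (Fin 2) ℂ) (x : ℝ) : ℂ := m x 1 1

lemma exists_bound_of_boundedContinuous (h : BoundedContinuous m) :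
    Continuous (colA m) ∧ Continuous (colB z m) ∧ Continuous (colC z m) ∧ Continuous (colD m) ∧
      ∃ C, (∀ x, ‖colA m x‖ ≤ C) ∧ (∀ x, ‖colB z m x‖ ≤ C) ∧ (∀ x, ‖colC z m x‖ ≤ C) ∧
        ∀ x, ‖colD m x‖ ≤ C := by
  obtain ⟨hc, C, hC⟩ := h
  have c : ∀ i j, Continuous fun x => m x i j := fun i j => hc.matrix_elem i j
  have c00 := c 0 0
  have c10 := c 1 0
  have c01 := c 0 1
  have c11 := c 1 1
  refine ⟨c00, by unfold colB; fun_prop, by unfold colC; fun_prop, c11, C, fun x => hC x 0 0,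
    fun x => ?_, fun x => ?_, fun x => hC x 1 1⟩
  · rw [colB, norm_mul, norm_ph, one_mul]; exact hC x 1 0
  · rw [colC, norm_mul, norm_ph, one_mul]; exact hC x 0 1

lemma integrand_zero_zero (x y : ℝ) : volterraIntegrand σ u z m x y 0 0
    = ph (-(2 * z * y)) * (u y * colB z m y) := by
  rw [volterraIntegrand_zero_zero, colB]
  linear_combination (-(u y * m y 1 0)) * ph_neg_mul_self (2 * z * y)

lemma integrand_one_one (x y : ℝ) : volterraIntegrand σ u z m x y 1 1
    = ph (2 * z * y) * (reflected σ u y * colC z m y) := by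
  rw [volterraIntegrand_one_one, colC]
  linear_combination (-(reflected σ u y * m y 0 1)) * ph_neg_mul_self (2 * z * y)

/-- Once the phases are absorbed, `x` enters each Volterra equation only as a limit of integration,
so the entries are tail integrals: differentiable, with the prescribed limits at `+∞` and with some
limits at `-∞`. -/
lemma fundamentalSolution_of_isJostPlus (hu : Continuous u) (hi : Integrable u)
    (h : IsJostPlus σ u z m) :
    FundamentalSolution z u (reflected σ u) (colA m) (colB z m) (colC z m) (colD m) atTop ∧
      ∃ a b c d, Tendsto (colA m) atBot (𝓝 a) ∧ Tendsto (colB z m) atBot (𝓝 b) ∧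
        Tendsto (colC z m) atBot (𝓝 c) ∧ Tendsto (colD m) atBot (𝓝 d) := by
  obtain ⟨cA, cB, cC, cD, K, bA, bB, bC, bD⟩ := exists_bound_of_boundedContinuous (z := z) h.1
  have hv := continuous_reflected (σ := σ) hu
  have hvi := integrable_reflected (σ := σ) hi
  have s1 : Continuous fun y : ℝ => -(2 * z * y) := by fun_prop
  have s2 : Continuous fun y : ℝ => 2 * z * y := by fun_prop
  obtain ⟨dA, tA, a, lA⟩ := hasDerivAt_of_eq_sub_tail (X := colA m) (X₀ := 1)
    (integrable_phase_mul s1 hu hi cB bB) (by fun_prop) (fun x => by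
      rw [colA, h.2 x 0 0, tail]
      simp only [integrand_zero_zero]
      simp)
  obtain ⟨dB, tB, b, lB⟩ := hasDerivAt_of_eq_sub_tail (X := colB z m) (X₀ := 0)
    (integrable_phase_mul s2 hv hvi cA bA) (by fun_prop) (fun x => by
      rw [colB, h.2 x 1 0, tail]
      simp only [volterraIntegrand_one_zero]
      rw [integral_const_mul, mul_sub, ← mul_assoc, ph_mul_neg_self]
      simp [colA])
  obtain ⟨dC, tC, c, lC⟩ := hasDerivAt_of_eq_sub_tail (X := colC z m) (X₀ := 0)
    (integrable_phase_mul s1 hu hi cD bD) (by fun_prop) (fun x => by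
      rw [colC, h.2 x 0 1, tail]
      simp only [volterraIntegrand_zero_one]
      rw [integral_const_mul, mul_sub, ← mul_assoc, ph_neg_mul_self]
      simp [colD])
  obtain ⟨dD, tD, d, lD⟩ := hasDerivAt_of_eq_sub_tail (X := colD m) (X₀ := 1)
    (integrable_phase_mul s2 hv hvi cC bC) (by fun_prop) (fun x => by
      rw [colD, h.2 x 1 1, tail]
      simp only [integrand_one_one]
      simp)
  exact ⟨⟨⟨dA, dB⟩, ⟨dC, dD⟩, tA, tB, tC, tD⟩, a, b, c, d, lA, lB, lC, lD⟩

lemma fundamentalSolution_of_isJostMinus (hu : Continuous u) (hi : Integrable u)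
    (h : IsJostMinus σ u z m) :
    FundamentalSolution z u (reflected σ u) (colA m) (colB z m) (colC z m) (colD m) atBot := by
  obtain ⟨cA, cB, cC, cD, K, bA, bB, bC, bD⟩ := exists_bound_of_boundedContinuous (z := z) h.1
  have hv := continuous_reflected (σ := σ) hu
  have hvi := integrable_reflected (σ := σ) hi
  have s1 : Continuous fun y : ℝ => -(2 * z * y) := by fun_prop
  have s2 : Continuous fun y : ℝ => 2 * z * y := by fun_prop
  obtain ⟨dA, tA⟩ := hasDerivAt_of_eq_add_integral_Iic (X := colA m) (X₀ := 1)
    (integrable_phase_mul s1 hu hi cB bB) (by fun_prop) (fun x => by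
      rw [colA, h.2 x 0 0]
      simp only [integrand_zero_zero]
      simp)
  obtain ⟨dB, tB⟩ := hasDerivAt_of_eq_add_integral_Iic (X := colB z m) (X₀ := 0)
    (integrable_phase_mul s2 hv hvi cA bA) (by fun_prop) (fun x => by
      rw [colB, h.2 x 1 0]
      simp only [volterraIntegrand_one_zero]
      rw [integral_const_mul, mul_add, ← mul_assoc, ph_mul_neg_self]
      simp [colA])
  obtain ⟨dC, tC⟩ := hasDerivAt_of_eq_add_integral_Iic (X := colC z m) (X₀ := 0)
    (integrable_phase_mul s1 hu hi cD bD) (by fun_prop) (fun x => by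
      rw [colC, h.2 x 0 1]
      simp only [volterraIntegrand_zero_one]
      rw [integral_const_mul, mul_add, ← mul_assoc, ph_neg_mul_self]
      simp [colD])
  obtain ⟨dD, tD⟩ := hasDerivAt_of_eq_add_integral_Iic (X := colD m) (X₀ := 1)
    (integrable_phase_mul s2 hv hvi cC bC) (by fun_prop) (fun x => by
      rw [colD, h.2 x 1 1]
      simp only [integrand_one_one]
      simp)
  exact ⟨⟨dA, dB⟩, ⟨dC, dD⟩, tA, tB, tC, tD⟩

/-! ### Existence of the Jost functions -/

/-- The operator `(p, r) ↦ (α r, β p)`. -/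
noncomputable def coupling (α β : ℂ) : (ℂ × ℂ) →L[ℝ] (ℂ × ℂ) :=
  α • ((ContinuousLinearMap.inl ℝ ℂ ℂ) ∘L (ContinuousLinearMap.snd ℝ ℂ ℂ))
    + β • ((ContinuousLinearMap.inr ℝ ℂ ℂ) ∘L (ContinuousLinearMap.fst ℝ ℂ ℂ))

lemma coupling_apply (α β : ℂ) (w : ℂ × ℂ) : coupling α β w = (α * w.2, β * w.1) := by
  simp [coupling]

lemma norm_coupling_le (α β : ℂ) : ‖coupling α β‖ ≤ ‖α‖ + ‖β‖ := by
  refine ContinuousLinearMap.opNorm_le_bound _ (by positivity) fun w => ?_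
  rw [coupling_apply, Prod.norm_def]
  have h1 : ‖w.1‖ ≤ ‖w‖ := norm_fst_le w
  have h2 : ‖w.2‖ ≤ ‖w‖ := norm_snd_le w
  refine max_le ?_ ?_
  · rw [norm_mul, add_mul]
    exact (mul_le_mul_of_nonneg_left h2 (norm_nonneg _)).trans
      (le_add_of_nonneg_right (by positivity))
  · rw [norm_mul, add_mul]
    exact (mul_le_mul_of_nonneg_left h1 (norm_nonneg _)).trans
      (le_add_of_nonneg_left (by positivity))

lemma continuous_coupling {α β : ℝ → ℂ} (hα : Continuous α) (hβ : Continuous β) :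
    Continuous fun x => coupling (α x) (β x) := by
  unfold coupling; fun_prop

/-- The matrix function with prescribed columns in the interaction picture. -/
noncomputable def ofColumns (z : ℝ) (N N' : ℝ → ℂ × ℂ) (x : ℝ) : Matrix (Fin 2) (Fin 2) ℂ :=
  !![(N x).1, ph (2 * z * x) * (N' x).1; ph (-(2 * z * x)) * (N x).2, (N' x).2]

lemma boundedContinuous_ofColumns {N N' : ℝ → ℂ × ℂ} {n₀ n₁ n₀' n₁' : ℂ × ℂ} (hN : Continuous N)
    (hN' : Continuous N') (h₀ : Tendsto N atTop (𝓝 n₀)) (h₁ : Tendsto N atBot (𝓝 n₁))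
    (h₀' : Tendsto N' atTop (𝓝 n₀')) (h₁' : Tendsto N' atBot (𝓝 n₁')) :
    BoundedContinuous (ofColumns z N N') := by
  obtain ⟨C, hC⟩ := exists_norm_le_of_tendsto hN h₀ h₁
  obtain ⟨C', hC'⟩ := exists_norm_le_of_tendsto hN' h₀' h₁'
  refine ⟨continuous_matrix fun i j => ?_, max C C', fun x i j => ?_⟩
  · fin_cases i <;> fin_cases j <;> simp [ofColumns] <;> fun_prop
  · have f := fun w : ℂ × ℂ => norm_fst_le w
    have s := fun w : ℂ × ℂ => norm_snd_le w
    fin_cases i <;> fin_cases j <;> simp only [ofColumns, Matrix.of_apply, Matrix.cons_val',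
      Matrix.cons_val_zero, Matrix.cons_val_one, Matrix.cons_val_fin_one, Fin.zero_eta,
      Fin.mk_one, norm_mul, norm_ph, one_mul]
    · exact ((f _).trans (hC x)).trans (le_max_left _ _)
    · exact ((f _).trans (hC' x)).trans (le_max_right _ _)
    · exact ((s _).trans (hC x)).trans (le_max_left _ _)
    · exact ((s _).trans (hC' x)).trans (le_max_right _ _)

lemma systemSolution_of_coupling {v : ℝ → ℂ} {N : ℝ → ℂ × ℂ}
    (h : ∀ x, HasDerivAt N
      (coupling (ph (-(2 * z * x)) * u x) (ph (2 * z * x) * v x) (N x)) x) :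
    SystemSolution z u v (fun x => (N x).1) (fun x => (N x).2) := by
  have hf := fun x => (ContinuousLinearMap.fst ℝ ℂ ℂ).hasFDerivAt.comp_hasDerivAt x (h x)
  have hs := fun x => (ContinuousLinearMap.snd ℝ ℂ ℂ).hasFDerivAt.comp_hasDerivAt x (h x)
  refine ⟨fun x => (hf x).congr_deriv ?_, fun x => (hs x).congr_deriv ?_⟩
  · simp [coupling_apply, mul_assoc]
  · simp [coupling_apply, mul_assoc]

lemma isJostPlus_of_fundamentalSolution (hu : Continuous u) (hi : Integrable u)
    (hb : BoundedContinuous m)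
    (h : FundamentalSolution z u (reflected σ u) (colA m) (colB z m) (colC z m) (colD m) atTop) :
    IsJostPlus σ u z m := by
  obtain ⟨cA, cB, cC, cD, K, bA, bB, bC, bD⟩ := exists_bound_of_boundedContinuous (z := z) hb
  have hv := continuous_reflected (σ := σ) hu
  have hvi := integrable_reflected (σ := σ) hi
  have s1 : Continuous fun y : ℝ => -(2 * z * y) := by fun_prop
  have s2 : Continuous fun y : ℝ => 2 * z * y := by fun_prop
  refine ⟨hb, fun x i j => ?_⟩
  fin_cases i <;> fin_cases j
  · simp only [Fin.zero_eta, integrand_zero_zero, Matrix.one_apply_eq]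
    rw [integral_Ioi_of_hasDerivAt_of_tendsto' (fun y _ => h.left.fst y)
      (integrable_phase_mul s1 hu hi cB bB).integrableOn h.tendsto_A, sub_sub_cancel]
    rfl
  · simp only [Fin.zero_eta, Fin.mk_one, volterraIntegrand_zero_one]
    rw [integral_const_mul]
    have := integral_Ioi_of_hasDerivAt_of_tendsto' (a := x) (fun y _ => h.right.fst y)
      (integrable_phase_mul s1 hu hi cD bD).integrableOn h.tendsto_C
    simp only [colC, colD] at this ⊢
    rw [this, zero_sub, mul_neg, ← mul_assoc, ph_mul_neg_self]
    simp
  · simp only [Fin.zero_eta, Fin.mk_one, volterraIntegrand_one_zero]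
    rw [integral_const_mul]
    have := integral_Ioi_of_hasDerivAt_of_tendsto' (a := x) (fun y _ => h.left.snd y)
      (integrable_phase_mul s2 hv hvi cA bA).integrableOn h.tendsto_B
    simp only [colA, colB] at this ⊢
    rw [this, zero_sub, mul_neg, ← mul_assoc, ph_neg_mul_self]
    simp
  · simp only [Fin.mk_one, integrand_one_one, Matrix.one_apply_eq]
    rw [integral_Ioi_of_hasDerivAt_of_tendsto' (fun y _ => h.right.snd y)
      (integrable_phase_mul s2 hv hvi cC bC).integrableOn h.tendsto_D, sub_sub_cancel]
    rfl

lemma isJostMinus_of_fundamentalSolution (hu : Continuous u) (hi : Integrable u)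
    (hb : BoundedContinuous m)
    (h : FundamentalSolution z u (reflected σ u) (colA m) (colB z m) (colC z m) (colD m) atBot) :
    IsJostMinus σ u z m := by
  obtain ⟨cA, cB, cC, cD, K, bA, bB, bC, bD⟩ := exists_bound_of_boundedContinuous (z := z) hb
  have hv := continuous_reflected (σ := σ) hu
  have hvi := integrable_reflected (σ := σ) hi
  have s1 : Continuous fun y : ℝ => -(2 * z * y) := by fun_prop
  have s2 : Continuous fun y : ℝ => 2 * z * y := by fun_prop
  refine ⟨hb, fun x i j => ?_⟩
  fin_cases i <;> fin_cases j
  · simp only [Fin.zero_eta, integrand_zero_zero, Matrix.one_apply_eq]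
    rw [integral_Iic_of_hasDerivAt_of_tendsto' (fun y _ => h.left.fst y)
      (integrable_phase_mul s1 hu hi cB bB).integrableOn h.tendsto_A, add_sub_cancel]
    rfl
  · simp only [Fin.zero_eta, Fin.mk_one, volterraIntegrand_zero_one]
    rw [integral_const_mul]
    have := integral_Iic_of_hasDerivAt_of_tendsto' (a := x) (fun y _ => h.right.fst y)
      (integrable_phase_mul s1 hu hi cD bD).integrableOn h.tendsto_C
    simp only [colC, colD] at this ⊢
    rw [this, sub_zero, ← mul_assoc, ph_mul_neg_self]
    simp
  · simp only [Fin.zero_eta, Fin.mk_one, volterraIntegrand_one_zero]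
    rw [integral_const_mul]
    have := integral_Iic_of_hasDerivAt_of_tendsto' (a := x) (fun y _ => h.left.snd y)
      (integrable_phase_mul s2 hv hvi cA bA).integrableOn h.tendsto_B
    simp only [colA, colB] at this ⊢
    rw [this, sub_zero, ← mul_assoc, ph_neg_mul_self]
    simp
  · simp only [Fin.mk_one, integrand_one_one, Matrix.one_apply_eq]
    rw [integral_Iic_of_hasDerivAt_of_tendsto' (fun y _ => h.right.snd y)
      (integrable_phase_mul s2 hv hvi cC bC).integrableOn h.tendsto_D, add_sub_cancel]
    rfl

lemma fundamentalSolution_ofColumns {v : ℝ → ℂ} {N N' : ℝ → ℂ × ℂ} {l : Filter ℝ}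
    (d : ∀ x, HasDerivAt N
      (coupling (ph (-(2 * z * x)) * u x) (ph (2 * z * x) * v x) (N x)) x)
    (d' : ∀ x, HasDerivAt N'
      (coupling (ph (-(2 * z * x)) * u x) (ph (2 * z * x) * v x) (N' x)) x)
    (t : Tendsto N l (𝓝 (1, 0))) (t' : Tendsto N' l (𝓝 (0, 1))) :
    FundamentalSolution z u v (colA (ofColumns z N N')) (colB z (ofColumns z N N'))
      (colC z (ofColumns z N N')) (colD (ofColumns z N N')) l := by
  have eA : colA (ofColumns z N N') = fun x => (N x).1 := rfl
  have eD : colD (ofColumns z N N') = fun x => (N' x).2 := rfl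
  have eB : colB z (ofColumns z N N') = fun x => (N x).2 := funext fun x => by
    change ph (2 * z * x) * (ph (-(2 * z * x)) * (N x).2) = _
    rw [← mul_assoc, ph_mul_neg_self, one_mul]
  have eC : colC z (ofColumns z N N') = fun x => (N' x).1 := funext fun x => by
    change ph (-(2 * z * x)) * (ph (2 * z * x) * (N' x).1) = _
    rw [← mul_assoc, ph_neg_mul_self, one_mul]
  rw [eA, eB, eC, eD]
  exact ⟨systemSolution_of_coupling d, systemSolution_of_coupling d', t.fst_nhds, t.snd_nhds,
    t'.fst_nhds, t'.snd_nhds⟩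

lemma continuous_coupling_phase {v : ℝ → ℂ} (hu : Continuous u) (hv : Continuous v) (z : ℝ) :
    Continuous fun x : ℝ => coupling (ph (-(2 * z * x)) * u x) (ph (2 * z * x) * v x) :=
  continuous_coupling (by fun_prop) (by fun_prop)

lemma norm_coupling_phase_le (u v : ℝ → ℂ) (z x : ℝ) :
    ‖coupling (ph (-(2 * z * x)) * u x) (ph (2 * z * x) * v x)‖ ≤ ‖u x‖ + ‖v x‖ := by
  refine (norm_coupling_le _ _).trans (le_of_eq ?_)
  rw [norm_mul, norm_mul, norm_ph, norm_ph, one_mul, one_mul]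

/-- Each column is solved in the interaction picture, where the coefficients are integrable, and the
phases are restored by `ofColumns`. -/
lemma exists_isJostPlus (hu : Continuous u) (hi : Integrable u) (σ z : ℝ) :
    ∃ m, IsJostPlus σ u z m := by
  have hv := continuous_reflected (σ := σ) hu
  have hL := continuous_coupling_phase hu hv z
  have hq := hi.norm.add (integrable_reflected (σ := σ) hi).norm
  have hc : Continuous fun x => ‖u x‖ + ‖reflected σ u x‖ := by fun_prop
  obtain ⟨N, n, d, t, b⟩ := exists_solution_atTop hL hq hc (norm_coupling_phase_le u _ z) (1, 0)
  obtain ⟨N', n', d', t', b'⟩ :=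
    exists_solution_atTop hL hq hc (norm_coupling_phase_le u _ z) (0, 1)
  have cN : Continuous N := continuous_iff_continuousAt.2 fun x => (d x).continuousAt
  have cN' : Continuous N' := continuous_iff_continuousAt.2 fun x => (d' x).continuousAt
  exact ⟨_, isJostPlus_of_fundamentalSolution hu hi (boundedContinuous_ofColumns cN cN' t b t' b')
    (fundamentalSolution_ofColumns d d' t t')⟩

lemma exists_isJostMinus (hu : Continuous u) (hi : Integrable u) (σ z : ℝ) :
    ∃ m, IsJostMinus σ u z m := by
  have hv := continuous_reflected (σ := σ) hu
  have hL := continuous_coupling_phase hu hv z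
  have hq := hi.norm.add (integrable_reflected (σ := σ) hi).norm
  have hc : Continuous fun x => ‖u x‖ + ‖reflected σ u x‖ := by fun_prop
  obtain ⟨N, n, d, b, t⟩ := exists_solution_atBot hL hq hc (norm_coupling_phase_le u _ z) (1, 0)
  obtain ⟨N', n', d', b', t'⟩ :=
    exists_solution_atBot hL hq hc (norm_coupling_phase_le u _ z) (0, 1)
  have cN : Continuous N := continuous_iff_continuousAt.2 fun x => (d x).continuousAt
  have cN' : Continuous N' := continuous_iff_continuousAt.2 fun x => (d' x).continuousAt
  exact ⟨_, isJostMinus_of_fundamentalSolution hu hi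
    (boundedContinuous_ofColumns cN cN' t b t' b') (fundamentalSolution_ofColumns d d' b b')⟩

/-! ### The scattering matrix -/

/-- For determinant one the inverse is the adjugate, so the entries of the product are Wronskians of
columns of `P` and `M`. -/
lemma scatteringMatrix_eq {M P : Matrix (Fin 2) (Fin 2) ℂ}
    (hM : M 0 0 * M 1 1 - M 1 0 * M 0 1 = 1) :
    M⁻¹ * P = !![P 0 0 * M 1 1 - P 1 0 * M 0 1, P 0 1 * M 1 1 - P 1 1 * M 0 1;
      M 0 0 * P 1 0 - M 1 0 * P 0 0, M 0 0 * P 1 1 - M 1 0 * P 0 1] := by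
  have hd : M.det = 1 := by rw [Matrix.det_fin_two, ← hM]; ring
  rw [Matrix.inv_def, hd, Ring.inverse_one, one_smul, Matrix.adjugate_fin_two]
  ext i j
  fin_cases i <;> fin_cases j <;> simp [Matrix.mul_apply, Fin.sum_univ_two] <;> ring

/-- At `x = 0` the scattering entries are Wronskians of columns of `m⁺` and `m⁻`. They are constant
in `x`, and at `-∞` the columns of `m⁻` become unit vectors, so the entries equal the limits of the
columns of `m⁺` there. -/
theorem exists_modelSolution_of_continuous (hu : Continuous u) (hi : Integrable u) (σ z : ℝ) :
    (∃ A B, ModelSolution 2 z u (reflected σ u) A B (NonlocalMKdV.a σ u z)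
      (NonlocalMKdV.b σ u z)) ∧
    ∃ A B, ModelSolution (-2) z (reflected σ u) u A B (NonlocalMKdV.d σ u z)
      (NonlocalMKdV.c σ u z) := by
  have hp : IsJostPlus σ u z (jostPlus σ u z) := by
    unfold jostPlus
    rw [dif_pos (exists_isJostPlus hu hi σ z)]
    exact (exists_isJostPlus hu hi σ z).choose_spec
  have hm : IsJostMinus σ u z (jostMinus σ u z) := by
    unfold jostMinus
    rw [dif_pos (exists_isJostMinus hu hi σ z)]
    exact (exists_isJostMinus hu hi σ z).choose_spec
  set p := jostPlus σ u z with hpd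
  set m := jostMinus σ u z with hmd
  obtain ⟨fp, a', b', c', d', la, lb, lc, ld⟩ := fundamentalSolution_of_isJostPlus hu hi hp
  have fm := fundamentalSolution_of_isJostMinus hu hi hm
  -- The phases are trivial at `x = 0`, where the scattering matrix is read off.
  have at0 : ∀ n : ℝ → Matrix (Fin 2) (Fin 2) ℂ, colA n 0 = n 0 0 0 ∧ colB z n 0 = n 0 1 0 ∧
      colC z n 0 = n 0 0 1 ∧ colD n 0 = n 0 1 1 := fun n => by simp [colA, colB, colC, colD]
  obtain ⟨p1, p2, p3, p4⟩ := at0 p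
  obtain ⟨m1, m2, m3, m4⟩ := at0 m
  have e0 := fm.left.wronskian_eq fm.right fm.tendsto_A fm.tendsto_B fm.tendsto_C fm.tendsto_D 0
  have e1 := fp.left.wronskian_eq fm.right la lb fm.tendsto_C fm.tendsto_D 0
  have e2 := fp.right.wronskian_eq fm.right lc ld fm.tendsto_C fm.tendsto_D 0
  have e3 := fm.left.wronskian_eq fp.left fm.tendsto_A fm.tendsto_B la lb 0
  have e4 := fm.left.wronskian_eq fp.right fm.tendsto_A fm.tendsto_B lc ld 0
  rw [p1, p2, m3, m4] at e1
  rw [p3, p4, m3, m4] at e2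
  rw [p1, p2, m1, m2] at e3
  rw [p3, p4, m1, m2] at e4
  rw [m1, m2, m3, m4] at e0
  simp only [mul_one, mul_zero, sub_zero, one_mul, zero_mul] at e0 e1 e2 e3 e4
  have hS : scatteringMatrix σ u z = !![a', c'; b', d'] := by
    rw [scatteringMatrix, ← hpd, ← hmd, scatteringMatrix_eq e0, e1, e2, e3, e4]
  have ha : NonlocalMKdV.a σ u z = a' := by rw [NonlocalMKdV.a, hS]; rfl
  have hb : NonlocalMKdV.b σ u z = b' := by rw [NonlocalMKdV.b, hS]; rfl
  have hc : NonlocalMKdV.c σ u z = c' := by rw [NonlocalMKdV.c, hS]; rfl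
  have hd : NonlocalMKdV.d σ u z = d' := by rw [NonlocalMKdV.d, hS]; rfl
  rw [ha, hb, hc, hd]
  -- The second column fits the model with `(D, C)` in place of `(A, B)`: this exchanges the two
  -- potentials and reverses the sign of `κ`.
  refine ⟨⟨_, _, fp.left.fst, fp.left.snd, fp.tendsto_A, fp.tendsto_B, la, lb⟩,
    ⟨_, _, fun x => ?_, fun x => ?_, fp.tendsto_D, fp.tendsto_C, ld, lc⟩⟩
  · have := fp.right.snd x
    rwa [show 2 * z * x = -(-2 * z * x) by ring] at this
  · have := fp.right.fst x
    rwa [show -(2 * z * x) = -2 * z * x by ring] at this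

end Jost

/-! ### Scattering data depend only on the almost everywhere class of the potential -/

lemma volterraIntegrand_ae_eq {u w : ℝ → ℂ} (h : u =ᵐ[volume] w) (σ z : ℝ)
    (m : ℝ → Matrix (Fin 2) (Fin 2) ℂ) (x : ℝ) (i j : Fin 2) :
    (fun y => volterraIntegrand σ u z m x y i j)
      =ᵐ[volume] fun y => volterraIntegrand σ w z m x y i j := by
  have h' : (fun y => u (-y)) =ᵐ[volume] fun y => w (-y) :=
    (Measure.measurePreserving_neg volume).quasiMeasurePreserving.ae_eq_comp h
  filter_upwards [h, h'] with y h1 h2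
  simp only [volterraIntegrand, Q, h1, h2]

/-- The predicates defining the Jost functions coincide for the two potentials, so the choices made
from them coincide as well; uniqueness of Jost functions is not needed. -/
lemma scatteringMatrix_congr {u w : ℝ → ℂ} (h : u =ᵐ[volume] w) (σ : ℝ) :
    scatteringMatrix σ u = scatteringMatrix σ w := by
  have e : ∀ (z : ℝ) (m : ℝ → Matrix (Fin 2) (Fin 2) ℂ) (s : Set ℝ) (x : ℝ) (i j : Fin 2),
      ∫ y in s, volterraIntegrand σ u z m x y i j = ∫ y in s, volterraIntegrand σ w z m x y i j :=
    fun z m s x i j => integral_congr_ae (ae_restrict_of_ae (volterraIntegrand_ae_eq h σ z m x i j))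
  have hp : IsJostPlus σ u = IsJostPlus σ w := by
    funext z m
    simp only [IsJostPlus, e]
  have hm : IsJostMinus σ u = IsJostMinus σ w := by
    funext z m
    simp only [IsJostMinus, e]
  have hp' : jostPlus σ u = jostPlus σ w := by
    unfold jostPlus
    rw [hp]
  have hm' : jostMinus σ u = jostMinus σ w := by
    unfold jostMinus
    rw [hm]
  funext z
  rw [scatteringMatrix, scatteringMatrix, hp', hm']

theorem exists_modelSolution {u w : ℝ → ℂ} (h : u =ᵐ[volume] w) (hw : Continuous w)
    (hi : Integrable w) (σ z : ℝ) :
    (∃ A B, ModelSolution 2 z w (reflected σ w) A B (NonlocalMKdV.a σ u z)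
      (NonlocalMKdV.b σ u z)) ∧
    ∃ A B, ModelSolution (-2) z (reflected σ w) w A B (NonlocalMKdV.d σ u z)
      (NonlocalMKdV.c σ u z) := by
  have := exists_modelSolution_of_continuous hw hi σ z
  simp only [NonlocalMKdV.a, NonlocalMKdV.b, NonlocalMKdV.c, NonlocalMKdV.d] at this ⊢
  rwa [scatteringMatrix_congr h]

end AKNS

namespace AKNS
open Filter Topology NonlocalMKdV

/-! ## Assembling the estimates -/

lemma L2le.comp_neg {E : Type*} [NormedAddCommGroup E] {f : ℝ → E} {C : ℝ} (h : L2le f C) :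
    L2le (fun x => f (-x)) C := by
  have hm := Measure.measurePreserving_neg (volume : Measure ℝ)
  exact ⟨h.1.comp_measurePreserving hm, (eLpNorm_comp_measurePreserving h.1 hm).le.trans h.2⟩

section Reflected
variable {σ : ℝ} {U : ℝ} {f f₁ f₂ f₃ : ℝ → ℂ}

lemma L2le.reflected (hσ : |σ| = 1) {g : ℝ → ℂ} (h : L2le g U) : L2le (AKNS.reflected σ g) U := by
  have := L2le.of_norm_le (f := AKNS.reflected σ g) (h.comp_neg.1.const_mul _) h.comp_neg
    zero_le_one (ae_of_all _ fun x => by simp [AKNS.reflected, hσ])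
  rwa [one_mul] at this

/-- Each differentiation of `u(-x)` changes the sign, hence `-σ` at odd orders; reflection and a
factor of modulus one preserve all the norms. -/
lemma Potential.reflected (hσ : |σ| = 1) (h : Potential U f f₁ f₂ f₃) :
    Potential U (AKNS.reflected σ f) (AKNS.reflected (-σ) f₁) (AKNS.reflected σ f₂)
      (AKNS.reflected (-σ) f₃) := by
  have hσ' : |-σ| = 1 := by rwa [abs_neg]
  have hd : ∀ {g g' : ℝ → ℂ} (s : ℝ), (∀ x, HasDerivAt g (g' x) x) → ∀ x,
      HasDerivAt (AKNS.reflected s g) (AKNS.reflected (-s) g' x) x := fun s hg x => by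
    have := ((hg (-x)).scomp x (hasDerivAt_neg x)).const_mul (-(s : ℂ))
    refine this.congr_deriv ?_
    simp [AKNS.reflected]
  have hw : ∀ {s : ℝ} {g : ℝ → ℂ}, |s| = 1 → L2le (fun y : ℝ => (y : ℂ) • g y) U →
      L2le (fun y : ℝ => (y : ℂ) • AKNS.reflected s g y) U := fun {s g} hs hg => by
    refine (hg.reflected (σ := -s) (by rwa [abs_neg])).congr (ae_of_all _ fun x => ?_)
    simp only [AKNS.reflected, smul_eq_mul]
    push_cast
    ring
  have d1 := hd (-σ) h.d1
  rw [neg_neg] at d1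
  refine ⟨hd σ h.d0, d1, ⟨fun x => ?_, h.s2.l2.reflected hσ, h.s2.l2'.reflected hσ'⟩,
    h.l0.reflected hσ, hw hσ h.w0, h.l1.reflected hσ', hw hσ' h.w1⟩
  simp only [AKNS.reflected]
  rw [intervalIntegral.integral_const_mul, intervalIntegral.integral_comp_neg, neg_zero,
    intervalIntegral.integral_symm, h.s2.prim (-x)]
  push_cast
  ring

end Reflected

lemma reflected_sub (σ : ℝ) (f g : ℝ → ℂ) :
    reflected σ (fun x => f x - g x) = fun x => reflected σ f x - reflected σ g x := by
  funext x
  simp [reflected, mul_sub]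

/-- The two signs of `κ` treat `(a, b)` and `(d, c)`. Passing to `C²` representatives is harmless,
since the scattering data see only the class of the potential. -/
theorem exists_lipschitz_bounds {σ : ℝ} (hσ : |σ| = 1) (U : ℝ) (hU : 0 ≤ U) :
    ∃ (C : ℝ) (K : ℝ → ℝ), 0 ≤ C ∧ (∀ δ > 0, 0 ≤ K δ) ∧ ∀ u v : ℝ → ℂ, MemX u → MemX v →
      normX u ≤ U → normX v ≤ U →
      (Continuous (a σ v) ∧ ∀ z : ℝ, ‖(z : ℂ) * (a σ v z - 1)‖ ≤ C) ∧
      (Continuous (d σ v) ∧ ∀ z : ℝ, ‖(z : ℂ) * (d σ v z - 1)‖ ≤ C) ∧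
      ∀ ε > 0, normX (u - v) ≤ ε →
      (∀ z, ‖a σ u z - a σ v z‖ ≤ C * ε) ∧ (∀ z, ‖d σ u z - d σ v z‖ ≤ C * ε) ∧
      ∀ δ > 0, RegularWith δ σ u → RegularWith δ σ v →
        ReflectionBounds (K δ * ε) (r₁ σ u - r₁ σ v) ∧
        ReflectionBounds (K δ * ε) (r₂ σ u - r₂ σ v) := by
  obtain ⟨C₁, K₁, hC₁, hK₁, h₁⟩ := exists_reflectionBounds (κ := 2) two_ne_zero U hU
  obtain ⟨C₂, K₂, hC₂, hK₂, h₂⟩ := exists_reflectionBounds (κ := -2) (by norm_num) U hU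
  refine ⟨C₁ + C₂, fun δ => K₁ δ + K₂ δ, by positivity,
    fun δ hδ => add_nonneg (hK₁ δ hδ) (hK₂ δ hδ), fun u v mu mv nu nv => ?_⟩
  obtain ⟨u₀, u₁, u₂, eu, eu₁, eu₂, du₀, du₁, pu⟩ := mu.exists_representative
  obtain ⟨v₀, v₁, v₂, ev, ev₁, ev₂, dv₀, dv₁, pv⟩ := mv.exists_representative
  have mono : ∀ {V W : ℝ} {f f₁ f₂ f₃ : ℝ → ℂ}, Potential V f f₁ f₂ f₃ → V ≤ W →
      Potential W f f₁ f₂ f₃ := fun h hVW =>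
    ⟨h.d0, h.d1, h.s2.mono hVW, h.l0.mono hVW, h.w0.mono hVW, h.l1.mono hVW, h.w1.mono hVW⟩
  have Pu := mono (potential_of_memX mu eu eu₁ eu₂ (ae_eq_refl _) du₀ du₁ pu) nu
  have Pv := mono (potential_of_memX mv ev ev₁ ev₂ (ae_eq_refl _) dv₀ dv₁ pv) nv
  have iu := (integrable_of_weighted hU Pu.l0 Pu.w0).1
  have iv := (integrable_of_weighted hU Pv.l0 Pv.w0).1
  have e := MemX.iterate_weakDeriv_sub mu mv
  have Pd : Potential (normX (u - v)) (fun x => u₀ x - v₀ x) (fun x => u₁ x - v₁ x)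
      (fun x => u₂ x - v₂ x) (fun x => (weakDeriv^[3] u) x - (weakDeriv^[3] v) x) := by
    refine potential_of_memX (mu.sub mv) (eu.sub ev) ((e 1 (by norm_num)).trans (eu₁.sub ev₁))
      ((e 2 (by norm_num)).trans (eu₂.sub ev₂)) (e 3 le_rfl)
      (fun x => (du₀ x).sub (dv₀ x)) (fun x => (du₁ x).sub (dv₁ x)) fun x => ?_
    rw [intervalIntegral.integral_sub (Pu.s2.l2'.intervalIntegrable _ _)
      (Pv.s2.l2'.intervalIntegrable _ _), pu x, pv x]
    ring
  have Rd := Pd.reflected hσ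
  simp only [reflected_sub] at Rd
  have Mu := exists_modelSolution eu Pu.c0.cont iu σ
  have Mv := exists_modelSolution ev Pv.c0.cont iv σ
  choose A B hAB using fun z => (Mu z).1
  choose D E hDE using fun z => (Mu z).2
  choose A' B' hAB' using fun z => (Mv z).1
  choose D' E' hDE' using fun z => (Mv z).2
  -- The potential `v` comes first in the pair, so that divided differences compute `u - v`.
  have key₁ := fun (ε : ℝ) (hε : 0 < ε) (hd : normX (u - v) ≤ ε) =>
    h₁ ε hε _ _ _ _ _ _ _ _ _ _ _ _ _ _ _ _ Pv (Pv.reflected hσ) Pu (Pu.reflected hσ)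
      (mono Pd hd) (mono Rd hd) A' B' A B _ _ _ _ hAB' hAB
  have key₂ := fun (ε : ℝ) (hε : 0 < ε) (hd : normX (u - v) ≤ ε) =>
    h₂ ε hε _ _ _ _ _ _ _ _ _ _ _ _ _ _ _ _ (Pv.reflected hσ) Pv (Pu.reflected hσ) Pu
      (mono Rd hd) (mono Pd hd) D' E' D E _ _ _ _ hDE' hDE
  -- The bounds on the coefficients of `v` alone do not involve `ε`; any admissible positive value
  -- serves to extract them.
  have hpos : 0 < normX (u - v) + 1 := by linarith [normX_nonneg (u - v)]
  obtain ⟨c₁, b₁, -⟩ := key₁ _ hpos (by linarith)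
  obtain ⟨c₂, b₂, -⟩ := key₂ _ hpos (by linarith)
  refine ⟨⟨c₁, fun z => (b₁ z).trans (by linarith)⟩, ⟨c₂, fun z => (b₂ z).trans (by linarith)⟩,
    fun ε hε hd => ?_⟩
  obtain ⟨-, -, l₁, r₁⟩ := key₁ ε hε hd
  obtain ⟨-, -, l₂, r₂⟩ := key₂ ε hε hd
  have rmono : ∀ {k K : ℝ} {f : ℝ → ℂ}, ReflectionBounds k f → k ≤ K → ReflectionBounds K f :=
    fun h hkK => ⟨h.cont, h.l2.trans (ENNReal.ofReal_le_ofReal hkK),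
      h.z3_l2.trans (ENNReal.ofReal_le_ofReal hkK), h.lip.mono hkK, h.z_lip.mono hkK⟩
  refine ⟨fun z => (l₁ z).trans ?_, fun z => (l₂ z).trans ?_, fun δ hδ hu hv => ⟨?_, ?_⟩⟩
  · exact mul_le_mul_of_nonneg_right (by linarith) hε.le
  · exact mul_le_mul_of_nonneg_right (by linarith) hε.le
  · exact rmono (r₁ δ hδ (fun z => (hv z).1) fun z => (hu z).1)
      (mul_le_mul_of_nonneg_right (by linarith [hK₂ δ hδ]) hε.le)
  · exact rmono (r₂ δ hδ (fun z => (hv z).2) fun z => (hu z).2)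
      (mul_le_mul_of_nonneg_right (by linarith [hK₁ δ hδ]) hε.le)

/-! ### Uniform lower bounds, comparison with the zero potential, final estimates -/

/-- For `|z| > 2C + 1` the decay of `f - 1` gives `|f| ≥ 1/2`; on the remaining compact interval the
minimum of `|f|` is attained and positive. -/
lemma exists_pos_le_norm {f : ℝ → ℂ} {C : ℝ} (hf : Continuous f)
    (hC : ∀ z : ℝ, ‖(z : ℂ) * (f z - 1)‖ ≤ C) (h0 : ∀ z, f z ≠ 0) :
    ∃ δ > 0, ∀ z, δ ≤ ‖f z‖ := by
  have hC0 : 0 ≤ C := (norm_nonneg _).trans (hC 0)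
  obtain ⟨w, -, hw⟩ := (isCompact_Icc (a := -(2 * C + 1)) (b := 2 * C + 1)).exists_isMinOn
    ⟨0, by constructor <;> linarith⟩ hf.norm.continuousOn
  refine ⟨min ‖f w‖ (1 / 2), lt_min (norm_pos_iff.2 (h0 w)) (by norm_num), fun z => ?_⟩
  by_cases hz : z ∈ Icc (-(2 * C + 1)) (2 * C + 1)
  · exact (min_le_left _ _).trans (hw hz)
  · refine (min_le_right _ _).trans ?_
    have hz' : 2 * C + 1 < |z| := lt_of_not_ge fun h => hz (abs_le.1 h)
    have h1 := hC z
    rw [norm_mul, Complex.norm_real, Real.norm_eq_abs] at h1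
    have h2 : ‖f z - 1‖ ≤ 1 / 2 := by
      by_contra h
      push Not at h
      nlinarith [norm_nonneg (f z - 1)]
    have h3 : ‖(1 : ℂ)‖ ≤ ‖f z‖ + ‖f z - 1‖ := by
      rw [← norm_neg (f z - 1)]
      refine le_trans (le_of_eq ?_) (norm_add_le _ _)
      congr 1
      ring
    rw [norm_one] at h3
    linarith

lemma exists_regularWith {σ : ℝ} (hσ : |σ| = 1) {u : ℝ → ℂ} (hu : MemX u) (h : Regular σ u) :
    ∃ δ > 0, RegularWith δ σ u := by
  obtain ⟨C, K, -, -, hmain⟩ := exists_lipschitz_bounds hσ (normX u) (normX_nonneg u)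
  obtain ⟨⟨ca, ba⟩, ⟨cd, bd⟩, -⟩ := hmain u u hu hu le_rfl le_rfl
  obtain ⟨δ, hδ, h1⟩ := exists_pos_le_norm ca ba fun z => (h z).1
  obtain ⟨δ', hδ', h2⟩ := exists_pos_le_norm cd bd fun z => (h z).2
  exact ⟨min δ δ', lt_min hδ hδ', fun z => ⟨(min_le_left _ _).trans (h1 z),
    (min_le_right _ _).trans (h2 z)⟩⟩

/-- For the zero potential the solutions of the model are constant; this supplies the base point
from which membership in `Y` follows by a difference estimate. -/
lemma scattering_zero (σ z : ℝ) : a σ 0 z = 1 ∧ b σ 0 z = 0 ∧ c σ 0 z = 0 ∧ d σ 0 z = 1 := by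
  have key : ∀ {κ : ℝ} {u v A B : ℝ → ℂ} {a b : ℂ}, (∀ x, u x = 0) → (∀ x, v x = 0) →
      ModelSolution κ z u v A B a b → a = 1 ∧ b = 0 := by
    intro κ u v A B a b hu hv h
    have hA : ∀ x y, A x = A y := is_const_of_deriv_eq_zero
      (fun x => (h.dA x).differentiableAt) fun x => by rw [(h.dA x).deriv, hu]; simp
    have hB : ∀ x y, B x = B y := is_const_of_deriv_eq_zero
      (fun x => (h.dB x).differentiableAt) fun x => by rw [(h.dB x).deriv, hv]; simp
    have cA : ∀ {l : Filter ℝ} [l.NeBot] {w : ℂ}, Tendsto A l (𝓝 w) → A 0 = w := fun ht =>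
      tendsto_nhds_unique (tendsto_const_nhds.congr fun x => hA 0 x) ht
    have cB : ∀ {l : Filter ℝ} [l.NeBot] {w : ℂ}, Tendsto B l (𝓝 w) → B 0 = w := fun ht =>
      tendsto_nhds_unique (tendsto_const_nhds.congr fun x => hB 0 x) ht
    exact ⟨(cA h.A_bot).symm.trans (cA h.A_top), (cB h.B_bot).symm.trans (cB h.B_top)⟩
  have hr : ∀ x, reflected σ 0 x = 0 := fun x => by simp [reflected]
  obtain ⟨⟨A, B, h⟩, A', B', h'⟩ := exists_modelSolution (ae_eq_refl (0 : ℝ → ℂ)) continuous_zero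
    (integrable_zero _ _ _) σ z
  obtain ⟨e1, e2⟩ := key (fun _ => rfl) hr h
  obtain ⟨e3, e4⟩ := key hr (fun _ => rfl) h'
  exact ⟨e1, e2, e4, e3⟩

theorem memY_reflection {σ : ℝ} (hσ : |σ| = 1) {u : ℝ → ℂ} (hu : MemX u) (h : Regular σ u) :
    MemY (r₁ σ u) ∧ MemY (r₂ σ u) := by
  obtain ⟨δ, hδ, hr⟩ := exists_regularWith hσ hu h
  have h0 : MemX 0 := sub_self u ▸ hu.sub hu
  obtain ⟨C, K, -, hK, hmain⟩ := exists_lipschitz_bounds hσ (max (normX u) (normX 0))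
    ((normX_nonneg u).trans (le_max_left _ _))
  obtain ⟨-, -, h1⟩ := hmain u 0 hu h0 (le_max_left _ _) (le_max_right _ _)
  have hpos : 0 < normX (u - 0) + 1 := by linarith [normX_nonneg (u - 0)]
  -- The lower bound must also hold for the zero potential, whose `a` and `d` are identically one.
  have hδ' : 0 < min δ 1 := lt_min hδ one_pos
  obtain ⟨-, -, h2⟩ := h1 _ hpos (by linarith)
  obtain ⟨b₁, b₂⟩ := h2 (min δ 1) hδ' (fun z => ⟨(min_le_left _ _).trans (hr z).1,
    (min_le_left _ _).trans (hr z).2⟩) (fun z => by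
      obtain ⟨e1, -, -, e4⟩ := scattering_zero σ z
      rw [e1, e4, norm_one]
      exact ⟨min_le_right _ _, min_le_right _ _⟩)
  have z₁ : r₁ σ 0 = 0 := funext fun z => by simp [r₁, (scattering_zero σ z).2.1]
  have z₂ : r₂ σ 0 = 0 := funext fun z => by simp [r₂, (scattering_zero σ z).2.2.1]
  rw [z₁, sub_zero (r₁ σ u)] at b₁
  rw [z₂, sub_zero (r₂ σ u)] at b₂
  have := mul_nonneg (hK _ hδ') hpos.le
  exact ⟨(b₁.memY this).1, (b₂.memY this).1⟩

theorem exists_normY_sub_le {σ : ℝ} (hσ : |σ| = 1) {U δ : ℝ} (hU : 0 ≤ U) (hδ : 0 < δ) :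
    ∃ C > (0 : ℝ), ∀ u v : ℝ → ℂ, MemX u → MemX v → normX u ≤ U → normX v ≤ U →
      RegularWith δ σ u → RegularWith δ σ v →
      normY (r₁ σ u - r₁ σ v) + normY (r₂ σ u - r₂ σ v) ≤ C * normX (u - v) := by
  obtain ⟨C, K, -, hK, hmain⟩ := exists_lipschitz_bounds hσ U hU
  have hKδ := hK δ hδ
  refine ⟨28 * K δ + 1, by positivity, fun u v hu hv nu nv ru rv => ?_⟩
  obtain ⟨-, -, h1⟩ := hmain u v hu hv nu nv
  have hN := normX_nonneg (u - v)
  -- The divided difference needs `ε > 0`, whereas `normX (u - v)` may vanish; a slack `η` is added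
  -- and removed again. The factor `28` is twice the constant of `ReflectionBounds.memY`, and the
  -- added one keeps the constant positive.
  refine le_of_forall_pos_le_add fun η hη => ?_
  have hη' : 0 < η / (28 * K δ + 1) := by positivity
  have hε : 0 < normX (u - v) + η / (28 * K δ + 1) := by positivity
  obtain ⟨-, -, h2⟩ := h1 _ hε (by linarith)
  obtain ⟨b₁, b₂⟩ := h2 δ hδ ru rv
  have hKε := mul_nonneg hKδ hε.le
  have n₁ := (b₁.memY hKε).2
  have n₂ := (b₂.memY hKε).2
  have h3 : (28 * K δ + 1) * (η / (28 * K δ + 1)) = η := by field_simp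
  nlinarith

theorem exists_neighbourhood {σ : ℝ} (hσ : |σ| = 1) {w : ℝ → ℂ} (hw : MemX w)
    (hr : Regular σ w) :
    ∃ ε > (0 : ℝ), ∃ δ > (0 : ℝ), ∃ U ≥ (0 : ℝ), ∀ u : ℝ → ℂ, MemX u → normX (u - w) < ε →
      normX u ≤ U ∧ RegularWith δ σ u := by
  obtain ⟨δ, hδ, hδw⟩ := exists_regularWith hσ hw hr
  have hU : 0 ≤ normX w + 1 := by linarith [normX_nonneg w]
  obtain ⟨C, K, hC, -, hmain⟩ := exists_lipschitz_bounds hσ (normX w + 1) hU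
  -- Radius at most one keeps `u` in the ball for which `C` was chosen; the other bound makes the
  -- change of `a` and `d` at most `δ/2`, with `C + 1` guarding against `C = 0`.
  refine ⟨min 1 (δ / (2 * (C + 1))), lt_min one_pos (by positivity), δ / 2, by positivity,
    normX w + 1, hU, fun u hu hd => ?_⟩
  have h1 : normX (u - w) ≤ 1 := hd.le.trans (min_le_left _ _)
  have hε : 0 < δ / (2 * (C + 1)) := by positivity
  have nu : normX u ≤ normX w + 1 := (normX_le_add hu hw).trans (by linarith)
  obtain ⟨-, -, h2⟩ := hmain u w hu hw nu (by linarith)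
  obtain ⟨la, ld, -⟩ := h2 _ hε (hd.le.trans (min_le_right _ _))
  have hCδ : C * (δ / (2 * (C + 1))) ≤ δ / 2 := by
    rw [mul_div_assoc', div_le_div_iff₀ (by positivity) (by positivity)]
    nlinarith
  have tri : ∀ {s t : ℂ}, ‖s - t‖ ≤ δ / 2 → δ ≤ ‖t‖ → δ / 2 ≤ ‖s‖ := fun {s t} h3 h4 => by
    have := norm_le_norm_add_norm_sub s t
    linarith
  exact ⟨nu, fun z => ⟨tri ((la z).trans hCδ) (hδw z).1, tri ((ld z).trans hCδ) (hδw z).2⟩⟩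

end AKNS

theorem mainTheorem3 (σ : ℝ) (hσ : σ = 1 ∨ σ = -1) :
    -- the reflection coefficients belong to the stated spaces
    (∀ u : ℝ → ℂ, NonlocalMKdV.MemX u → NonlocalMKdV.Regular σ u →
      NonlocalMKdV.MemY (NonlocalMKdV.r₁ σ u) ∧ NonlocalMKdV.MemY (NonlocalMKdV.r₂ σ u)) ∧
    -- Lipschitz estimate, uniform on bounded sets of potentials with `|a|, |d| ≥ δ`
    (∀ U > (0 : ℝ), ∀ δ > (0 : ℝ), ∃ C > (0 : ℝ), ∀ u v : ℝ → ℂ,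
      NonlocalMKdV.MemX u → NonlocalMKdV.MemX v →
      NonlocalMKdV.normX u ≤ U → NonlocalMKdV.normX v ≤ U →
      NonlocalMKdV.RegularWith δ σ u → NonlocalMKdV.RegularWith δ σ v →
      NonlocalMKdV.normY (NonlocalMKdV.r₁ σ u - NonlocalMKdV.r₁ σ v) +
          NonlocalMKdV.normY (NonlocalMKdV.r₂ σ u - NonlocalMKdV.r₂ σ v) ≤
        C * NonlocalMKdV.normX (u - v)) ∧
    -- the domain of the map is open and the map is Lipschitz near each of its points
    (∀ w : ℝ → ℂ, NonlocalMKdV.MemX w → NonlocalMKdV.Regular σ w →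
      ∃ ε > (0 : ℝ), ∃ C > (0 : ℝ),
        (∀ u : ℝ → ℂ, NonlocalMKdV.MemX u → NonlocalMKdV.normX (u - w) < ε →
          NonlocalMKdV.Regular σ u) ∧
        ∀ u v : ℝ → ℂ, NonlocalMKdV.MemX u → NonlocalMKdV.MemX v →
          NonlocalMKdV.normX (u - w) < ε → NonlocalMKdV.normX (v - w) < ε →
          NonlocalMKdV.normY (NonlocalMKdV.r₁ σ u - NonlocalMKdV.r₁ σ v) +
              NonlocalMKdV.normY (NonlocalMKdV.r₂ σ u - NonlocalMKdV.r₂ σ v) ≤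
            C * NonlocalMKdV.normX (u - v)) := by
  have hσ' : |σ| = 1 := by rcases hσ with rfl | rfl <;> simp
  refine ⟨fun u hu h => AKNS.memY_reflection hσ' hu h,
    fun U hU δ hδ => AKNS.exists_normY_sub_le hσ' hU.le hδ, fun w hw hr => ?_⟩
  obtain ⟨ε, hε, δ, hδ, U, hU, hnear⟩ := AKNS.exists_neighbourhood hσ' hw hr
  obtain ⟨C, hC, hlip⟩ := AKNS.exists_normY_sub_le hσ' hU hδ
  refine ⟨ε, hε, C, hC, fun u hu hd z => ?_, fun u v hu hv hdu hdv => ?_⟩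
  · have h := (hnear u hu hd).2 z
    exact ⟨norm_pos_iff.1 (hδ.trans_le h.1), norm_pos_iff.1 (hδ.trans_le h.2)⟩
  · exact hlip u v hu hv (hnear u hu hdu).1 (hnear v hv hdv).1 (hnear u hu hdu).2
      (hnear v hv hdv).2
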